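/- \textbf{Setting.} A seller offers two goods; bundles are $\mathbf q\in[0,1]^2$ and buyer types are $\mathbf x\in\mathcal X=[0,1]^2$, with utility $\mathbf x\cdot\mathbf q$. Types have a density $f\ge 0$ on $[0,1]^2$ with $\int_{\mathcal X} f=1$, continuously differentiable on $(0,1)^2$ and extended continuously to $[0,1]^2\setminus\{\mathbf 0\}$, such that $\lVert\mathbf x\rVert f(\mathbf x)$ is bounded on the boundary of $[0,1]^2$, $f(\mathbf x)>0$ for almost all $\mathbf x$ with $x_1=1$ or $x_2=1$, and $\phi(\mathbf x)=\mathbf x\cdot\nabla f(\mathbf x)+3f(\mathbf x)$ is bounded on $(0,1)^2$ and extends continuously to $\{0\}\times(0,1)$. The environment is \emph{SRS} (strictly regular and symmetric): $\phi>0$ almost everywhere and $f(x_1,x_2)=f(x_2,x_1)$. A (feasible) mechanism is a price schedule $p:[0,1]^2\to\mathbb R$ that is bounded below and has $p(\mathbf 0)=0$. Its indirect utility is $u(\mathbf x)=\sup_{\mathbf q\in[0,1]^2}\{\mathbf x\cdot\mathbf q-p(\mathbf q)\}$; it is \emph{symmetric} if $u(x_1,x_2)=u(x_2,x_1)$ on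 $\mathcal X$, and \emph{optimal} if it maximizes $\int_{\mathcal X}[\mathbf x\cdot\nabla u(\mathbf x)-u(\mathbf x)]f(\mathbf x)\,d\mathbf x$ among all feasible mechanisms. The demand set of $\mathbf q\in[0,1]^2$ is \[\mathcal D(\mathbf q)=\{\mathbf x\in\mathcal X:\ \mathbf x\cdot\mathbf q-u(\mathbf x)\ge\hat{\mathbf x}\cdot\mathbf q-u(\hat{\mathbf x})\ \text{for all }\hat{\mathbf x}\in\mathcal X\}.\] A bundle $\mathbf q\neq\mathbf 0$ is \emph{active} if for every $\delta>0$ the set $\bigcup_{\lVert\hat{\mathbf q}-\mathbf q\rVert<\delta}\mathcal D(\hat{\mathbf q})$ has positive measure with respect to $f$ (Euclidean norm, $\hat{\mathbf q}\in[0,1]^2$). An active bundle is \emph{pooling} if $\mathcal D(\mathbf q)$ has positive measure with respect to $f$, and \emph{separating} otherwise. Its marginal revenue is \[\mathrm{MR}(\mathbf q)=\int_{\mathcal D(\mathbf q)}\phi(\mathbf x)\,d\mathbf x-\int_{\mathcal D(\mathbf q)\cap\{x_1=1\text{ or }x_2=1\}}f(\mathbf x)\,(\mathbf x\cdot\mathbf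 n_{\mathbf x})\,d\sigma(\mathbf x),\] where $\mathbf n_{\mathbf x}$ is the outward unit normal and $\sigma$ is arc length. Let $\overline u(x)=u(x,1)$, with the conventions $\overline u'(0-)=0$ and $\overline u'(1+)=1$; for $q\in[0,1]$, let $[a^q,b^q]=\{x\in[0,1]:\overline u'(x-)\le q\le\overline u'(x+)\}$ (which is a nonempty closed interval); and let \[\Phi(x_1)=\int_{\max(1-\overline u(x_1),\,x_1)}^{1}\phi(x_1,x_2)\,dx_2-f(x_1,1).\] \textbf{Proposition.} Suppose that the environment is SRS. Then in any symmetric optimal mechanism: \begin{enumerate} \item If $(q_1,q_2)$ is active, then $q_1=1$ or $q_2=1$, and $(q_2,q_1)$ is also active. \item If $(q,1)$ is pooling, then $\mathrm{MR}(q,1)=0$ and $\int_{a^q}^{b^q}\Phi(x_1)\,dx_1=0$. Moreover, $\Phi(a^q)\ge 0$ unless $q=0$, and $\Phi(b^q)\ge 0$ unless $q=1$. The grand bundle $(1,1)$ is pooling. \item If $(q,1)$ is separating, then $a^q=b^q$ and $\Phi(a^q)=0$. \end{enumerate} -/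

import Mathlib

open Set Filter Topology MeasureTheory

noncomputable section

namespace TwoGoods

/-- The square `[0,1]²`: both the type space and the allocation space. -/
def square : Set (ℝ × ℝ) := Icc 0 1 ×ˢ Icc 0 1

/-- The open square `(0,1)²`. -/
def openSquare : Set (ℝ × ℝ) := Ioo 0 1 ×ˢ Ioo 0 1

/-- The standard inner product of two vectors of the plane. -/
def dot (x q : ℝ × ℝ) : ℝ := x.1 * q.1 + x.2 * q.2

/-- `x · ∇f(x) + 3 f(x)`; meaningful at interior types, where `f` is differentiable. -/
def phiInt (f : ℝ × ℝ → ℝ) (x : ℝ × ℝ) : ℝ := fderiv ℝ f x x + 3 * f x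

/-- The marginal revenue density `φ(x) = x · ∇f(x) + 3 f(x)`, extended from the open square to its
boundary by continuity. -/
def phi (f : ℝ × ℝ → ℝ) : ℝ × ℝ → ℝ := extendFrom openSquare (phiInt f)

/-- Standing assumptions on the density `f` of the type distribution on the square. -/
structure IsTypeDensity (f : ℝ × ℝ → ℝ) : Prop where
  nonneg : ∀ x ∈ square, 0 ≤ f x
  integral_eq_one : ∫ x in square, f x = 1
  contDiffOn : ContDiffOn ℝ 1 f openSquare
  /-- The values of `f` on the boundary (except possibly at the origin) are those given by
  continuity. -/
  continuousOn : ContinuousOn f (square \ {0})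
  bounded_boundary : ∃ C : ℝ, ∀ x ∈ square \ openSquare, ‖x‖ * f x ≤ C
  phi_bounded : ∃ C : ℝ, ∀ x ∈ openSquare, |phiInt f x| ≤ C
  /-- `φ` extends continuously to the open left edge, so that `φ(0, ·)` makes sense. -/
  phi_left : ∀ y ∈ Ioo (0 : ℝ) 1, ∃ l : ℝ, Tendsto (phiInt f) (𝓝[openSquare] (0, y)) (𝓝 l)
  pos_top : ∀ᵐ t ∂(volume.restrict (Icc (0 : ℝ) 1)), 0 < f (t, 1) ∧ 0 < f (1, t)

/-- A strictly regular and symmetric (SRS) environment. -/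
structure IsSRS (f : ℝ × ℝ → ℝ) : Prop extends IsTypeDensity f where
  strictly_regular : ∀ᵐ x ∂(volume.restrict openSquare), 0 < phiInt f x
  symmetric : ∀ x ∈ square, f x.swap = f x

/-- The distribution of types. -/
def typeMeasure (f : ℝ × ℝ → ℝ) : Measure (ℝ × ℝ) :=
  (volume.restrict square).withDensity (fun x => ENNReal.ofReal (f x))

/-- A price schedule `p : [0,1]² → ℝ` (values outside the square are never used) is feasible if
`p(0) = 0`; boundedness below says that the indirect utility is finite. -/
structure IsFeasible (p : ℝ × ℝ → ℝ) : Prop where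
  zero : p 0 = 0
  bddBelow : BddBelow (p '' square)

/-- The indirect utility `u(x) = sup_{q ∈ [0,1]²} (x · q - p(q))`. -/
def utility (p : ℝ × ℝ → ℝ) (x : ℝ × ℝ) : ℝ := sSup ((fun q => dot x q - p q) '' square)

/-- Total revenue `∫ (x · ∇u(x) - u(x)) f(x) dx`. -/
def totalRevenue (f p : ℝ × ℝ → ℝ) : ℝ :=
  ∫ x in square, (fderiv ℝ (utility p) x x - utility p x) * f x

/-- `p` maximizes total revenue among all feasible price schedules. -/
structure IsOptimal (f p : ℝ × ℝ → ℝ) : Prop where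
  feasible : IsFeasible p
  le : ∀ p' : ℝ × ℝ → ℝ, IsFeasible p' → totalRevenue f p' ≤ totalRevenue f p

/-- The mechanism is symmetric: its indirect utility is a symmetric function of the type. -/
def IsSymmetric (p : ℝ × ℝ → ℝ) : Prop := ∀ x ∈ square, utility p x.swap = utility p x

/-- The subdifferential `∂u(x)`, as a set of feasible bundles. -/
def subdiff (p : ℝ × ℝ → ℝ) (x : ℝ × ℝ) : Set (ℝ × ℝ) :=
  {q | q ∈ square ∧ ∀ y ∈ square, dot y q - utility p y ≤ dot x q - utility p x}

/-- The demand set `𝒟(q)`. -/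
def demand (p : ℝ × ℝ → ℝ) (q : ℝ × ℝ) : Set (ℝ × ℝ) := {x | x ∈ square ∧ q ∈ subdiff p x}

/-- Euclidean distance in the plane. -/
def eDist (q r : ℝ × ℝ) : ℝ := Real.sqrt ((q.1 - r.1) ^ 2 + (q.2 - r.2) ^ 2)

/-- Active bundles: nonzero bundles all of whose neighbourhoods are purchased by a set of types of
positive measure. -/
def IsActive (f p : ℝ × ℝ → ℝ) (q : ℝ × ℝ) : Prop :=
  q ∈ square ∧ q ≠ 0 ∧
    ∀ δ : ℝ, 0 < δ → 0 < typeMeasure f (⋃ r ∈ {r : ℝ × ℝ | eDist r q < δ}, demand p r)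

/-- Pooling bundles: active, with a demand set of positive measure. -/
def IsPooling (f p : ℝ × ℝ → ℝ) (q : ℝ × ℝ) : Prop :=
  IsActive f p q ∧ 0 < typeMeasure f (demand p q)

/-- Separating bundles: active but not pooling. -/
def IsSeparating (f p : ℝ × ℝ → ℝ) (q : ℝ × ℝ) : Prop :=
  IsActive f p q ∧ ¬ IsPooling f p q

/-- Marginal revenue
`∫_{𝒟(q)} φ dx - ∫_{𝒟(q) ∩ {x₁ = 1 or x₂ = 1}} f(x) (x · n_x) dσ(x)`.
The two line integrals are over the top and the right edge, on which `x · n_x = 1`. -/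
def marginalRevenue (f p : ℝ × ℝ → ℝ) (q : ℝ × ℝ) : ℝ :=
  (∫ x in demand p q, phi f x) -
    ((∫ t in {t : ℝ | (t, (1 : ℝ)) ∈ demand p q}, f (t, 1)) +
      ∫ t in {t : ℝ | ((1 : ℝ), t) ∈ demand p q}, f (1, t))

/-- `ū(t) = u(t, 1)`. -/
def ubar (p : ℝ × ℝ → ℝ) (t : ℝ) : ℝ := utility p (t, 1)

/-- The left derivative `ū'(x-)` on `[0,1]`, with the convention `ū'(0-) = 0`. -/
def ubarLeft (p : ℝ × ℝ → ℝ) (x : ℝ) : ℝ := if x ≤ 0 then 0 else derivWithin (ubar p) (Iio x) x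

/-- The right derivative `ū'(x+)` on `[0,1]`, with the convention `ū'(1+) = 1`. -/
def ubarRight (p : ℝ × ℝ → ℝ) (x : ℝ) : ℝ := if 1 ≤ x then 1 else derivWithin (ubar p) (Ioi x) x

/-- `{x ∈ [0,1] : ū'(x-) ≤ q ≤ ū'(x+)}`. -/
def buyers (p : ℝ × ℝ → ℝ) (q : ℝ) : Set ℝ :=
  {x | x ∈ Icc (0 : ℝ) 1 ∧ ubarLeft p x ≤ q ∧ q ≤ ubarRight p x}

/-- The left end point `a^q` of `buyers p q`. -/
def lowerEnd (p : ℝ × ℝ → ℝ) (q : ℝ) : ℝ := sInf (buyers p q)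

/-- The right end point `b^q` of `buyers p q`. -/
def upperEnd (p : ℝ × ℝ → ℝ) (q : ℝ) : ℝ := sSup (buyers p q)

/-- `Φ(x₁) = ∫_{max(1 - ū(x₁), x₁)}^1 φ(x₁, x₂) dx₂ - f(x₁, 1)`. -/
def Phi (f p : ℝ × ℝ → ℝ) (t : ℝ) : ℝ :=
  (∫ y in (max (1 - ubar p t) t)..1, phi f (t, y)) - f (t, 1)

end TwoGoods

end

open scoped Pointwise

namespace TwoGoods

/-! ### The density -/

/-! By symmetry it suffices to study types with `x₁ < x₂`. Integration by parts along rays from the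
origin (`IsTypeDensity.setIntegral_triangle_revenue`) writes half the revenue as `∫ u(s,1) f(s,1)
ds` minus the integral of `u φ` over the triangle. Given the restriction `ū` to the top edge, `u`
should therefore be as small as possible. A slope of at most 1 in `x₂` forces `u ≥ max 0 (ū(x₁) + x₂
- 1)`, and this bound is itself implementable. Since `φ > 0` almost everywhere, an optimal `u`
attains it (`IsOptimal.utility_eq`), so almost every type buys nothing or one of the goods for sure.

What remains is a concave problem over convex functions `ū` on the unit interval with slopes and
initial value in `[0,1]`. The derivative of the objective is `-Φ`, so `∫ (w - ū) Φ ≥ 0` for every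
competitor `w` (`IsOptimal.integral_Phi_mul_nonneg`). Put `P(s) = ∫_s^1 Φ`. Integrating by parts
makes this functional linear in the initial value, with weight `P(0)`, and in the increments of the
slope, with weight `∫_s^1 P`. Moving an increment elsewhere cannot help, so the slope increases only
where `∫_s^1 P` is minimal (`IsStationary.tail_tail_le`). At such a kink the first- and second-order
conditions read `P = 0` and `Φ ≥ 0` (`IsOptimal.of_isKink`).

The end points of `[a^q, b^q]` are kinks, except that `a^0` and `b^1` need separate arguments. Hence
`∫ Φ = P(a^q) - P(b^q)` vanishes for a pooling bundle, and this integral is its marginal revenue, up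
to a factor 2 for the grand bundle. For a separating bundle, kinks accumulate at the single buyer,
so zeros of `P` do, and `P' = -Φ` vanishes there. If the grand bundle were not pooling, 1 would be a
kink, so `∫_s^1 P` would be minimal at `s = 1`, with value 0. But for `s` near 1 this quantity is
`-s` times the mass of the types with `s < x₁ < x₂`, which is negative (`IsOptimal.tail_tail_neg`).
-/

lemma isOpen_openSquare : IsOpen openSquare := isOpen_Ioo.prod isOpen_Ioo

lemma measurableSet_square : MeasurableSet square := measurableSet_Icc.prod measurableSet_Icc

lemma openSquare_subset_square : openSquare ⊆ square :=
  prod_mono Ioo_subset_Icc_self Ioo_subset_Icc_self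

lemma isCompact_square : IsCompact square := isCompact_Icc.prod isCompact_Icc

lemma closure_openSquare : closure openSquare = square := by
  rw [openSquare, closure_prod_eq, closure_Ioo zero_ne_one]; rfl

lemma openSquare_ae_eq_square : openSquare =ᵐ[volume] square :=
  Measure.set_prod_ae_eq Ioo_ae_eq_Icc Ioo_ae_eq_Icc

variable {f : ℝ × ℝ → ℝ}

lemma IsTypeDensity.continuousOn_phiInt (hf : IsTypeDensity f) :
    ContinuousOn (phiInt f) openSquare :=
  ((hf.contDiffOn.continuousOn_fderiv_of_isOpen isOpen_openSquare le_rfl).clm_apply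
    continuousOn_id).add (continuousOn_const.mul hf.contDiffOn.continuousOn)

lemma IsTypeDensity.hasFDerivAt (hf : IsTypeDensity f) {x : ℝ × ℝ} (hx : x ∈ openSquare) :
    HasFDerivAt f (fderiv ℝ f x) x :=
  ((hf.contDiffOn.differentiableOn one_ne_zero).differentiableAt
    (isOpen_openSquare.mem_nhds hx)).hasFDerivAt

lemma IsTypeDensity.phi_eq (hf : IsTypeDensity f) {x : ℝ × ℝ} (hx : x ∈ openSquare) :
    phi f x = phiInt f x :=
  extendFrom_eq (subset_closure hx) (hf.continuousOn_phiInt x hx)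

lemma IsTypeDensity.continuousOn_phi (hf : IsTypeDensity f) :
    ContinuousOn (phi f) (Ico 0 1 ×ˢ Ioo 0 1) := by
  refine continuousOn_extendFrom ?_ ?_
  · rw [closure_openSquare]
    exact prod_mono Ico_subset_Icc_self Ioo_subset_Icc_self
  · rintro ⟨a, b⟩ ⟨ha, hb⟩
    rcases eq_or_lt_of_le ha.1 with h | h
    · simp only at h
      subst h
      exact hf.phi_left b hb
    · exact ⟨_, hf.continuousOn_phiInt (a, b) ⟨⟨h, ha.2⟩, hb⟩⟩

/-- Continuity turns the almost-everywhere sign into a pointwise one: a nonempty open set where `φ <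
0` would have positive measure. -/
lemma IsSRS.phiInt_nonneg (hf : IsSRS f) {x : ℝ × ℝ} (hx : x ∈ openSquare) :
    0 ≤ phiInt f x := by
  have ho : IsOpen (openSquare ∩ phiInt f ⁻¹' Iio 0) :=
    hf.continuousOn_phiInt.isOpen_inter_preimage isOpen_openSquare isOpen_Iio
  have h0 : volume (openSquare ∩ phiInt f ⁻¹' Iio 0) = 0 := by
    have := (ae_restrict_iff' isOpen_openSquare.measurableSet).1 hf.strictly_regular
    refine measure_mono_null ?_ (ae_iff.1 this)
    rintro y ⟨hy, hy'⟩
    simp only [mem_preimage, mem_Iio] at hy'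
    simp only [mem_ofPred_eq, Classical.not_imp, not_lt]
    exact ⟨hy, hy'.le⟩
  rw [ho.measure_eq_zero_iff volume] at h0
  by_contra! h
  exact (h0 ▸ (⟨hx, h⟩ : x ∈ openSquare ∩ phiInt f ⁻¹' Iio 0) : x ∈ (∅ : Set (ℝ × ℝ)))

lemma IsTypeDensity.integrableOn (hf : IsTypeDensity f) : IntegrableOn f square := by
  by_contra h
  have := hf.integral_eq_one
  rw [integral_undef h] at this
  exact zero_ne_one this

lemma smul_mem_openSquare {x : ℝ × ℝ} (hx : x ∈ openSquare) {t : ℝ} (h0 : 0 < t) (h1 : t ≤ 1) :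
    t • x ∈ openSquare := by
  obtain ⟨⟨h2, h3⟩, h4, h5⟩ := hx
  refine ⟨⟨mul_pos h0 h2, ?_⟩, mul_pos h0 h4, ?_⟩
  · show t * x.1 < 1
    nlinarith
  · show t * x.2 < 1
    nlinarith

lemma hasDerivAt_smul_const (x : ℝ × ℝ) (t : ℝ) : HasDerivAt (fun t : ℝ => t • x) x t := by
  simpa using (hasDerivAt_id t).smul_const x

/-! ### Radial derivatives, boundedness and positivity of the density. -/

lemma IsTypeDensity.hasDerivAt_ray (hf : IsTypeDensity f) {x : ℝ × ℝ} {t : ℝ}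
    (hx : t • x ∈ openSquare) :
    HasDerivAt (fun t : ℝ => f (t • x)) (fderiv ℝ f (t • x) x) t :=
  (hf.hasFDerivAt hx).comp_hasDerivAt t (hasDerivAt_smul_const x t)

lemma IsTypeDensity.hasDerivAt_cube_mul (hf : IsTypeDensity f) {x : ℝ × ℝ} {t : ℝ}
    (hx : t • x ∈ openSquare) :
    HasDerivAt (fun t : ℝ => t ^ 3 * f (t • x)) (t ^ 2 * phiInt f (t • x)) t := by
  refine ((hasDerivAt_pow 3 t).fun_mul (hf.hasDerivAt_ray hx)).congr_deriv ?_
  simp only [phiInt, map_smul, smul_eq_mul]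
  push_cast
  ring

/-- The derivative of `t³ f(tx)` is `t² φ(tx) ≤ C t²`, so `t³ f(tx) - (C/3) t³` decreases in `t`;
compare its values at `t` and at 1. -/
lemma IsTypeDensity.le_cube_mul (hf : IsTypeDensity f) {C : ℝ}
    (hC : ∀ x ∈ openSquare, |phiInt f x| ≤ C) {x : ℝ × ℝ} (hx : x ∈ openSquare) {t : ℝ}
    (h0 : 0 < t) (h1 : t ≤ 1) : f x - C / 3 ≤ t ^ 3 * f (t • x) := by
  have hC0 : 0 ≤ C := (abs_nonneg _).trans (hC x hx)
  have hd : ∀ s ∈ Icc t 1, HasDerivAt (fun s : ℝ => s ^ 3 * f (s • x) - C / 3 * s ^ 3)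
      (s ^ 2 * phiInt f (s • x) - C * s ^ 2) s := by
    intro s hs
    refine ((hf.hasDerivAt_cube_mul (smul_mem_openSquare hx (h0.trans_le hs.1) hs.2)).fun_sub
      ((hasDerivAt_pow 3 s).const_mul (C / 3))).congr_deriv ?_
    push_cast
    ring
  have hanti : AntitoneOn (fun s : ℝ => s ^ 3 * f (s • x) - C / 3 * s ^ 3) (Icc t 1) := by
    refine antitoneOn_of_deriv_nonpos (convex_Icc _ _)
      (fun s hs => (hd s hs).continuousAt.continuousWithinAt)
      (fun s hs => (hd s (interior_subset hs)).differentiableAt.differentiableWithinAt) ?_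
    intro s hs
    have hs' := interior_subset hs
    rw [(hd s hs').deriv]
    have := (abs_le.1 (hC _ (smul_mem_openSquare hx (h0.trans_le hs'.1) hs'.2))).2
    nlinarith [sq_nonneg s]
  have := hanti (left_mem_Icc.2 h1) (right_mem_Icc.2 h1) h1
  simp only [one_pow, one_smul, one_mul, mul_one] at this
  have h3 : 0 ≤ C / 3 * t ^ 3 := by positivity
  linarith

/-- A bounded marginal revenue density forces a bounded type density: otherwise the mass of small
homothetic copies of an open set would blow up. -/
lemma IsTypeDensity.le_of_phi_le (hf : IsTypeDensity f) {C : ℝ}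
    (hC : ∀ x ∈ openSquare, |phiInt f x| ≤ C) {x : ℝ × ℝ} (hx : x ∈ openSquare) :
    f x ≤ C / 3 := by
  by_contra! hlt
  obtain ⟨c, hc1, hc2⟩ := exists_between hlt
  set U := openSquare ∩ f ⁻¹' Ioi c with hU
  have hUo : IsOpen U :=
    hf.contDiffOn.continuousOn.isOpen_inter_preimage isOpen_openSquare isOpen_Ioi
  have hUfin : volume U ≠ ⊤ :=
    ((measure_mono (inter_subset_left.trans openSquare_subset_square)).trans_lt
      isCompact_square.measure_lt_top).ne
  have hm : 0 < volume.real U :=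
    ENNReal.toReal_pos (hUo.measure_pos volume ⟨x, hx, hc2⟩).ne' hUfin
  set m := volume.real U
  set η := c - C / 3
  have hη : 0 < η := sub_pos.2 hc1
  -- The copy `t • U` has area `t² m` and density at least `η / t³`, hence mass at least `η m / t`.
  -- This choice makes that at least 2, or gives `t = 1`; the first bound alone contradicts total
  -- mass 1.
  set t := min 1 (η * m / 2)
  have ht0 : 0 < t := lt_min one_pos (by positivity)
  have ht1 : t ≤ 1 := min_le_left _ _
  have ht2 : t ≤ η * m / 2 := min_le_right _ _
  have hsub : t • U ⊆ square := by
    rintro _ ⟨y, hy, rfl⟩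
    exact openSquare_subset_square (smul_mem_openSquare hy.1 ht0 ht1)
  have hvol : volume.real (t • U) = t ^ 2 * m := by
    rw [measureReal_def, Measure.addHaar_smul]
    simp only [Module.finrank_prod, Module.finrank_self, ENNReal.toReal_mul]
    rw [ENNReal.toReal_ofReal (abs_nonneg _), abs_of_nonneg (by positivity)]
    rfl
  have hmeas : MeasurableSet (t • U) := (hUo.smul₀ ht0.ne').measurableSet
  have h1 : η / t ^ 3 * volume.real (t • U) ≤ ∫ y in t • U, f y := by
    refine setIntegral_ge_of_const_le_real hmeas ?_ ?_ (hf.integrableOn.mono_set hsub)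
    · exact ((measure_mono hsub).trans_lt isCompact_square.measure_lt_top).ne
    · rintro _ ⟨y, hy, rfl⟩
      have h3 := hf.le_cube_mul hC hy.1 ht0 ht1
      have h4 : c < f y := hy.2
      rw [div_le_iff₀ (by positivity)]
      show c - C / 3 ≤ _
      linarith
  have h2 : ∫ y in t • U, f y ≤ 1 := by
    rw [← hf.integral_eq_one]
    exact setIntegral_mono_set hf.integrableOn
      ((ae_restrict_iff' measurableSet_square).2 (Eventually.of_forall hf.nonneg))
      hsub.eventuallyLE
  rw [hvol] at h1
  have h5 : η / t ^ 3 * (t ^ 2 * m) = η * m / t := by field_simp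
  rw [h5] at h1
  have h6 := h1.trans h2
  rw [div_le_one ht0] at h6
  have : 0 < η * m := by positivity
  linarith

/-- An interior zero of the nonnegative `f` is a local minimum, so the gradient and hence `φ` vanish
there, which strict regularity excludes almost everywhere. -/
lemma IsSRS.pos_ae (hf : IsSRS f) : ∀ᵐ x ∂(volume.restrict openSquare), 0 < f x := by
  filter_upwards [hf.strictly_regular, ae_restrict_mem isOpen_openSquare.measurableSet]
    with x hx hxo
  refine (hf.nonneg x (openSquare_subset_square hxo)).lt_of_ne' fun h0 => ?_
  have hmin : IsLocalMin f x := by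
    filter_upwards [isOpen_openSquare.mem_nhds hxo] with y hy
    rw [h0]
    exact hf.nonneg y (openSquare_subset_square hy)
  simp [phiInt, hmin.fderiv_eq_zero, h0] at hx

lemma IsTypeDensity.aestronglyMeasurable (hf : IsTypeDensity f) :
    AEStronglyMeasurable f (volume.restrict square) := hf.integrableOn.aestronglyMeasurable

/-- With `typeMeasure_ac`, this lets null sets be tested with Lebesgue measure instead of the type
distribution. -/
lemma IsSRS.volume_ac (hf : IsSRS f) : volume.restrict square ≪ typeMeasure f := by
  refine withDensity_absolutelyContinuous' ?_ ?_
  · exact hf.aestronglyMeasurable.aemeasurable.ennreal_ofReal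
  · rw [← Measure.restrict_congr_set openSquare_ae_eq_square]
    filter_upwards [hf.pos_ae] with x hx
    simpa using hx

lemma typeMeasure_ac (f : ℝ × ℝ → ℝ) : typeMeasure f ≪ volume.restrict square :=
  withDensity_absolutelyContinuous _ _

lemma IsSRS.typeMeasure_pos_of_isOpen (hf : IsSRS f) {s U : Set (ℝ × ℝ)} (hU : IsOpen U)
    (hne : U.Nonempty) (hUs : U ⊆ s) (hsq : U ⊆ square) : 0 < typeMeasure f s := by
  refine pos_iff_ne_zero.2 fun h => ?_
  have h1 := hf.volume_ac (measure_mono_null hUs h)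
  rw [Measure.restrict_apply hU.measurableSet, inter_eq_left.2 hsq] at h1
  exact (hU.measure_pos volume hne).ne' h1

/-! ### Integrals of the marginal revenue density over vertical slices -/

/-- The value of `Φ` at a type whose boundary utility is `a`. -/
noncomputable def slicePhi (f : ℝ × ℝ → ℝ) (a t : ℝ) : ℝ :=
  (∫ y in (max (1 - a) t)..1, phi f (t, y)) - f (t, 1)

lemma Phi_eq (f p : ℝ × ℝ → ℝ) (t : ℝ) : Phi f p t = slicePhi f (ubar p t) t := rfl

lemma IsTypeDensity.exists_phi_bound (hf : IsTypeDensity f) : ∃ C : ℝ, 0 ≤ C ∧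
    (∀ x ∈ openSquare, |phiInt f x| ≤ C) ∧ ∀ x ∈ Ico (0 : ℝ) 1 ×ˢ Ioo (0 : ℝ) 1, |phi f x| ≤ C := by
  obtain ⟨C, hC⟩ := hf.phi_bounded
  have hcl : ∀ x ∈ Ico (0 : ℝ) 1 ×ˢ Ioo (0 : ℝ) 1, |phi f x| ≤ C := by
    intro x hx
    have hxc : x ∈ closure openSquare := by
      rw [closure_openSquare]
      exact prod_mono Ico_subset_Icc_self Ioo_subset_Icc_self hx
    have hsub : openSquare ⊆ Ico (0 : ℝ) 1 ×ˢ Ioo (0 : ℝ) 1 :=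
      prod_mono Ioo_subset_Ico_self subset_rfl
    have := mem_closure_iff_nhdsWithin_neBot.1 hxc
    refine le_of_tendsto (((hf.continuousOn_phi x hx).mono hsub).abs) ?_
    filter_upwards [self_mem_nhdsWithin] with y hy
    rw [hf.phi_eq hy]
    exact hC y hy
  exact ⟨C, (abs_nonneg _).trans (hC (1 / 2, 1 / 2) (by constructor <;> norm_num)), hC, hcl⟩

lemma IsTypeDensity.continuousOn_slice (hf : IsTypeDensity f) {t : ℝ} (ht : t ∈ Ico (0 : ℝ) 1) :
    ContinuousOn (fun y => phi f (t, y)) (Ioo 0 1) :=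
  hf.continuousOn_phi.comp (by fun_prop) fun _ hy => ⟨ht, hy⟩

lemma IsTypeDensity.integrableOn_slice (hf : IsTypeDensity f) {t : ℝ}
    (ht : t ∈ Ico (0 : ℝ) 1) : IntegrableOn (fun y => phi f (t, y)) (Ioc 0 1) := by
  obtain ⟨C, -, -, hC⟩ := hf.exists_phi_bound
  rw [integrableOn_Ioc_iff_integrableOn_Ioo]
  refine IntegrableOn.of_bound (by simp)
    ((hf.continuousOn_slice ht).aestronglyMeasurable measurableSet_Ioo) C ?_
  filter_upwards [ae_restrict_mem measurableSet_Ioo] with y hy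
  exact hC (t, y) ⟨ht, hy⟩

lemma IsTypeDensity.continuousOn_top (hf : IsTypeDensity f) :
    ContinuousOn (fun t => f (t, 1)) (Icc 0 1) :=
  hf.continuousOn.comp (by fun_prop) fun t ht =>
    ⟨⟨ht, right_mem_Icc.2 zero_le_one⟩, fun h => by simp [Prod.ext_iff] at h⟩

/-- Fixing the domain of integration lets dominated convergence handle a moving lower limit. -/
lemma intervalIntegral_slice_eq {c : ℝ} (h0 : 0 ≤ c) (h1 : c ≤ 1) (g : ℝ → ℝ) :
    ∫ y in c..1, g y = ∫ y in Ioo 0 1, (Ioi c).indicator g y := by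
  rw [setIntegral_indicator measurableSet_Ioi, intervalIntegral.integral_of_le h1,
    integral_Ioc_eq_integral_Ioo]
  congr 2
  ext y
  simp only [mem_Ioo, mem_inter_iff, mem_Ioi]
  constructor
  · rintro ⟨h2, h3⟩
    exact ⟨⟨h0.trans_lt h2, h3⟩, h2⟩
  · rintro ⟨⟨h2, h3⟩, h4⟩
    exact ⟨h4, h3⟩

lemma max_one_sub_mem {a t : ℝ} (ha : 0 ≤ a) (ht : t ∈ Icc (0 : ℝ) 1) :
    max (1 - a) t ∈ Icc t 1 :=
  ⟨le_max_right _ _, max_le (by linarith) ht.2⟩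

lemma IsTypeDensity.continuousOn_slicePhi (hf : IsTypeDensity f) {w : ℝ → ℝ}
    (hw : ContinuousOn w (Icc 0 1)) (hw0 : ∀ t ∈ Icc (0 : ℝ) 1, 0 ≤ w t) :
    ContinuousOn (fun t => slicePhi f (w t) t) (Icc 0 1) := by
  obtain ⟨C, hC0, -, hC⟩ := hf.exists_phi_bound
  refine ContinuousOn.sub ?_ hf.continuousOn_top
  have hc : ContinuousOn (fun t => max (1 - w t) t) (Icc 0 1) :=
    (continuousOn_const.sub hw).sup continuousOn_id
  have hmem := fun t (ht : t ∈ Icc (0 : ℝ) 1) => max_one_sub_mem (hw0 t ht) ht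
  have key : ContinuousOn (fun t => ∫ y in Ioo (0 : ℝ) 1,
      (Ioi (max (1 - w t) t)).indicator (fun y => phi f (t, y)) y) (Icc 0 1) := by
    intro t₀ ht₀
    refine tendsto_integral_filter_of_dominated_convergence (fun _ => C) ?_ ?_
      (integrable_const _) ?_
    · filter_upwards [self_mem_nhdsWithin] with t ht
      rcases eq_or_lt_of_le ht.2 with h1 | h1
      · refine (aestronglyMeasurable_const (b := (0 : ℝ))).congr ?_
        filter_upwards [ae_restrict_mem measurableSet_Ioo] with y hy
        rw [indicator_of_notMem]
        have := (hmem t ht).1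
        simp only [mem_Ioi, not_lt]
        exact hy.2.le.trans (h1 ▸ this)
      · exact ((hf.continuousOn_slice ⟨ht.1, h1⟩).aestronglyMeasurable
          measurableSet_Ioo).indicator measurableSet_Ioi
    · filter_upwards [self_mem_nhdsWithin] with t ht
      filter_upwards [ae_restrict_mem measurableSet_Ioo] with y hy
      by_cases h : y ∈ Ioi (max (1 - w t) t)
      · rw [indicator_of_mem h]
        exact hC (t, y) ⟨⟨ht.1, ((le_max_right _ _).trans_lt h).trans hy.2⟩, hy⟩
      · rw [indicator_of_notMem h]
        simpa using hC0
    · have hne : ∀ᵐ y ∂(volume.restrict (Ioo (0 : ℝ) 1)), y ≠ max (1 - w t₀) t₀ :=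
        ae_restrict_of_ae (Measure.ae_ne volume _)
      filter_upwards [ae_restrict_mem measurableSet_Ioo, hne] with y hy hyne
      rcases lt_or_gt_of_ne hyne with hlt | hgt
      · have hev : ∀ᶠ t in 𝓝[Icc 0 1] t₀, y < max (1 - w t) t :=
          (hc t₀ ht₀).eventually (lt_mem_nhds hlt)
        rw [indicator_of_notMem (notMem_Ioi.2 hlt.le)]
        refine tendsto_const_nhds.congr' ?_
        filter_upwards [hev] with t ht
        rw [indicator_of_notMem (notMem_Ioi.2 ht.le)]
      · have hev : ∀ᶠ t in 𝓝[Icc 0 1] t₀, max (1 - w t) t < y :=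
          (hc t₀ ht₀).eventually (gt_mem_nhds hgt)
        rw [indicator_of_mem (by exact hgt)]
        have h1 : t₀ < 1 := ((le_max_right _ _).trans_lt hgt).trans hy.2
        have hcont : Tendsto (fun t => phi f (t, y)) (𝓝[Icc 0 1] t₀) (𝓝 (phi f (t₀, y))) := by
          have h2 : ContinuousWithinAt (fun t => phi f (t, y)) (Ico 0 1) t₀ :=
            (hf.continuousOn_phi.comp (f := fun t : ℝ => (t, y)) (by fun_prop)
              fun t ht => ⟨ht, hy⟩) t₀ ⟨ht₀.1, h1⟩
          refine h2.mono_of_mem_nhdsWithin ?_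
          filter_upwards [self_mem_nhdsWithin, mem_nhdsWithin_of_mem_nhds (gt_mem_nhds h1)]
            with t ht ht1
          exact ⟨ht.1, ht1⟩
        refine hcont.congr' ?_
        filter_upwards [hev] with t ht
        rw [indicator_of_mem (by exact ht)]
  refine key.congr fun t ht => ?_
  exact intervalIntegral_slice_eq (ht.1.trans (hmem t ht).1) (hmem t ht).2 _

lemma IsTypeDensity.intervalIntegrable_slice (hf : IsTypeDensity f) {t : ℝ}
    (ht : t ∈ Ico (0 : ℝ) 1) {a b : ℝ} (ha : a ∈ Icc (0 : ℝ) 1) (hb : b ∈ Icc (0 : ℝ) 1) :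
    IntervalIntegrable (fun y => phi f (t, y)) volume a b := by
  have h : IntervalIntegrable (fun y => phi f (t, y)) volume 0 1 :=
    (intervalIntegrable_iff_integrableOn_Ioc_of_le zero_le_one).2 (hf.integrableOn_slice ht)
  exact h.mono_set (by rw [uIcc_of_le zero_le_one]; exact uIcc_subset_Icc ha hb)

/-- Only the lower limit of integration depends on `a`, and `φ` is bounded. This controls the
second-order error in the first-order condition. -/
lemma IsTypeDensity.exists_slicePhi_lipschitz (hf : IsTypeDensity f) : ∃ C : ℝ, 0 ≤ C ∧
    ∀ t ∈ Ico (0 : ℝ) 1, ∀ a b : ℝ, 0 ≤ a → 0 ≤ b →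
      |slicePhi f a t - slicePhi f b t| ≤ C * |a - b| := by
  obtain ⟨C, hC0, -, hC⟩ := hf.exists_phi_bound
  refine ⟨C, hC0, fun t ht a b ha hb => ?_⟩
  have ht' := Ico_subset_Icc_self ht
  have hma := max_one_sub_mem ha ht'
  have hmb := max_one_sub_mem hb ht'
  have hma' : max (1 - a) t ∈ Icc (0 : ℝ) 1 := ⟨ht.1.trans hma.1, hma.2⟩
  have hmb' : max (1 - b) t ∈ Icc (0 : ℝ) 1 := ⟨ht.1.trans hmb.1, hmb.2⟩
  have h1 : (1 : ℝ) ∈ Icc (0 : ℝ) 1 := right_mem_Icc.2 zero_le_one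
  have hdiff : slicePhi f a t - slicePhi f b t
      = ∫ y in (max (1 - a) t)..(max (1 - b) t), phi f (t, y) := by
    rw [slicePhi, slicePhi, ← intervalIntegral.integral_add_adjacent_intervals
      (hf.intervalIntegrable_slice ht hma' hmb') (hf.intervalIntegrable_slice ht hmb' h1)]
    ring
  have hb1 : ‖∫ y in (max (1 - a) t)..(max (1 - b) t), phi f (t, y)‖
      ≤ C * |max (1 - b) t - max (1 - a) t| := by
    refine intervalIntegral.norm_integral_le_of_norm_le_const_ae ?_
    have hne : ∀ᵐ y : ℝ, y ≠ 1 := Measure.ae_ne volume _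
    filter_upwards [hne] with y hy1 hy
    have hy2 : y ∈ Ioc (0 : ℝ) 1 := by
      rcases mem_uIoc.1 hy with h | h
      · exact ⟨hma'.1.trans_lt h.1, h.2.trans hmb.2⟩
      · exact ⟨hmb'.1.trans_lt h.1, h.2.trans hma.2⟩
    exact hC (t, y) ⟨ht, hy2.1, lt_of_le_of_ne hy2.2 hy1⟩
  rw [hdiff]
  refine hb1.trans (mul_le_mul_of_nonneg_left ?_ hC0)
  refine (abs_max_sub_max_le_abs _ _ _).trans (le_of_eq ?_)
  rw [show (1 - b) - (1 - a) = a - b by ring]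


end TwoGoods

namespace TwoGoods

/-! ### Integration by parts along rays -/

/-- The open triangle of types whose second coordinate is the larger one. -/
def triangle : Set (ℝ × ℝ) := {x | 0 < x.1 ∧ x.1 < x.2 ∧ x.2 < 1}

lemma isOpen_triangle : IsOpen triangle :=
  (isOpen_lt continuous_const continuous_fst).inter
    ((isOpen_lt continuous_fst continuous_snd).inter (isOpen_lt continuous_snd continuous_const))

lemma triangle_subset_openSquare : triangle ⊆ openSquare := fun _ ⟨h1, h2, h3⟩ =>
  ⟨⟨h1, h2.trans h3⟩, h1.trans h2, h3⟩

/-- The map `(s, t) ↦ t • (s, 1)`. -/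
def rayMap (z : ℝ × ℝ) : ℝ × ℝ := (z.2 * z.1, z.2)

/-- The derivative of `rayMap`. -/
noncomputable def rayMapDeriv (z : ℝ × ℝ) : ℝ × ℝ →L[ℝ] ℝ × ℝ :=
  (Matrix.toLin (.finTwoProd ℝ) (.finTwoProd ℝ) !![z.2, z.1; 0, 1]).toContinuousLinearMap

lemma hasFDerivAt_rayMap (z : ℝ × ℝ) : HasFDerivAt rayMap (rayMapDeriv z) z := by
  have h1 : HasFDerivAt (fun z : ℝ × ℝ => z.1) (ContinuousLinearMap.fst ℝ ℝ ℝ) z := hasFDerivAt_fst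
  have h2 : HasFDerivAt (fun z : ℝ × ℝ => z.2) (ContinuousLinearMap.snd ℝ ℝ ℝ) z := hasFDerivAt_snd
  refine ((h2.mul h1).prodMk h2).congr_fderiv ?_
  rw [rayMapDeriv, Matrix.toLin_finTwoProd_toContinuousLinearMap]
  simp

lemma det_rayMapDeriv (z : ℝ × ℝ) : (rayMapDeriv z).det = z.2 := by
  unfold rayMapDeriv
  simp only [LinearMap.det_toContinuousLinearMap, LinearMap.det_toLin, Matrix.det_fin_two_of]
  ring

lemma injOn_rayMap : InjOn rayMap openSquare := by
  rintro ⟨a, b⟩ ⟨_, hb⟩ ⟨c, d⟩ _ h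
  simp only [rayMap, Prod.mk.injEq] at h ⊢
  obtain ⟨h1, rfl⟩ := h
  exact ⟨mul_left_cancel₀ hb.1.ne' h1, rfl⟩

lemma image_rayMap : rayMap '' openSquare = triangle := by
  ext ⟨a, b⟩
  constructor
  · rintro ⟨⟨s, t⟩, ⟨⟨h1, h2⟩, h3, h4⟩, h⟩
    simp only [rayMap, Prod.mk.injEq] at h h1 h2 h3 h4
    obtain ⟨rfl, rfl⟩ := h
    exact ⟨mul_pos h3 h1, by simp only; nlinarith, h4⟩
  · rintro ⟨h1, h2, h3⟩
    simp only at h1 h2 h3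
    have hb : 0 < b := h1.trans h2
    refine ⟨(a / b, b), ⟨⟨div_pos h1 hb, (div_lt_one hb).2 h2⟩, hb, h3⟩, ?_⟩
    simp only [rayMap, Prod.mk.injEq, and_true]
    field_simp

/-- The weight `t` is the Jacobian of `rayMap`. -/
lemma setIntegral_triangle {g : ℝ × ℝ → ℝ} (hg : IntegrableOn g triangle) :
    ∫ x in triangle, g x = ∫ s in Ioo 0 1, ∫ t in Ioo 0 1, t * g (t * s, t) := by
  have hm := isOpen_openSquare.measurableSet
  have hd : ∀ z ∈ openSquare, HasFDerivWithinAt rayMap (rayMapDeriv z) openSquare z :=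
    fun z _ => (hasFDerivAt_rayMap z).hasFDerivWithinAt
  have habs : EqOn (fun z => |(rayMapDeriv z).det| • g (rayMap z))
      (fun z => z.2 * g (z.2 * z.1, z.2)) openSquare := fun z hz => by
    simp only [det_rayMapDeriv, abs_of_pos hz.2.1, smul_eq_mul, rayMap]
  rw [← image_rayMap] at hg ⊢
  rw [integral_image_eq_integral_abs_det_fderiv_smul _ hm hd injOn_rayMap,
    setIntegral_congr_fun hm habs]
  rw [integrableOn_image_iff_integrableOn_abs_det_fderiv_smul _ hm hd injOn_rayMap] at hg
  exact setIntegral_prod _ (hg.congr_fun habs hm)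

variable {f : ℝ × ℝ → ℝ}

lemma ray_mem_openSquare {s t : ℝ} (hs : s ∈ Ioo (0 : ℝ) 1) (ht : t ∈ Ioo (0 : ℝ) 1) :
    t • ((s, 1) : ℝ × ℝ) ∈ openSquare := by
  refine triangle_subset_openSquare ⟨?_, ?_, ?_⟩
  · exact mul_pos ht.1 hs.1
  · show t * s < t * 1
    exact mul_lt_mul_of_pos_left hs.2 ht.1
  · show t * 1 < 1
    linarith [ht.2]

lemma IsTypeDensity.exists_bounds (hf : IsTypeDensity f) : ∃ C : ℝ, 0 ≤ C ∧
    (∀ x ∈ openSquare, |phiInt f x| ≤ C) ∧ ∀ x ∈ openSquare, |f x| ≤ C := by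
  obtain ⟨C, hC0, hC, -⟩ := hf.exists_phi_bound
  refine ⟨C, hC0, hC, fun x hx => ?_⟩
  rw [abs_of_nonneg (hf.nonneg x (openSquare_subset_square hx))]
  linarith [hf.le_of_phi_le hC hx]

lemma IsTypeDensity.hasDerivAt_sq_mul (hf : IsTypeDensity f) {x : ℝ × ℝ} {t : ℝ}
    (hx : t • x ∈ openSquare) :
    HasDerivAt (fun t : ℝ => t ^ 2 * f (t • x)) (t * phiInt f (t • x) - t * f (t • x)) t := by
  refine ((hasDerivAt_pow 2 t).fun_mul (hf.hasDerivAt_ray hx)).congr_deriv ?_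
  simp only [phiInt, map_smul, smul_eq_mul]
  push_cast
  ring

/-- The derivative `t (φ - f)` is bounded on the open interval because `f` is. Lipschitz continuity
up to both ends is what absolute continuity in `integral_ray` requires. -/
lemma IsTypeDensity.lipschitzOnWith_sq_mul (hf : IsTypeDensity f) {s : ℝ}
    (hs : s ∈ Ioo (0 : ℝ) 1) :
    ∃ K, LipschitzOnWith K (fun t : ℝ => t ^ 2 * f (t • (s, 1))) (Icc 0 1) := by
  obtain ⟨C, hC0, hC1, hC2⟩ := hf.exists_bounds
  refine ⟨(2 * C).toNNReal, ?_⟩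
  have hcl : closure (Ioo (0 : ℝ) 1) = Icc 0 1 := closure_Ioo zero_ne_one
  rw [← hcl]
  refine LipschitzOnWith.closure ?_ ?_
  · rw [hcl]
    intro t ht
    rcases eq_or_lt_of_le ht.1 with h0 | h0
    · subst h0
      -- At the origin `f` need not be continuous; boundedness of `f` and the factor `t²` suffice.
      have hz : Tendsto (fun t : ℝ => t ^ 2 * C) (𝓝[Icc 0 1] 0) (𝓝 0) := by
        have : Continuous fun t : ℝ => t ^ 2 * C := by fun_prop
        simpa using (this.tendsto 0).mono_left nhdsWithin_le_nhds
      have hlt : ∀ᶠ t : ℝ in 𝓝[Icc 0 1] 0, t < 1 :=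
        mem_nhdsWithin_of_mem_nhds (gt_mem_nhds one_pos)
      show Tendsto _ _ (𝓝 _)
      simp only [ne_eq, OfNat.ofNat_ne_zero, not_false_eq_true, zero_pow, zero_mul]
      refine squeeze_zero_norm' ?_ hz
      filter_upwards [self_mem_nhdsWithin, hlt] with t ht ht1
      rcases eq_or_lt_of_le ht.1 with h | h
      · simp [← h]
      · rw [norm_mul, norm_pow, Real.norm_eq_abs, Real.norm_eq_abs, sq_abs]
        exact mul_le_mul_of_nonneg_left (hC2 _ (ray_mem_openSquare hs ⟨h, ht1⟩)) (sq_nonneg _)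
    · refine ContinuousWithinAt.mul (by fun_prop) ?_
      have hmem : t • ((s, 1) : ℝ × ℝ) ∈ square \ {0} := by
        refine ⟨⟨⟨mul_nonneg ht.1 hs.1.le, ?_⟩, mul_nonneg ht.1 zero_le_one, ?_⟩, ?_⟩
        · exact mul_le_one₀ ht.2 hs.1.le hs.2.le
        · show t * 1 ≤ 1
          linarith [ht.2]
        · simp [h0.ne']
      have hopen : IsOpen {x : ℝ × ℝ | 0 < x.2} := isOpen_lt continuous_const continuous_snd
      refine (hf.continuousOn _ hmem).comp_of_preimage_mem_nhdsWithin
        (f := fun t : ℝ => t • ((s, 1) : ℝ × ℝ)) (by fun_prop) ?_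
      filter_upwards [self_mem_nhdsWithin, mem_nhdsWithin_of_mem_nhds (lt_mem_nhds h0)]
        with r hr hr0
      refine ⟨⟨⟨mul_nonneg hr.1 hs.1.le, ?_⟩, mul_nonneg hr.1 zero_le_one, ?_⟩, ?_⟩
      · exact mul_le_one₀ hr.2 hs.1.le hs.2.le
      · show r * 1 ≤ 1
        linarith [hr.2]
      · simp [hr0.ne']
  · refine (convex_Ioo 0 1).lipschitzOnWith_of_nnnorm_deriv_le (𝕜 := ℝ)
      (fun t ht => (hf.hasDerivAt_sq_mul (ray_mem_openSquare hs ht)).differentiableAt) ?_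
    intro t ht
    have hmem := ray_mem_openSquare hs ht
    rw [(hf.hasDerivAt_sq_mul hmem).deriv, ← NNReal.coe_le_coe, coe_nnnorm,
      Real.coe_toNNReal _ (by positivity), Real.norm_eq_abs, ← mul_sub, abs_mul, abs_of_pos ht.1]
    calc t * |phiInt f (t • (s, 1)) - f (t • (s, 1))|
        ≤ 1 * (|phiInt f (t • (s, 1))| + |f (t • (s, 1))|) :=
          mul_le_mul ht.2.le (abs_sub _ _) (abs_nonneg _) zero_le_one
      _ ≤ 2 * C := by linarith [hC1 _ hmem, hC2 _ hmem]

/-- The integrand is the derivative of `w(tx) · t² f(tx)` with `x = (s, 1)`. The product is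
absolutely continuous and vanishes at `t = 0`, so only the top-edge term survives. -/
lemma IsTypeDensity.integral_ray (hf : IsTypeDensity f) {w : ℝ × ℝ → ℝ} {K : NNReal}
    (hw : LipschitzWith K w) {s : ℝ} (hs : s ∈ Ioo (0 : ℝ) 1) :
    ∫ t in Ioo 0 1, t * ((t * deriv (fun τ : ℝ => w (τ • (s, 1))) t - w (t • (s, 1)))
        * f (t • (s, 1)) + w (t • (s, 1)) * phiInt f (t • (s, 1))) = w (s, 1) * f (s, 1) := by
  have hlin : LipschitzWith 1 (fun τ : ℝ => τ • ((s, 1) : ℝ × ℝ)) := by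
    refine LipschitzWith.of_dist_le_mul fun a b => ?_
    rw [NNReal.coe_one, one_mul, dist_eq_norm, ← sub_smul, norm_smul, ← dist_eq_norm]
    have h1 : ‖((s, 1) : ℝ × ℝ)‖ = 1 := by
      simp [Prod.norm_def, abs_of_pos hs.1, hs.2.le]
    rw [h1, mul_one]
  obtain ⟨L, hL⟩ := hf.lipschitzOnWith_sq_mul hs
  have hu : uIcc (0 : ℝ) 1 = Icc 0 1 := uIcc_of_le zero_le_one
  have hacw : AbsolutelyContinuousOnInterval (fun τ : ℝ => w (τ • (s, 1))) 0 1 :=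
    (hw.comp hlin).lipschitzOnWith.absolutelyContinuousOnInterval
  have hacq : AbsolutelyContinuousOnInterval (fun t : ℝ => t ^ 2 * f (t • (s, 1))) 0 1 :=
    LipschitzOnWith.absolutelyContinuousOnInterval (hu ▸ hL)
  have := hacw.integral_deriv_mul_eq_sub hacq
  simp only [one_smul, one_pow, one_mul, ne_eq, OfNat.ofNat_ne_zero, not_false_eq_true,
    zero_pow, zero_mul, mul_zero, sub_zero] at this
  rw [← this, intervalIntegral.integral_of_le zero_le_one, integral_Ioc_eq_integral_Ioo]
  refine setIntegral_congr_fun measurableSet_Ioo fun t ht => ?_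
  rw [(hf.hasDerivAt_sq_mul (ray_mem_openSquare hs ht)).deriv]
  ring

lemma IsTypeDensity.integrableOn_mul_phiInt (hf : IsTypeDensity f) {w : ℝ × ℝ → ℝ}
    (hw : ContinuousOn w square) : IntegrableOn (fun x => w x * phiInt f x) openSquare := by
  obtain ⟨C, hC0, hC1, -⟩ := hf.exists_bounds
  obtain ⟨M, hM⟩ := isCompact_square.exists_bound_of_continuousOn hw
  refine IntegrableOn.of_bound ((measure_mono openSquare_subset_square).trans_lt
    isCompact_square.measure_lt_top) (((hw.mono openSquare_subset_square).mul
      hf.continuousOn_phiInt).aestronglyMeasurable isOpen_openSquare.measurableSet) (M * C) ?_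
  filter_upwards [ae_restrict_mem isOpen_openSquare.measurableSet] with x hx
  have h1 := hM x (openSquare_subset_square hx)
  rw [norm_mul]
  exact mul_le_mul h1 (hC1 x hx) (norm_nonneg _) ((norm_nonneg _).trans h1)

lemma IsTypeDensity.integrableOn_revenue (hf : IsTypeDensity f) {w : ℝ × ℝ → ℝ} {K : NNReal}
    (hw : LipschitzWith K w) :
    IntegrableOn (fun x => (fderiv ℝ w x x - w x) * f x) openSquare := by
  obtain ⟨C, hC0, -, hC2⟩ := hf.exists_bounds
  obtain ⟨M, hM⟩ := isCompact_square.exists_bound_of_continuousOn hw.continuous.continuousOn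
  have hmeas : Measurable fun x => fderiv ℝ w x x - w x := by
    have h1 : Measurable fun x => fderiv ℝ w x x :=
      isBoundedBilinearMap_apply.continuous.measurable.comp
        ((measurable_fderiv ℝ w).prodMk measurable_id)
    exact h1.sub hw.continuous.measurable
  refine IntegrableOn.of_bound ((measure_mono openSquare_subset_square).trans_lt
    isCompact_square.measure_lt_top) (hmeas.aestronglyMeasurable.mul
      (hf.contDiffOn.continuousOn.aestronglyMeasurable isOpen_openSquare.measurableSet))
    ((K + M) * C) ?_
  filter_upwards [ae_restrict_mem isOpen_openSquare.measurableSet] with x hx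
  have h1 := hM x (openSquare_subset_square hx)
  have h2 : ‖fderiv ℝ w x x‖ ≤ K := by
    have hx1 : ‖x‖ ≤ 1 := by
      obtain ⟨⟨h1, h2⟩, h3, h4⟩ := hx
      rw [Prod.norm_def, max_le_iff, Real.norm_eq_abs, Real.norm_eq_abs, abs_of_pos h1,
        abs_of_pos h3]
      exact ⟨h2.le, h4.le⟩
    calc ‖fderiv ℝ w x x‖ ≤ ‖fderiv ℝ w x‖ * ‖x‖ := (fderiv ℝ w x).le_opNorm x
      _ ≤ K * 1 := mul_le_mul (norm_fderiv_le_of_lipschitz ℝ hw) hx1 (norm_nonneg _) K.2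
      _ = K := mul_one _
  rw [norm_mul]
  refine mul_le_mul ((norm_sub_le _ _).trans (add_le_add h2 h1)) (hC2 x hx) (norm_nonneg _) ?_
  exact add_nonneg K.2 ((norm_nonneg _).trans h1)

/-- The divergence theorem on the triangle, for the vector field `x ↦ w(x) f(x) x`. -/
theorem IsTypeDensity.setIntegral_triangle_revenue (hf : IsTypeDensity f) {w : ℝ × ℝ → ℝ}
    {K : NNReal} (hw : LipschitzWith K w) :
    ∫ x in triangle, (fderiv ℝ w x x - w x) * f x =
      (∫ s in Icc 0 1, w (s, 1) * f (s, 1)) - ∫ x in triangle, w x * phiInt f x := by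
  have hi1 := (hf.integrableOn_revenue hw).mono_set triangle_subset_openSquare
  have hi2 := (hf.integrableOn_mul_phiInt hw.continuous.continuousOn).mono_set triangle_subset_openSquare
  -- The radial derivative replaces `fderiv` because it is what the ray integrals contain. The two
  -- agree wherever `w` is differentiable, hence almost everywhere by Rademacher's theorem.
  set g : ℝ × ℝ → ℝ := fun x => (deriv (fun τ : ℝ => w (τ • x)) 1 - w x) * f x + w x * phiInt f x
  have hae : (fun x => (fderiv ℝ w x x - w x) * f x + w x * phiInt f x)
      =ᵐ[volume.restrict triangle] g := by
    filter_upwards [ae_restrict_of_ae hw.ae_differentiableAt] with x hx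
    have h1 : HasFDerivAt w (fderiv ℝ w x) ((1 : ℝ) • x) := by
      rw [one_smul]; exact hx.hasFDerivAt
    have h2 : deriv (fun τ : ℝ => w (τ • x)) 1 = fderiv ℝ w x x :=
      (h1.comp_hasDerivAt (1 : ℝ) (hasDerivAt_smul_const x 1)).deriv
    simp only [g, h2]
  have hg : IntegrableOn g triangle := (hi1.add hi2).congr hae
  rw [eq_sub_iff_add_eq, ← integral_add hi1 hi2, integral_congr_ae hae, setIntegral_triangle hg,
    integral_Icc_eq_integral_Ioo]
  refine setIntegral_congr_fun measurableSet_Ioo fun s hs => ?_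
  rw [← hf.integral_ray hw hs]
  refine setIntegral_congr_fun measurableSet_Ioo fun t ht => ?_
  have hts : t • ((s, 1) : ℝ × ℝ) = (t * s, t) := by simp
  have hder : deriv (fun τ : ℝ => w (τ • (t * s, t))) 1
      = t * deriv (fun τ : ℝ => w (τ • (s, 1))) t := by
    have h1 : (fun τ : ℝ => w (τ • (t * s, t)))
        = fun τ : ℝ => (fun r : ℝ => w (r • (s, 1))) (t * τ) := by
      funext τ
      simp only [← hts, smul_smul]
      rw [mul_comm]
    rw [h1]
    have h2 := deriv_comp_mul_left t (fun r : ℝ => w (r • (s, 1))) 1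
    rw [mul_one, smul_eq_mul] at h2
    exact h2
  simp only [g, hder, hts]


end TwoGoods

namespace TwoGoods

/-! ### Indirect utilities -/

variable {f p : ℝ × ℝ → ℝ}

lemma zero_mem_square : (0 : ℝ × ℝ) ∈ square :=
  ⟨left_mem_Icc.2 zero_le_one, left_mem_Icc.2 zero_le_one⟩

lemma IsFeasible.bddAbove (hp : IsFeasible p) (x : ℝ × ℝ) :
    BddAbove ((fun q => dot x q - p q) '' square) := by
  obtain ⟨c, hc⟩ := hp.bddBelow
  refine ⟨|x.1| + |x.2| - c, ?_⟩
  rintro _ ⟨q, hq, rfl⟩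
  have h1 : x.1 * q.1 ≤ |x.1| * 1 :=
    mul_le_mul (le_abs_self _) hq.1.2 hq.1.1 (abs_nonneg _)
  have h2 : x.2 * q.2 ≤ |x.2| * 1 :=
    mul_le_mul (le_abs_self _) hq.2.2 hq.2.1 (abs_nonneg _)
  have h3 := hc ⟨q, hq, rfl⟩
  simp only [dot]
  linarith

lemma IsFeasible.le_utility (hp : IsFeasible p) (x : ℝ × ℝ) {q : ℝ × ℝ} (hq : q ∈ square) :
    dot x q - p q ≤ utility p x := le_csSup (hp.bddAbove x) ⟨q, hq, rfl⟩

lemma utility_le {x : ℝ × ℝ} {c : ℝ} (h : ∀ q ∈ square, dot x q - p q ≤ c) :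
    utility p x ≤ c := by
  refine csSup_le ⟨_, 0, zero_mem_square, rfl⟩ ?_
  rintro _ ⟨q, hq, rfl⟩
  exact h q hq

lemma dot_sub_dot_le {x y q : ℝ × ℝ} (hq : q ∈ square) : dot x q - dot y q ≤ 2 * ‖x - y‖ := by
  have h1 : x.1 - y.1 ≤ ‖x - y‖ := (le_abs_self _).trans (norm_fst_le (x - y))
  have h2 : x.2 - y.2 ≤ ‖x - y‖ := (le_abs_self _).trans (norm_snd_le (x - y))
  have h0 := norm_nonneg (x - y)
  have h3 : (x.1 - y.1) * q.1 ≤ ‖x - y‖ := by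
    nlinarith [mul_nonneg (sub_nonneg.2 h1) hq.1.1, mul_nonneg h0 (sub_nonneg.2 hq.1.2)]
  have h4 : (x.2 - y.2) * q.2 ≤ ‖x - y‖ := by
    nlinarith [mul_nonneg (sub_nonneg.2 h2) hq.2.1, mul_nonneg h0 (sub_nonneg.2 hq.2.2)]
  simp only [dot]
  linarith

lemma IsFeasible.lipschitzWith (hp : IsFeasible p) : LipschitzWith 2 (utility p) := by
  refine LipschitzWith.of_le_add_mul 2 fun x y => utility_le fun q hq => ?_
  have h1 := dot_sub_dot_le (x := x) (y := y) hq
  have h2 := hp.le_utility y hq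
  rw [dist_eq_norm]
  push_cast
  linarith

lemma IsFeasible.utility_nonneg (hp : IsFeasible p) (x : ℝ × ℝ) : 0 ≤ utility p x := by
  have := hp.le_utility x zero_mem_square
  simpa [dot, hp.zero] using this

/-- The indirect utility has a feasible subgradient at every type. -/
lemma IsFeasible.exists_subgradient (hp : IsFeasible p) (x : ℝ × ℝ) : ∃ q ∈ square, ∀ y,
    utility p x + ((y.1 - x.1) * q.1 + (y.2 - x.2) * q.2) ≤ utility p y := by
  -- The supremum defining `u(x)` need not be attained, as `p` need not be lower semicontinuous; a
  -- limit of nearly optimal bundles still supports `u` at `x`.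
  have h1 : ∀ n : ℕ, ∃ q ∈ square, utility p x - 1 / (n + 1 : ℝ) < dot x q - p q := by
    intro n
    have hlt : utility p x - 1 / (n + 1 : ℝ) < utility p x := by
      have : (0 : ℝ) < 1 / (n + 1 : ℝ) := Nat.one_div_pos_of_nat
      linarith
    have hne : ((fun q => dot x q - p q) '' square).Nonempty := ⟨_, 0, zero_mem_square, rfl⟩
    obtain ⟨_, ⟨q, hq, rfl⟩, h⟩ := exists_lt_of_lt_csSup hne hlt
    exact ⟨q, hq, h⟩
  choose q hq hlt using h1
  obtain ⟨q₀, hq₀, φ, hφ, hlim⟩ := isCompact_square.tendsto_subseq hq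
  refine ⟨q₀, hq₀, fun y => ?_⟩
  have hle : ∀ n, utility p x - 1 / ((φ n : ℕ) + 1 : ℝ)
      + ((y.1 - x.1) * (q (φ n)).1 + (y.2 - x.2) * (q (φ n)).2) ≤ utility p y := by
    intro n
    have h2 := hlt (φ n)
    have h3 := hp.le_utility y (hq (φ n))
    simp only [dot] at h2 h3
    linarith
  have ht1 : Tendsto (fun n => 1 / ((φ n : ℕ) + 1 : ℝ)) atTop (𝓝 0) :=
    tendsto_one_div_add_atTop_nhds_zero_nat.comp hφ.tendsto_atTop
  have ht2 : Tendsto (fun n => (q (φ n)).1) atTop (𝓝 q₀.1) := (continuous_fst.tendsto _).comp hlim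
  have ht3 : Tendsto (fun n => (q (φ n)).2) atTop (𝓝 q₀.2) := (continuous_snd.tendsto _).comp hlim
  have := ((ht1.const_sub (utility p x)).add
    ((ht2.const_mul (y.1 - x.1)).add (ht3.const_mul (y.2 - x.2))))
  rw [sub_zero] at this
  exact le_of_tendsto' this hle

lemma IsFeasible.convexOn (hp : IsFeasible p) : ConvexOn ℝ univ (utility p) := by
  refine ⟨convex_univ, fun x _ y _ a b ha hb hab => ?_⟩
  obtain ⟨q, -, hq⟩ := hp.exists_subgradient (a • x + b • y)
  have h1 := mul_le_mul_of_nonneg_left (hq x) ha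
  have h2 := mul_le_mul_of_nonneg_left (hq y) hb
  simp only [Prod.fst_add, Prod.snd_add, Prod.smul_fst, Prod.smul_snd, smul_eq_mul] at h1 h2 ⊢
  obtain rfl : b = 1 - a := by linarith
  linarith

/-- Every convex function on the square with feasible subgradients that vanishes at the origin is
implemented by a price schedule, namely its conjugate. -/
lemma exists_isFeasible_utility_eq {w : ℝ × ℝ → ℝ} (h0 : w 0 = 0)
    (hw : ∀ x ∈ square, ∃ q ∈ square, ∀ y ∈ square,
      w x + ((y.1 - x.1) * q.1 + (y.2 - x.2) * q.2) ≤ w y) :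
    ∃ p', IsFeasible p' ∧ ∀ x ∈ square, utility p' x = w x := by
  have hnn : ∀ y ∈ square, 0 ≤ w y := by
    intro y hy
    obtain ⟨q, hq, h⟩ := hw 0 zero_mem_square
    have h1 := h y hy
    have h2 := mul_nonneg hy.1.1 hq.1.1
    have h3 := mul_nonneg hy.2.1 hq.2.1
    simp only [Prod.fst_zero, Prod.snd_zero, sub_zero, h0] at h1
    linarith
  set p' : ℝ × ℝ → ℝ := fun q => sSup ((fun y => dot y q - w y) '' square) with hp'
  have hne : ∀ q, ((fun y => dot y q - w y) '' square).Nonempty :=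
    fun q => ⟨_, 0, zero_mem_square, rfl⟩
  have hbdd : ∀ q, BddAbove ((fun y => dot y q - w y) '' square) := by
    intro q
    refine ⟨|q.1| + |q.2|, ?_⟩
    rintro _ ⟨y, hy, rfl⟩
    have h1 : y.1 * q.1 ≤ 1 * |q.1| :=
      (mul_le_mul_of_nonneg_left (le_abs_self _) hy.1.1).trans
        (mul_le_mul_of_nonneg_right hy.1.2 (abs_nonneg _))
    have h2 : y.2 * q.2 ≤ 1 * |q.2| :=
      (mul_le_mul_of_nonneg_left (le_abs_self _) hy.2.1).trans
        (mul_le_mul_of_nonneg_right hy.2.2 (abs_nonneg _))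
    have h3 := hnn y hy
    simp only [dot]
    linarith
  have hle : ∀ q, ∀ y ∈ square, dot y q - w y ≤ p' q :=
    fun q y hy => le_csSup (hbdd q) ⟨y, hy, rfl⟩
  have hfeas : IsFeasible p' := by
    refine ⟨le_antisymm ?_ ?_, 0, ?_⟩
    · refine csSup_le (hne 0) ?_
      rintro _ ⟨y, hy, rfl⟩
      simpa [dot] using hnn y hy
    · simpa [dot, h0] using hle 0 0 zero_mem_square
    · rintro _ ⟨q, -, rfl⟩
      simpa [dot, h0] using hle q 0 zero_mem_square
  refine ⟨p', hfeas, fun x hx => le_antisymm (utility_le fun q _ => ?_) ?_⟩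
  · linarith [hle q x hx]
  · obtain ⟨q, hq, h⟩ := hw x hx
    have h1 : p' q ≤ dot x q - w x := by
      refine csSup_le (hne q) ?_
      rintro _ ⟨y, hy, rfl⟩
      have := h y hy
      simp only [dot]
      linarith
    linarith [hfeas.le_utility x hq]

/-! ### Revenue of a symmetric mechanism -/

lemma swap_mem_square {x : ℝ × ℝ} (hx : x ∈ square) : x.swap ∈ square := ⟨hx.2, hx.1⟩

lemma swap_mem_openSquare {x : ℝ × ℝ} (hx : x ∈ openSquare) : x.swap ∈ openSquare := ⟨hx.2, hx.1⟩

lemma volume_diagonal : volume {x : ℝ × ℝ | x.1 = x.2} = 0 := by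
  have h : {x : ℝ × ℝ | x.1 = x.2}
      = ((LinearMap.ker (LinearMap.fst ℝ ℝ ℝ - LinearMap.snd ℝ ℝ ℝ) : Submodule ℝ (ℝ × ℝ)) :
        Set (ℝ × ℝ)) := by
    ext x
    simp [sub_eq_zero]
  rw [h]
  refine Measure.addHaar_submodule volume _ fun htop => ?_
  have : ((1, 0) : ℝ × ℝ) ∈ LinearMap.ker (LinearMap.fst ℝ ℝ ℝ - LinearMap.snd ℝ ℝ ℝ) :=
    htop ▸ Submodule.mem_top
  simp at this

lemma measurePreserving_swap :
    MeasurePreserving (Prod.swap : ℝ × ℝ → ℝ × ℝ) volume volume :=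
  Measure.measurePreserving_swap

lemma setIntegral_preimage_swap (s : Set (ℝ × ℝ)) (g : ℝ × ℝ → ℝ) :
    ∫ x in Prod.swap ⁻¹' s, g x.swap = ∫ x in s, g x :=
  measurePreserving_swap.setIntegral_preimage_emb
    MeasurableEquiv.prodComm.measurableEmbedding g s

/-- The integral of a symmetric function over a symmetric set is twice the integral over the part
above the diagonal. -/
lemma setIntegral_of_symm {s : Set (ℝ × ℝ)} {g : ℝ × ℝ → ℝ} (hs : MeasurableSet s)
    (hsymm : Prod.swap ⁻¹' s = s) (hg : IntegrableOn g s) (h : ∀ x ∈ s, g x.swap = g x) :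
    ∫ x in s, g x = 2 * ∫ x in s ∩ {x | x.1 < x.2}, g x := by
  have hU : MeasurableSet {x : ℝ × ℝ | x.1 < x.2} := measurableSet_lt measurable_fst measurable_snd
  have h1 : (s \ {x | x.1 < x.2} : Set (ℝ × ℝ)) =ᵐ[volume] Prod.swap ⁻¹' (s ∩ {x | x.1 < x.2}) := by
    have hd : ∀ᵐ x : ℝ × ℝ, x.1 ≠ x.2 := by
      rw [ae_iff]
      simpa using volume_diagonal
    rw [preimage_inter, hsymm]
    filter_upwards [hd] with x hx
    refine propext ⟨fun h => ⟨h.1, ?_⟩, fun h => ⟨h.1, ?_⟩⟩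
    · exact lt_of_le_of_ne (not_lt.1 h.2) hx.symm
    · exact not_lt.2 (show x.2 < x.1 from h.2).le
  have h2 : ∫ x in s \ {x | x.1 < x.2}, g x = ∫ x in s ∩ {x | x.1 < x.2}, g x := by
    rw [setIntegral_congr_set (f := g) h1, ← setIntegral_preimage_swap (s ∩ {x | x.1 < x.2}) g]
    refine setIntegral_congr_fun (measurable_swap (hs.inter hU)) fun x hx => ?_
    exact (h x (hsymm.subset hx.1)).symm
  rw [← integral_inter_add_sdiff hU hg, h2, two_mul]

lemma preimage_swap_openSquare : Prod.swap ⁻¹' openSquare = openSquare := by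
  ext x
  exact and_comm

lemma triangle_eq : triangle = openSquare ∩ {x | x.1 < x.2} := by
  ext x
  constructor
  · exact fun hx => ⟨triangle_subset_openSquare hx, hx.2.1⟩
  · exact fun ⟨hx, h⟩ => ⟨hx.1.1, h, hx.2.2⟩

lemma fderiv_swap_apply {w : ℝ × ℝ → ℝ} (hw : ∀ x ∈ openSquare, w x.swap = w x) {x : ℝ × ℝ}
    (hx : x ∈ openSquare) : fderiv ℝ w x.swap x.swap = fderiv ℝ w x x := by
  have hev : w =ᶠ[𝓝 x] w ∘ ContinuousLinearEquiv.prodComm ℝ ℝ ℝ := by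
    filter_upwards [isOpen_openSquare.mem_nhds hx] with y hy
    exact (hw y hy).symm
  rw [hev.fderiv_eq, ContinuousLinearEquiv.comp_right_fderiv]
  rfl

lemma IsSRS.totalRevenue_eq (hf : IsSRS f) (hp : IsFeasible p) (hsymm : IsSymmetric p) :
    totalRevenue f p = 2 * ((∫ s in Icc 0 1, utility p (s, 1) * f (s, 1))
      - ∫ x in triangle, utility p x * phiInt f x) := by
  rw [← hf.setIntegral_triangle_revenue hp.lipschitzWith, triangle_eq, totalRevenue,
    ← setIntegral_congr_set openSquare_ae_eq_square]
  refine setIntegral_of_symm isOpen_openSquare.measurableSet preimage_swap_openSquare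
    (hf.integrableOn_revenue hp.lipschitzWith) fun x hx => ?_
  rw [fderiv_swap_apply (fun y hy => hsymm y (openSquare_subset_square hy)) hx,
    hsymm x (openSquare_subset_square hx), hf.symmetric x (openSquare_subset_square hx)]

lemma IsSRS.setIntegral_triangle_density (hf : IsSRS f) : ∫ x in triangle, f x = 1 / 2 := by
  have h := setIntegral_of_symm isOpen_openSquare.measurableSet preimage_swap_openSquare
    (hf.integrableOn.mono_set openSquare_subset_square)
    (fun x hx => hf.symmetric x (openSquare_subset_square hx))
  rw [setIntegral_congr_set openSquare_ae_eq_square, hf.integral_eq_one, ← triangle_eq] at h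
  linarith

/-- This is the divergence identity for `w = 1`: raising all utilities by a constant costs exactly
that constant times the mass of types. -/
lemma IsSRS.setIntegral_triangle_phiInt (hf : IsSRS f) :
    ∫ x in triangle, phiInt f x = (∫ s in Icc 0 1, f (s, 1)) + 1 / 2 := by
  have h := hf.setIntegral_triangle_revenue (LipschitzWith.const (1 : ℝ))
  simp only [fderiv_fun_const, Pi.zero_apply, zero_apply, zero_sub, neg_mul,
    one_mul, integral_neg, hf.setIntegral_triangle_density] at h
  linarith


end TwoGoods

namespace TwoGoods

/-! ### Profiles: utilities along the top edge -/

variable {f p : ℝ × ℝ → ℝ} {w v : ℝ → ℝ}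

/-- `q` is a subgradient at `t` of the function `w` on the unit interval. -/
def IsSlope (w : ℝ → ℝ) (t q : ℝ) : Prop := ∀ s ∈ Icc (0 : ℝ) 1, w t + (s - t) * q ≤ w s

/-- Convex functions on the unit interval with slopes in `[0,1]` and initial value in `[0,1]`. -/
structure IsProfile (w : ℝ → ℝ) : Prop where
  exists_slope : ∀ t ∈ Icc (0 : ℝ) 1, ∃ q ∈ Icc (0 : ℝ) 1, IsSlope w t q
  initial_nonneg : 0 ≤ w 0
  initial_le_one : w 0 ≤ 1

lemma IsSlope.le_of_lt {s t q r : ℝ} (hs : s ∈ Icc (0 : ℝ) 1) (ht : t ∈ Icc (0 : ℝ) 1)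
    (hq : IsSlope w s q) (hr : IsSlope w t r) (hst : s < t) : q ≤ r := by
  have h1 := hq t ht
  have h2 := hr s hs
  nlinarith

lemma IsProfile.le_of_le (hw : IsProfile w) {s t : ℝ} (hs : s ∈ Icc (0 : ℝ) 1)
    (ht : t ∈ Icc (0 : ℝ) 1) (hst : s ≤ t) : w s ≤ w t := by
  obtain ⟨q, hq, h⟩ := hw.exists_slope s hs
  nlinarith [h t ht, mul_nonneg (sub_nonneg.2 hst) hq.1]

lemma IsProfile.sub_le (hw : IsProfile w) {s t : ℝ} (hs : s ∈ Icc (0 : ℝ) 1)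
    (ht : t ∈ Icc (0 : ℝ) 1) (hst : s ≤ t) : w t - w s ≤ t - s := by
  obtain ⟨q, hq, h⟩ := hw.exists_slope t ht
  nlinarith [h s hs, mul_nonneg (sub_nonneg.2 hst) (sub_nonneg.2 hq.2)]

lemma IsProfile.nonneg (hw : IsProfile w) {t : ℝ} (ht : t ∈ Icc (0 : ℝ) 1) : 0 ≤ w t :=
  hw.initial_nonneg.trans (hw.le_of_le (left_mem_Icc.2 zero_le_one) ht ht.1)

lemma IsProfile.lipschitzOnWith (hw : IsProfile w) : LipschitzOnWith 1 w (Icc 0 1) := by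
  refine LipschitzOnWith.of_le_add_mul 1 fun s hs t ht => ?_
  rw [NNReal.coe_one, one_mul, Real.dist_eq]
  rcases le_total s t with h | h
  · linarith [hw.le_of_le hs ht h, abs_nonneg (s - t)]
  · linarith [hw.sub_le ht hs h, le_abs_self (s - t)]

lemma IsProfile.continuousOn (hw : IsProfile w) : ContinuousOn w (Icc 0 1) :=
  hw.lipschitzOnWith.continuousOn

lemma IsProfile.lineMap (hv : IsProfile v) (hw : IsProfile w) {ε : ℝ} (h0 : 0 ≤ ε) (h1 : ε ≤ 1) :
    IsProfile fun t => v t + ε * (w t - v t) := by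
  have h1' : 0 ≤ 1 - ε := sub_nonneg.2 h1
  refine ⟨fun t ht => ?_, ?_, ?_⟩
  · obtain ⟨q, hq, hq'⟩ := hv.exists_slope t ht
    obtain ⟨r, hr, hr'⟩ := hw.exists_slope t ht
    refine ⟨(1 - ε) * q + ε * r, convex_Icc 0 1 hq hr h1' h0 (by ring), fun s hs => ?_⟩
    nlinarith [mul_le_mul_of_nonneg_left (hq' s hs) h1', mul_le_mul_of_nonneg_left (hr' s hs) h0]
  · nlinarith [mul_nonneg h1' hv.initial_nonneg, mul_nonneg h0 hw.initial_nonneg]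
  · nlinarith [mul_le_mul_of_nonneg_left hv.initial_le_one h1',
      mul_le_mul_of_nonneg_left hw.initial_le_one h0]

/-- A monotone function into the unit interval integrates to a profile. -/
lemma isProfile_of_monotone {m : ℝ → ℝ} (hm : Monotone m) (hm01 : ∀ t, m t ∈ Icc (0 : ℝ) 1)
    {c : ℝ} (hc : c ∈ Icc (0 : ℝ) 1) : IsProfile fun t => c + ∫ τ in (0 : ℝ)..t, m τ := by
  refine ⟨fun t _ => ⟨m t, hm01 t, fun s _ => ?_⟩, by simpa using hc.1, by simpa using hc.2⟩
  have hi : ∀ a b : ℝ, IntervalIntegrable m volume a b := fun a b => hm.intervalIntegrable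
  have h1 : (∫ τ in (0 : ℝ)..s, m τ) = (∫ τ in (0 : ℝ)..t, m τ) + ∫ τ in t..s, m τ :=
    (intervalIntegral.integral_add_adjacent_intervals (hi _ _) (hi _ _)).symm
  have h2 : (s - t) * m t ≤ ∫ τ in t..s, m τ := by
    rcases le_total t s with h | h
    · have := intervalIntegral.integral_mono_on h (intervalIntegrable_const (c := m t)) (hi t s)
        fun x hx => hm hx.1
      simpa using this
    · have := intervalIntegral.integral_mono_on h (hi s t) (intervalIntegrable_const (c := m t))
        fun x hx => hm hx.2
      rw [intervalIntegral.integral_symm]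
      simp only [intervalIntegral.integral_const, smul_eq_mul] at this
      linarith
  simp only [h1]
  linarith

/-- A profile is the integral of a monotone selection of its slopes. -/
lemma IsProfile.exists_monotone (hw : IsProfile w) : ∃ m : ℝ → ℝ, Monotone m ∧
    (∀ t, m t ∈ Icc (0 : ℝ) 1) ∧ (∀ t ∈ Icc (0 : ℝ) 1, IsSlope w t (m t)) ∧
    ∀ t ∈ Icc (0 : ℝ) 1, w t = w 0 + ∫ τ in (0 : ℝ)..t, m τ := by
  choose q hq hq' using hw.exists_slope
  have hproj : ∀ t : ℝ, (projIcc (0 : ℝ) 1 zero_le_one t : ℝ) ∈ Icc (0 : ℝ) 1 :=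
    fun t => (projIcc (0 : ℝ) 1 zero_le_one t).2
  -- Projecting to the unit interval extends the selection of slopes to a monotone function on the
  -- whole line.
  set m : ℝ → ℝ := fun t => q _ (hproj t) with hm
  have hmeq : ∀ t (ht : t ∈ Icc (0 : ℝ) 1), m t = q t ht := by
    intro t ht
    simp only [hm]
    congr 1
    rw [projIcc_of_mem _ ht]
  have hslope : ∀ t ∈ Icc (0 : ℝ) 1, IsSlope w t (m t) := by
    intro t ht
    rw [hmeq t ht]
    exact hq' t ht
  refine ⟨m, fun s t hst => ?_, fun t => hq _ _, hslope, fun t ht => ?_⟩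
  · have hle : (projIcc (0 : ℝ) 1 zero_le_one s : ℝ) ≤ projIcc (0 : ℝ) 1 zero_le_one t :=
      monotone_projIcc _ hst
    rcases hle.eq_or_lt with h | h
    · simp only [hm, h, le_refl]
    · exact IsSlope.le_of_lt (hproj s) (hproj t) (hq' _ _) (hq' _ _) h
  · have hac : AbsolutelyContinuousOnInterval w 0 t := by
      refine LipschitzOnWith.absolutelyContinuousOnInterval (hw.lipschitzOnWith.mono ?_)
      rw [uIcc_of_le ht.1]
      exact Icc_subset_Icc_right ht.2
    have h1 := hac.integral_deriv_eq_sub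
    have h2 : ∫ τ in (0 : ℝ)..t, deriv w τ = ∫ τ in (0 : ℝ)..t, m τ := by
      refine intervalIntegral.integral_congr_ae ?_
      filter_upwards [hac.ae_differentiableAt, Measure.ae_ne volume t] with τ hτ hne hτm
      rw [uIoc_of_le ht.1] at hτm
      have hτ1 : τ < 1 := (lt_of_le_of_ne hτm.2 hne).trans_le ht.2
      have hd := hτ (by rw [uIcc_of_le ht.1]; exact Ioc_subset_Icc_self hτm)
      -- Where `w` is differentiable, its only subgradient is its derivative.
      have hmin : IsLocalMin (fun s => w s - s * m τ) τ := by
        filter_upwards [Icc_mem_nhds hτm.1 hτ1] with s hs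
        linarith [hslope τ ⟨hτm.1.le, hτ1.le⟩ s hs]
      have h3 := hd.hasDerivAt.fun_sub ((hasDerivAt_id τ).mul_const (m τ))
      have h4 := hmin.hasDerivAt_eq_zero h3
      linarith
    rw [← h2, h1]
    ring

/-! ### The least mechanism with a given profile -/

/-- The smallest utility function with the profile `w` on the top and right edges. -/
def extendProfile (w : ℝ → ℝ) (x : ℝ × ℝ) : ℝ :=
  max (max 0 (w x.1 + x.2 - 1)) (w x.2 + x.1 - 1)

lemma extendProfile_swap (w : ℝ → ℝ) (x : ℝ × ℝ) : extendProfile w x.swap = extendProfile w x := by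
  simp only [extendProfile, Prod.fst_swap, Prod.snd_swap]
  exact max_right_comm _ _ _

lemma IsProfile.extendProfile_eq (hw : IsProfile w) {x : ℝ × ℝ} (hx : x ∈ square)
    (h : x.1 ≤ x.2) : extendProfile w x = max 0 (w x.1 + x.2 - 1) := by
  refine max_eq_left (le_max_of_le_right ?_)
  linarith [hw.sub_le hx.1 hx.2 h]

/-- At each type, the branch attaining the maximum supplies a supporting bundle: `0`, `(q, 1)` or
`(1, q)`, with `q` a slope of `w`. -/
lemma IsProfile.exists_mechanism (hw : IsProfile w) :
    ∃ p, IsFeasible p ∧ IsSymmetric p ∧ ∀ x ∈ square, utility p x = extendProfile w x := by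
  suffices h : ∃ p, IsFeasible p ∧ ∀ x ∈ square, utility p x = extendProfile w x by
    obtain ⟨p, hp, hpw⟩ := h
    refine ⟨p, hp, fun x hx => ?_, hpw⟩
    rw [hpw x hx, hpw _ (swap_mem_square hx), extendProfile_swap]
  refine exists_isFeasible_utility_eq ?_ ?_
  · have := hw.initial_le_one
    simp [extendProfile, this]
  · intro x hx
    rcases max_choice (max 0 (w x.1 + x.2 - 1)) (w x.2 + x.1 - 1) with h | h
    · rcases max_choice 0 (w x.1 + x.2 - 1) with h' | h'
      · refine ⟨0, zero_mem_square, fun y _ => ?_⟩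
        rw [extendProfile, h, h', extendProfile]
        simp
      · obtain ⟨q, hq, hq'⟩ := hw.exists_slope x.1 hx.1
        refine ⟨(q, 1), ⟨hq, right_mem_Icc.2 zero_le_one⟩, fun y hy => ?_⟩
        rw [extendProfile, h, h']
        refine le_max_of_le_left (le_max_of_le_right ?_)
        linarith [hq' y.1 hy.1]
    · obtain ⟨q, hq, hq'⟩ := hw.exists_slope x.2 hx.2
      refine ⟨(1, q), ⟨right_mem_Icc.2 zero_le_one, hq⟩, fun y hy => ?_⟩
      rw [extendProfile, h]
      refine le_max_of_le_right ?_
      linarith [hq' y.2 hy.2]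

lemma IsProfile.extendProfile_top (hw : IsProfile w) {t : ℝ} (ht : t ∈ Icc (0 : ℝ) 1) :
    extendProfile w (t, 1) = w t := by
  rw [hw.extendProfile_eq ⟨ht, right_mem_Icc.2 zero_le_one⟩ ht.2]
  simp [hw.nonneg ht]

/-- Half the revenue of the mechanism `extendProfile w`. -/
noncomputable def profileRevenue (f : ℝ × ℝ → ℝ) (w : ℝ → ℝ) : ℝ :=
  (∫ t in Icc 0 1, w t * f (t, 1)) - ∫ x in triangle, max 0 (w x.1 + x.2 - 1) * phiInt f x

lemma IsSRS.totalRevenue_eq_profileRevenue (hf : IsSRS f) (hw : IsProfile w) (hp : IsFeasible p)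
    (hsymm : IsSymmetric p) (hpw : ∀ x ∈ square, utility p x = extendProfile w x) :
    totalRevenue f p = 2 * profileRevenue f w := by
  rw [hf.totalRevenue_eq hp hsymm, profileRevenue]
  congr 2
  · refine setIntegral_congr_fun measurableSet_Icc fun t ht => ?_
    rw [hpw _ ⟨ht, right_mem_Icc.2 zero_le_one⟩, hw.extendProfile_top ht]
  · refine setIntegral_congr_fun isOpen_triangle.measurableSet fun x hx => ?_
    have hx' := openSquare_subset_square (triangle_subset_openSquare hx)
    rw [hpw x hx', hw.extendProfile_eq hx' hx.2.1.le]

/-! ### Optimal mechanisms sell upgrades -/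

/-- Moving up to the top edge raises utility at rate at most 1, the largest quantity of the second
good. -/
lemma IsFeasible.top_sub_le (hp : IsFeasible p) {x : ℝ × ℝ} (hx : x ∈ square) :
    ubar p x.1 + x.2 - 1 ≤ utility p x := by
  obtain ⟨q, hq, h⟩ := hp.exists_subgradient (x.1, 1)
  have h1 := h x
  simp only [sub_self, zero_mul, zero_add] at h1
  have h2 : ubar p x.1 = utility p (x.1, 1) := rfl
  nlinarith [mul_nonneg (sub_nonneg.2 hx.2.2) (sub_nonneg.2 hq.2.2)]

lemma IsFeasible.utility_zero_le (hp : IsFeasible p) {x : ℝ × ℝ} (hx : x ∈ square) :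
    utility p 0 ≤ utility p x := by
  obtain ⟨q, hq, h⟩ := hp.exists_subgradient 0
  have h1 := h x
  simp only [Prod.fst_zero, Prod.snd_zero, sub_zero] at h1
  linarith [mul_nonneg hx.1.1 hq.1.1, mul_nonneg hx.2.1 hq.2.1]

lemma IsFeasible.isProfile_sub (hp : IsFeasible p) :
    IsProfile fun t => ubar p t - utility p 0 := by
  refine ⟨fun t _ => ?_, ?_, ?_⟩
  · obtain ⟨q, hq, h⟩ := hp.exists_subgradient (t, 1)
    refine ⟨q.1, hq.1, fun s _ => ?_⟩
    have := h (s, 1)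
    simp only [sub_self, zero_mul, add_zero] at this
    simp only [ubar]
    linarith
  · have := hp.utility_zero_le (x := (0, 1))
      ⟨left_mem_Icc.2 zero_le_one, right_mem_Icc.2 zero_le_one⟩
    simpa [ubar] using this
  · obtain ⟨q, hq, h⟩ := hp.exists_subgradient (0, 1)
    have := h 0
    simp only [Prod.fst_zero, Prod.snd_zero, sub_self, zero_mul, zero_add] at this
    have h1 := hq.2.2
    simp only [ubar]
    linarith

lemma IsFeasible.continuous_ubar (hp : IsFeasible p) : Continuous (ubar p) :=
  hp.lipschitzWith.continuous.comp (by fun_prop : Continuous fun t : ℝ => (t, (1 : ℝ)))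

lemma mem_closure_triangle {x : ℝ × ℝ} (hx : x ∈ square) (h : x.1 ≤ x.2) :
    x ∈ closure triangle := by
  have hc : Continuous fun ε : ℝ =>
      ((x.1 + ε * (1 / 3 - x.1), x.2 + ε * (2 / 3 - x.2)) : ℝ × ℝ) := by fun_prop
  have ht : Tendsto (fun ε : ℝ => ((x.1 + ε * (1 / 3 - x.1), x.2 + ε * (2 / 3 - x.2)) : ℝ × ℝ))
      (𝓝[>] 0) (𝓝 x) := by
    have := (hc.tendsto 0).mono_left (nhdsWithin_le_nhds (s := Ioi (0 : ℝ)))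
    simpa using this
  refine mem_closure_of_tendsto ht ?_
  filter_upwards [self_mem_nhdsWithin, mem_nhdsWithin_of_mem_nhds (gt_mem_nhds one_pos)]
    with ε h0 h1
  simp only [mem_Ioi] at h0
  obtain ⟨⟨h2, h3⟩, h4, h5⟩ := hx
  exact ⟨by simp only; nlinarith, by simp only; nlinarith, by simp only; nlinarith⟩

/-- Compare with the least mechanism whose profile is `ū - c`, where `c = u(0)`. The excess `u - e -
c` over it is nonnegative, and optimality bounds its `φ`-integral by `-c/2`. Hence `c = 0` and the
excess vanishes almost everywhere, then everywhere by continuity. -/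
theorem IsOptimal.utility_eq_aux (hp : IsOptimal f p) (hf : IsSRS f) (hsymm : IsSymmetric p) :
    utility p 0 = 0 ∧ ∀ x ∈ triangle, utility p x = max 0 (ubar p x.1 + x.2 - 1) := by
  have hF := hp.feasible
  set c := utility p 0 with hc
  have hc0 : 0 ≤ c := hF.utility_nonneg 0
  have hw : IsProfile fun t => ubar p t - c := hF.isProfile_sub
  obtain ⟨p', hp', hs', hpw⟩ := hw.exists_mechanism
  have hle := hp.le p' hp'
  rw [hf.totalRevenue_eq_profileRevenue hw hp' hs' hpw, hf.totalRevenue_eq hF hsymm,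
    profileRevenue] at hle
  have hvc := hF.continuous_ubar
  set e : ℝ × ℝ → ℝ := fun x => max 0 (ubar p x.1 - c + x.2 - 1) with he
  have hec : Continuous e := by fun_prop
  have huc := hF.lipschitzWith.continuous
  have hi1 := (hf.integrableOn_mul_phiInt huc.continuousOn).mono_set triangle_subset_openSquare
  have hi2 := (hf.integrableOn_mul_phiInt hec.continuousOn).mono_set triangle_subset_openSquare
  have hi3 := (hf.integrableOn_mul_phiInt (continuousOn_const (c := c))).mono_set
    triangle_subset_openSquare
  have htop : ∫ t in Icc 0 1, (ubar p t - c) * f (t, 1)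
      = (∫ t in Icc 0 1, utility p (t, 1) * f (t, 1)) - c * ∫ t in Icc 0 1, f (t, 1) := by
    have hft := hf.continuousOn_top
    rw [← integral_const_mul, ← integral_sub]
    · refine setIntegral_congr_fun measurableSet_Icc fun t _ => ?_
      simp only [ubar]
      ring
    · exact (hvc.continuousOn.mul hft).integrableOn_compact isCompact_Icc
    · exact (continuousOn_const.mul hft).integrableOn_compact isCompact_Icc
  have hsum : ∫ x in triangle, (utility p x - e x - c) * phiInt f x
      = (∫ x in triangle, utility p x * phiInt f x) - (∫ x in triangle, e x * phiInt f x)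
        - c * ∫ x in triangle, phiInt f x := by
    rw [← integral_const_mul, ← integral_sub hi1 hi2, ← integral_sub (by exact hi1.sub hi2) hi3]
    refine integral_congr_ae (Eventually.of_forall fun x => ?_)
    simp only
    ring
  have hnn : ∀ x ∈ triangle, 0 ≤ utility p x - e x - c := by
    intro x hx
    have hxs := openSquare_subset_square (triangle_subset_openSquare hx)
    have h1 := hF.utility_zero_le hxs
    have h2 := hF.top_sub_le hxs
    have h3 : e x ≤ utility p x - c := max_le (by linarith) (by linarith)
    linarith
  have hφ : ∀ x ∈ triangle, 0 ≤ phiInt f x := fun x hx =>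
    hf.phiInt_nonneg (triangle_subset_openSquare hx)
  have hint0 : 0 ≤ ∫ x in triangle, (utility p x - e x - c) * phiInt f x :=
    setIntegral_nonneg isOpen_triangle.measurableSet fun x hx => mul_nonneg (hnn x hx) (hφ x hx)
  have hfull := hf.setIntegral_triangle_phiInt
  rw [hfull] at hsum
  have hcz : c = 0 := by nlinarith
  refine ⟨hcz, ?_⟩
  have hz : ∫ x in triangle, (utility p x - e x - c) * phiInt f x = 0 := by nlinarith
  have hcont : Continuous fun x => utility p x - e x - c := by fun_prop
  rw [setIntegral_eq_zero_iff_of_nonneg_ae] at hz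
  · have hpos : ∀ᵐ x ∂(volume.restrict triangle), 0 < phiInt f x :=
      ae_restrict_of_ae_restrict_of_subset triangle_subset_openSquare hf.strictly_regular
    have hae : (fun x => utility p x - e x - c) =ᵐ[volume.restrict triangle] fun _ => 0 := by
      filter_upwards [hz, hpos] with x hx hx'
      exact (mul_eq_zero.1 hx).resolve_right hx'.ne'
    have heq := Measure.eqOn_open_of_ae_eq hae isOpen_triangle hcont.continuousOn
      continuousOn_const
    intro x hx
    have := heq hx
    simp only [he, hcz] at this
    rw [sub_zero, sub_zero] at this
    linarith
  · exact (ae_restrict_iff' isOpen_triangle.measurableSet).2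
      (Eventually.of_forall fun x hx => mul_nonneg (hnn x hx) (hφ x hx))
  · exact (hf.integrableOn_mul_phiInt hcont.continuousOn).mono_set triangle_subset_openSquare

/-- The profile of an optimal symmetric mechanism. -/
theorem IsOptimal.isProfile (hp : IsOptimal f p) (hf : IsSRS f) (hsymm : IsSymmetric p) :
    IsProfile (ubar p) := by
  have := hp.feasible.isProfile_sub
  simpa [(hp.utility_eq_aux hf hsymm).1] using this

/-- A symmetric optimal mechanism is determined by its profile. -/
theorem IsOptimal.utility_eq (hp : IsOptimal f p) (hf : IsSRS f) (hsymm : IsSymmetric p)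
    {x : ℝ × ℝ} (hx : x ∈ square) : utility p x = extendProfile (ubar p) x := by
  have hw := hp.isProfile hf hsymm
  have hF := hp.feasible
  have hvc := hF.continuous_ubar
  have huc := hF.lipschitzWith.continuous
  have key : ∀ x ∈ square, x.1 ≤ x.2 → utility p x = extendProfile (ubar p) x := by
    intro x hx h
    rw [hw.extendProfile_eq hx h]
    have hcl : IsClosed {x : ℝ × ℝ | utility p x = max 0 (ubar p x.1 + x.2 - 1)} :=
      isClosed_eq huc (by fun_prop)
    exact closure_minimal (hp.utility_eq_aux hf hsymm).2 hcl (mem_closure_triangle hx h)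
  rcases le_total x.1 x.2 with h | h
  · exact key x hx h
  · rw [← hsymm x hx, ← extendProfile_swap]
    exact key _ (swap_mem_square hx) h


end TwoGoods

namespace TwoGoods

/-! ### The first-order condition -/

variable {f p : ℝ × ℝ → ℝ} {w v : ℝ → ℝ}

lemma measurableSet_triangle : MeasurableSet triangle := isOpen_triangle.measurableSet

lemma indicator_triangle (g : ℝ × ℝ → ℝ) {t : ℝ} (ht : t ∈ Ioo (0 : ℝ) 1) :
    ∫ y in Ioo 0 1, triangle.indicator g (t, y) = ∫ y in Ioo t 1, g (t, y) := by
  have h : ∀ y, triangle.indicator g (t, y) = (Ioo t 1).indicator (fun y => g (t, y)) y := by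
    intro y
    by_cases hy : y ∈ Ioo t 1
    · rw [indicator_of_mem hy, indicator_of_mem]
      exact ⟨ht.1, hy⟩
    · rw [indicator_of_notMem hy, indicator_of_notMem]
      exact fun h => hy h.2
  simp only [h]
  rw [setIntegral_indicator measurableSet_Ioo]
  congr 2
  rw [inter_eq_right]
  exact Ioo_subset_Ioo_left ht.1.le

lemma integrableOn_indicator_triangle {g : ℝ × ℝ → ℝ} (hg : IntegrableOn g triangle) :
    Integrable (triangle.indicator g)
      ((volume.restrict (Ioo (0 : ℝ) 1)).prod (volume.restrict (Ioo (0 : ℝ) 1))) := by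
  rw [Measure.prod_restrict]
  exact (hg.integrable_indicator measurableSet_triangle).integrableOn

lemma setIntegral_triangle_slices {g : ℝ × ℝ → ℝ} (hg : IntegrableOn g triangle) :
    ∫ x in triangle, g x = ∫ t in Ioo 0 1, ∫ y in Ioo t 1, g (t, y) := by
  have h1 : ∫ x in triangle, g x = ∫ x in openSquare, triangle.indicator g x := by
    rw [setIntegral_indicator measurableSet_triangle,
      inter_eq_right.2 triangle_subset_openSquare]
  have h2 := integral_prod _ (integrableOn_indicator_triangle hg)
  rw [Measure.prod_restrict] at h2
  rw [h1]
  refine h2.trans (setIntegral_congr_fun measurableSet_Ioo fun t ht => ?_)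
  exact indicator_triangle g ht

lemma integrableOn_triangle_slices {g : ℝ × ℝ → ℝ} (hg : IntegrableOn g triangle) :
    IntegrableOn (fun t => ∫ y in Ioo t 1, g (t, y)) (Ioo 0 1) := by
  refine (integrableOn_indicator_triangle hg).integral_prod_left.congr ?_
  filter_upwards [ae_restrict_mem measurableSet_Ioo] with t ht
  exact indicator_triangle g ht

lemma IsTypeDensity.integrableOn_mul_slice (hf : IsTypeDensity f) {t : ℝ}
    (ht : t ∈ Ioo (0 : ℝ) 1) {h : ℝ → ℝ} (hh : Continuous h) :
    IntegrableOn (fun y => h y * phi f (t, y)) (Ioo t 1) := by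
  have h1 : IntegrableOn (fun y => phi f (t, y)) (Icc 0 1) :=
    (integrableOn_Icc_iff_integrableOn_Ioc (by simp)).2 (hf.integrableOn_slice (Ioo_subset_Ico_self ht))
  exact (h1.continuousOn_mul hh.continuousOn isCompact_Icc).mono_set
    ((Ioo_subset_Ioo_left ht.1.le).trans Ioo_subset_Icc_self)

lemma slicePhi_eq_setIntegral {a t : ℝ} (ha : 0 ≤ a) (ht : t ∈ Ioo (0 : ℝ) 1) :
    slicePhi f a t
      = (∫ y in Ioo t 1, (Ioi (1 - a)).indicator (fun y => phi f (t, y)) y) - f (t, 1) := by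
  rw [slicePhi, setIntegral_indicator measurableSet_Ioi, intervalIntegral.integral_of_le
    (max_one_sub_mem ha (Ioo_subset_Icc_self ht)).2, integral_Ioc_eq_integral_Ioo]
  congr 3
  ext y
  simp only [mem_Ioo, mem_inter_iff, mem_Ioi, max_lt_iff]
  tauto

/-- The contribution of the types with first coordinate `t` to `profileRevenue`. -/
noncomputable def sliceRevenue (f : ℝ × ℝ → ℝ) (a t : ℝ) : ℝ :=
  a * f (t, 1) - ∫ y in Ioo t 1, max 0 (a + y - 1) * phi f (t, y)

lemma IsSRS.phi_nonneg (hf : IsSRS f) {x : ℝ × ℝ} (hx : x ∈ openSquare) : 0 ≤ phi f x := by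
  rw [hf.phi_eq hx]
  exact hf.phiInt_nonneg hx

/-- Slice revenue is concave in `a` because `φ ≥ 0`, and `-slicePhi f b t` is a supergradient at
`b`. -/
lemma IsSRS.sliceRevenue_sub_ge (hf : IsSRS f) {a b t : ℝ} (hb : 0 ≤ b)
    (ht : t ∈ Ioo (0 : ℝ) 1) :
    -((b - a) * slicePhi f b t) ≤ sliceRevenue f b t - sliceRevenue f a t := by
  have hi : ∀ c : ℝ, IntegrableOn (fun y => max 0 (c + y - 1) * phi f (t, y)) (Ioo t 1) :=
    fun c => hf.integrableOn_mul_slice ht (by fun_prop)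
  have hphi : IntegrableOn (fun y => phi f (t, y)) (Ioo t 1) := by
    simpa using hf.integrableOn_mul_slice ht (continuous_const (y := (1 : ℝ)))
  have key : (∫ y in Ioo t 1, max 0 (b + y - 1) * phi f (t, y))
      - (∫ y in Ioo t 1, max 0 (a + y - 1) * phi f (t, y))
      ≤ (b - a) * ∫ y in Ioo t 1, (Ioi (1 - b)).indicator (fun y => phi f (t, y)) y := by
    rw [← integral_sub (hi b) (hi a), ← integral_const_mul]
    refine setIntegral_mono_on ((hi b).sub (hi a))
      ((hphi.indicator measurableSet_Ioi).const_mul _) measurableSet_Ioo fun y hy => ?_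
    have h0 := hf.phi_nonneg (x := (t, y)) ⟨ht, ht.1.trans hy.1, hy.2⟩
    by_cases h : y ∈ Ioi (1 - b)
    · rw [indicator_of_mem h, ← sub_mul]
      refine mul_le_mul_of_nonneg_right ?_ h0
      have h1 : 0 ≤ b + y - 1 := by
        have : 1 - b < y := h
        linarith
      rw [max_eq_right h1]
      linarith [le_max_right 0 (a + y - 1)]
    · rw [indicator_of_notMem h, ← sub_mul, mul_zero]
      refine mul_nonpos_of_nonpos_of_nonneg ?_ h0
      have h1 : b + y - 1 ≤ 0 := by
        have : y ≤ 1 - b := not_lt.1 h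
        linarith
      rw [max_eq_left h1]
      linarith [le_max_left 0 (a + y - 1)]
  rw [slicePhi_eq_setIntegral hb ht, sliceRevenue, sliceRevenue]
  linarith

lemma IsSRS.integrableOn_max_profile (hf : IsSRS f) (hw : ContinuousOn w (Icc 0 1)) :
    IntegrableOn (fun x : ℝ × ℝ => max 0 (w x.1 + x.2 - 1) * phiInt f x) triangle := by
  refine (hf.integrableOn_mul_phiInt ?_).mono_set triangle_subset_openSquare
  have h1 : ContinuousOn (fun x : ℝ × ℝ => w x.1) square :=
    hw.comp continuous_fst.continuousOn fun x hx => hx.1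
  exact continuousOn_const.sup ((h1.add continuous_snd.continuousOn).sub continuousOn_const)

lemma setIntegral_max_slice (hf : IsTypeDensity f) (a : ℝ) {t : ℝ} (ht : t ∈ Ioo (0 : ℝ) 1) :
    ∫ y in Ioo t 1, max 0 (a + y - 1) * phiInt f (t, y)
      = ∫ y in Ioo t 1, max 0 (a + y - 1) * phi f (t, y) := by
  refine setIntegral_congr_fun measurableSet_Ioo fun y hy => ?_
  rw [hf.phi_eq ⟨ht, ht.1.trans hy.1, hy.2⟩]

lemma IsSRS.integrableOn_sliceRevenue (hf : IsSRS f) (hw : ContinuousOn w (Icc 0 1)) :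
    IntegrableOn (fun t => sliceRevenue f (w t) t) (Ioo 0 1) := by
  have h1 : IntegrableOn (fun t => w t * f (t, 1)) (Ioo 0 1) :=
    ((hw.mul hf.continuousOn_top).integrableOn_compact isCompact_Icc).mono_set Ioo_subset_Icc_self
  refine h1.sub ((integrableOn_triangle_slices (hf.integrableOn_max_profile hw)).congr_fun
    (fun t ht => ?_) measurableSet_Ioo)
  exact setIntegral_max_slice hf.toIsTypeDensity (w t) ht

lemma IsSRS.profileRevenue_eq (hf : IsSRS f) (hw : ContinuousOn w (Icc 0 1)) :
    profileRevenue f w = ∫ t in Ioo 0 1, sliceRevenue f (w t) t := by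
  have h1 : IntegrableOn (fun t => w t * f (t, 1)) (Ioo 0 1) :=
    ((hw.mul hf.continuousOn_top).integrableOn_compact isCompact_Icc).mono_set Ioo_subset_Icc_self
  have hi := hf.integrableOn_max_profile hw
  rw [profileRevenue, setIntegral_triangle_slices hi, integral_Icc_eq_integral_Ioo,
    ← integral_sub h1 (integrableOn_triangle_slices hi)]
  refine setIntegral_congr_fun measurableSet_Ioo fun t ht => ?_
  simp only [sliceRevenue]
  rw [← setIntegral_max_slice hf.toIsTypeDensity _ ht]

lemma IsOptimal.profileRevenue_le (hp : IsOptimal f p) (hf : IsSRS f) (hsymm : IsSymmetric p)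
    (hw : IsProfile w) : profileRevenue f w ≤ profileRevenue f (ubar p) := by
  obtain ⟨p', hp', hs', hpw⟩ := hw.exists_mechanism
  have h := hp.le p' hp'
  rw [hf.totalRevenue_eq_profileRevenue hw hp' hs' hpw,
    hf.totalRevenue_eq_profileRevenue (hp.isProfile hf hsymm) hp.feasible hsymm
      fun x hx => hp.utility_eq hf hsymm hx] at h
  linarith

lemma IsOptimal.continuousOn_Phi (hp : IsOptimal f p) (hf : IsSRS f) (hsymm : IsSymmetric p) :
    ContinuousOn (Phi f p) (Icc 0 1) :=
  hf.continuousOn_slicePhi (hp.isProfile hf hsymm).continuousOn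
    fun _ ht => (hp.isProfile hf hsymm).nonneg ht

/-- First-order condition: moving the profile towards another profile does not raise revenue. -/
theorem IsOptimal.integral_Phi_mul_nonneg (hp : IsOptimal f p) (hf : IsSRS f)
    (hsymm : IsSymmetric p) (hw : IsProfile w) :
    0 ≤ ∫ t in Ioo 0 1, (w t - ubar p t) * Phi f p t := by
  have hv := hp.isProfile hf hsymm
  set v := ubar p with hvdef
  obtain ⟨C, hC0, hC⟩ := hf.exists_slicePhi_lipschitz
  have hPhi := hp.continuousOn_Phi hf hsymm
  have hd : ContinuousOn (fun t => w t - v t) (Icc 0 1) := hw.continuousOn.sub hv.continuousOn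
  have hint : ∀ {g : ℝ → ℝ}, ContinuousOn g (Icc 0 1) → IntegrableOn g (Ioo 0 1) :=
    fun hg => (hg.integrableOn_compact isCompact_Icc).mono_set Ioo_subset_Icc_self
  set I := ∫ t in Ioo 0 1, (w t - v t) * Phi f p t
  set J := ∫ t in Ioo 0 1, C * (w t - v t) ^ 2
  have key : ∀ ε ∈ Ioc (0 : ℝ) 1, 0 ≤ I + ε * J := by
    intro ε hε
    have hwε : IsProfile fun t => v t + ε * (w t - v t) := hv.lineMap hw hε.1.le hε.2
    have hle := hp.profileRevenue_le hf hsymm hwε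
    rw [hf.profileRevenue_eq hwε.continuousOn, hf.profileRevenue_eq hv.continuousOn] at hle
    have hsl := hf.continuousOn_slicePhi hwε.continuousOn fun t ht => hwε.nonneg ht
    -- The supergradient is taken at the perturbed profile, so concavity bounds the gain from below.
    have h1 : ∫ t in Ioo 0 1, -(ε * (w t - v t) * slicePhi f (v t + ε * (w t - v t)) t)
        ≤ ∫ t in Ioo 0 1, (sliceRevenue f (v t + ε * (w t - v t)) t - sliceRevenue f (v t) t) := by
      refine setIntegral_mono_on (hint ((continuousOn_const.mul hd).mul hsl).neg)
        ((hf.integrableOn_sliceRevenue hwε.continuousOn).sub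
          (hf.integrableOn_sliceRevenue hv.continuousOn)) measurableSet_Ioo fun t ht => ?_
      have := hf.sliceRevenue_sub_ge (a := v t) (hwε.nonneg (Ioo_subset_Icc_self ht)) ht
      rwa [add_sub_cancel_left] at this
    rw [integral_sub (hf.integrableOn_sliceRevenue hwε.continuousOn)
      (hf.integrableOn_sliceRevenue hv.continuousOn)] at h1
    have h2 : ∫ t in Ioo 0 1, -(ε * (w t - v t) * slicePhi f (v t + ε * (w t - v t)) t) ≤ 0 := by
      linarith
    -- Replacing the perturbed `slicePhi` by `Φ` costs only order `ε²`, by the Lipschitz estimate.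
    have h3 : ∫ t in Ioo 0 1, -(ε * ((w t - v t) * Phi f p t + ε * (C * (w t - v t) ^ 2)))
        ≤ ∫ t in Ioo 0 1, -(ε * (w t - v t) * slicePhi f (v t + ε * (w t - v t)) t) := by
      refine setIntegral_mono_on (hint (continuousOn_const.mul ((hd.mul hPhi).add
        (continuousOn_const.mul (continuousOn_const.mul (hd.pow 2))))).neg)
        (hint ((continuousOn_const.mul hd).mul hsl).neg) measurableSet_Ioo fun t ht => ?_
      have ht' := Ioo_subset_Icc_self ht
      have hl := hC t (Ioo_subset_Ico_self ht) _ _ (hwε.nonneg ht') (hv.nonneg ht')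
      rw [add_sub_cancel_left, abs_mul, abs_of_pos hε.1] at hl
      have hl2 : (w t - v t) * (slicePhi f (v t + ε * (w t - v t)) t - slicePhi f (v t) t)
          ≤ ε * (C * (w t - v t) ^ 2) := by
        refine (le_abs_self _).trans ?_
        rw [abs_mul, ← sq_abs (w t - v t)]
        calc |w t - v t| * |slicePhi f (v t + ε * (w t - v t)) t - slicePhi f (v t) t|
            ≤ |w t - v t| * (C * (ε * |w t - v t|)) :=
              mul_le_mul_of_nonneg_left hl (abs_nonneg _)
          _ = _ := by ring
      rw [Phi_eq, ← hvdef]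
      nlinarith [mul_le_mul_of_nonneg_left hl2 hε.1.le]
    have h4 : ∫ t in Ioo 0 1, -(ε * ((w t - v t) * Phi f p t + ε * (C * (w t - v t) ^ 2)))
        = -(ε * (I + ε * J)) := by
      rw [integral_neg, integral_const_mul, integral_add (by exact hint (hd.mul hPhi))
        (by exact hint (continuousOn_const.mul (continuousOn_const.mul (hd.pow 2)))),
        integral_const_mul]
    rw [h4] at h3
    have h5 : 0 ≤ ε * (I + ε * J) := by linarith
    exact nonneg_of_mul_nonneg_right h5 hε.1
  have hlim : Tendsto (fun ε : ℝ => I + ε * J) (𝓝[>] 0) (𝓝 I) := by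
    have hc : Continuous fun ε : ℝ => I + ε * J := by fun_prop
    simpa using (hc.tendsto 0).mono_left (nhdsWithin_le_nhds (s := Ioi (0 : ℝ)))
  refine ge_of_tendsto hlim ?_
  filter_upwards [self_mem_nhdsWithin, mem_nhdsWithin_of_mem_nhds (gt_mem_nhds one_pos)]
    with ε h0 h1
  exact key ε ⟨h0, h1.le⟩


end TwoGoods

namespace TwoGoods

/-! ### Stationary profiles -/

variable {g h v : ℝ → ℝ}

/-- The integral of `h` from `s` to `1`. -/
noncomputable def tail (h : ℝ → ℝ) (s : ℝ) : ℝ := ∫ t in s..1, h t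

lemma hasDerivAt_tail (hh : Continuous h) (s : ℝ) : HasDerivAt (tail h) (-h s) s :=
  intervalIntegral.integral_hasDerivAt_left (hh.intervalIntegrable _ _)
    (hh.stronglyMeasurableAtFilter _ _) hh.continuousAt

lemma continuous_tail (hh : Continuous h) : Continuous (tail h) :=
  continuous_iff_continuousAt.2 fun s => (hasDerivAt_tail hh s).continuousAt

lemma tail_one (h : ℝ → ℝ) : tail h 1 = 0 := intervalIntegral.integral_same

lemma tail_sub_tail (hh : Continuous h) (a b : ℝ) : tail h a - tail h b = ∫ t in a..b, h t := by
  rw [tail, tail, ← intervalIntegral.integral_add_adjacent_intervals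
    (hh.intervalIntegrable a b) (hh.intervalIntegrable b 1)]
  ring

lemma tail_lt_of_pos (hh : Continuous h) {a b : ℝ} (hab : a < b)
    (hpos : ∀ x ∈ Ioo a b, 0 < h x) : tail h b < tail h a := by
  have := intervalIntegral.intervalIntegral_pos_of_pos_on (hh.intervalIntegrable a b) hpos hab
  rw [← tail_sub_tail hh] at this
  linarith

lemma tail_lt_of_neg (hh : Continuous h) {a b : ℝ} (hab : a < b)
    (hneg : ∀ x ∈ Ioo a b, h x < 0) : tail h a < tail h b := by
  have := intervalIntegral.intervalIntegral_pos_of_pos_on (hh.neg.intervalIntegrable a b)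
    (fun x hx => by simpa using hneg x hx) hab
  simp only [Pi.neg_apply, intervalIntegral.integral_neg] at this
  rw [← tail_sub_tail hh] at this
  linarith

lemma exists_Icc_of_pos (hh : Continuous h) {s : ℝ} (hs : 0 < h s) :
    ∃ δ > 0, ∀ x ∈ Icc (s - δ) (s + δ), 0 < h x := by
  obtain ⟨δ, hδ, hball⟩ := Metric.eventually_nhds_iff.1 (hh.continuousAt.eventually (lt_mem_nhds hs))
  refine ⟨δ / 2, half_pos hδ, fun x hx => hball ?_⟩
  rw [Real.dist_eq]
  exact (abs_le.2 ⟨by linarith [hx.1], by linarith [hx.2]⟩).trans_lt (half_lt_self hδ)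

lemma exists_Icc_of_neg (hh : Continuous h) {s : ℝ} (hs : h s < 0) :
    ∃ δ > 0, ∀ x ∈ Icc (s - δ) (s + δ), h x < 0 := by
  obtain ⟨δ, hδ, H⟩ := exists_Icc_of_pos hh.neg (s := s) (by simpa using hs)
  exact ⟨δ, hδ, fun x hx => by simpa using H x hx⟩

/-! ### First- and second-order conditions at minima of the double tail integral. -/

lemma tail_nonpos_of_isMin (hg : Continuous g) {s : ℝ} (hs : s < 1)
    (hmin : ∀ r ∈ Icc s 1, tail (tail g) s ≤ tail (tail g) r) : tail g s ≤ 0 := by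
  by_contra! hpos
  obtain ⟨δ, hδ, H⟩ := exists_Icc_of_pos (continuous_tail hg) hpos
  have hlt : s < min (s + δ) 1 := lt_min (by linarith) hs
  refine (tail_lt_of_pos (continuous_tail hg) hlt fun x hx => H x ⟨?_, ?_⟩).not_ge
    (hmin _ ⟨hlt.le, min_le_right _ _⟩)
  · linarith [hx.1]
  · exact hx.2.le.trans (min_le_left _ _)

lemma tail_nonneg_of_isMin (hg : Continuous g) {s : ℝ} (hs : 0 < s)
    (hmin : ∀ r ∈ Icc 0 s, tail (tail g) s ≤ tail (tail g) r) : 0 ≤ tail g s := by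
  by_contra! hneg
  obtain ⟨δ, hδ, H⟩ := exists_Icc_of_neg (continuous_tail hg) hneg
  have hlt : max (s - δ) 0 < s := max_lt (by linarith) hs
  refine (tail_lt_of_neg (continuous_tail hg) hlt fun x hx => H x ⟨?_, ?_⟩).not_ge
    (hmin _ ⟨le_max_right _ _, hlt.le⟩)
  · exact (le_max_left _ _).trans hx.1.le
  · linarith [hx.2]

/-- If `g < 0` near `s`, then `tail g` rises from 0 to the right of `s`, so `tail (tail g)` falls
strictly below its minimum. -/
lemma nonneg_of_isMin_right (hg : Continuous g) {s : ℝ} (hs : s < 1) (h0 : tail g s = 0)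
    (hmin : ∀ r ∈ Icc s 1, tail (tail g) s ≤ tail (tail g) r) : 0 ≤ g s := by
  by_contra! hneg
  obtain ⟨δ, hδ, H⟩ := exists_Icc_of_neg hg hneg
  have hlt : s < min (s + δ) 1 := lt_min (by linarith) hs
  refine (tail_lt_of_pos (continuous_tail hg) hlt fun x hx => ?_).not_ge
    (hmin _ ⟨hlt.le, min_le_right _ _⟩)
  rw [← h0]
  refine tail_lt_of_neg hg hx.1 fun y hy => H y ⟨?_, ?_⟩
  · linarith [hy.1]
  · exact (hy.2.trans hx.2).le.trans (min_le_left _ _)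

lemma nonneg_of_isMin_left (hg : Continuous g) {s : ℝ} (hs : 0 < s) (h0 : tail g s = 0)
    (hmin : ∀ r ∈ Icc 0 s, tail (tail g) s ≤ tail (tail g) r) : 0 ≤ g s := by
  by_contra! hneg
  obtain ⟨δ, hδ, H⟩ := exists_Icc_of_neg hg hneg
  have hlt : max (s - δ) 0 < s := max_lt (by linarith) hs
  refine (tail_lt_of_neg (continuous_tail hg) hlt fun x hx => ?_).not_ge
    (hmin _ ⟨le_max_right _ _, hlt.le⟩)
  rw [← h0]
  refine tail_lt_of_neg hg hx.2 fun y hy => H y ⟨?_, ?_⟩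
  · exact (le_max_left _ _).trans (hx.1.trans hy.1).le
  · linarith [hy.2]

/-- The derivative of `tail g` is `-g`, and a nonzero derivative isolates a zero. -/
lemma eq_zero_of_tail_accumulates (hg : Continuous g) {s : ℝ}
    (hacc : ∀ ε > 0, ∃ r, r ≠ s ∧ |r - s| < ε ∧ tail g r = 0) : g s = 0 := by
  by_contra hne
  have hev := (hasDerivAt_tail hg s).eventually_ne (c := 0) (neg_ne_zero.2 hne)
  rw [eventually_nhdsWithin_iff] at hev
  obtain ⟨ε, hε, hball⟩ := Metric.eventually_nhds_iff.1 hev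
  obtain ⟨r, hrs, hr, hr0⟩ := hacc ε hε
  exact hball (by rwa [Real.dist_eq]) hrs hr0

/-- Integration by parts against a tail integral. -/
lemma integral_integral_mul_eq (hg : Continuous g) {m : ℝ → ℝ} (hm : Monotone m) :
    ∫ t in (0 : ℝ)..1, (∫ τ in (0 : ℝ)..t, m τ) * g t = ∫ t in (0 : ℝ)..1, m t * tail g t := by
  have hi : IntervalIntegrable m volume 0 1 := hm.intervalIntegrable
  have hac1 : AbsolutelyContinuousOnInterval (fun t => ∫ τ in (0 : ℝ)..t, m τ) 0 1 :=
    hi.absolutelyContinuousOnInterval_intervalIntegral (by simp)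
  -- Basing this antiderivative at 1 and the other at 0 kills both boundary terms.
  have hac2 : AbsolutelyContinuousOnInterval (fun s => ∫ t in (1 : ℝ)..s, g t) 0 1 :=
    (hg.intervalIntegrable 0 1).absolutelyContinuousOnInterval_intervalIntegral (by simp)
  have h := hac1.integral_deriv_mul_eq_sub hac2
  simp only [intervalIntegral.integral_same, mul_zero, zero_mul, sub_zero] at h
  have h1 : ∫ x in (0 : ℝ)..1, (deriv (fun t => ∫ τ in (0 : ℝ)..t, m τ) x
        * (∫ t in (1 : ℝ)..x, g t)
        + (∫ τ in (0 : ℝ)..x, m τ) * deriv (fun s => ∫ t in (1 : ℝ)..s, g t) x)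
      = ∫ x in (0 : ℝ)..1, (-(m x * tail g x) + (∫ τ in (0 : ℝ)..x, m τ) * g x) := by
    refine intervalIntegral.integral_congr_ae ?_
    filter_upwards [LocallyIntegrable.ae_hasDerivAt_integral hm.locallyIntegrable] with x hx _
    rw [(hx 0).deriv, (intervalIntegral.integral_hasDerivAt_right (hg.intervalIntegrable _ _)
      (hg.stronglyMeasurableAtFilter _ _) hg.continuousAt).deriv, tail,
      intervalIntegral.integral_symm x 1]
    ring
  have hi1 : IntervalIntegrable (fun x => m x * tail g x) volume 0 1 :=
    hi.mul_continuousOn (continuous_tail hg).continuousOn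
  have hi2 : IntervalIntegrable (fun x => (∫ τ in (0 : ℝ)..x, m τ) * g x) volume 0 1 :=
    (hac1.continuousOn.mul hg.continuousOn).intervalIntegrable
  rw [h1, intervalIntegral.integral_add (by exact hi1.neg) hi2, intervalIntegral.integral_neg] at h
  linarith

/-- `v` minimizes the linear functional `w ↦ ∫ w g` among all profiles. -/
structure IsStationary (g v : ℝ → ℝ) : Prop where
  continuous : Continuous g
  isProfile : IsProfile v
  integral_nonneg : ∀ w, IsProfile w → 0 ≤ ∫ t in (0 : ℝ)..1, (w t - v t) * g t

/-- A competitor is described by an initial value `c` and a monotone slope `n`, chosen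
independently, so level and slope can be varied separately. -/
lemma IsStationary.slope_form (hs : IsStationary g v) {m : ℝ → ℝ} (hm : Monotone m)
    (hmv : ∀ t ∈ Icc (0 : ℝ) 1, v t = v 0 + ∫ τ in (0 : ℝ)..t, m τ) {n : ℝ → ℝ}
    (hn : Monotone n) (hn01 : ∀ t, n t ∈ Icc (0 : ℝ) 1) {c : ℝ} (hc : c ∈ Icc (0 : ℝ) 1) :
    0 ≤ (c - v 0) * tail g 0 + ∫ t in (0 : ℝ)..1, (n t - m t) * tail g t := by
  have h1 := hs.integral_nonneg _ (isProfile_of_monotone hn hn01 hc)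
  have hcg := hs.continuous
  have hP := continuous_tail hcg
  have hcm : ∀ {k : ℝ → ℝ}, Monotone k →
      IntervalIntegrable (fun t => (∫ τ in (0 : ℝ)..t, k τ) * g t) volume 0 1 := by
    intro k hk
    have hac : AbsolutelyContinuousOnInterval (fun t => ∫ τ in (0 : ℝ)..t, k τ) 0 1 :=
      IntervalIntegrable.absolutelyContinuousOnInterval_intervalIntegral
        hk.intervalIntegrable (by simp)
    exact (hac.continuousOn.mul hcg.continuousOn).intervalIntegrable
  have hmi : ∀ {k : ℝ → ℝ}, Monotone k →
      IntervalIntegrable (fun t => k t * tail g t) volume 0 1 := fun hk =>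
    IntervalIntegrable.mul_continuousOn hk.intervalIntegrable hP.continuousOn
  have h2 : ∫ t in (0 : ℝ)..1, ((c + ∫ τ in (0 : ℝ)..t, n τ) - v t) * g t
      = ∫ t in (0 : ℝ)..1, ((c - v 0) * g t + ((∫ τ in (0 : ℝ)..t, n τ) * g t
          - (∫ τ in (0 : ℝ)..t, m τ) * g t)) := by
    refine intervalIntegral.integral_congr fun t ht => ?_
    rw [uIcc_of_le zero_le_one] at ht
    simp only [hmv t ht]
    ring
  rw [h2, intervalIntegral.integral_add ((hcg.intervalIntegrable _ _).const_mul _)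
    ((hcm hn).sub (hcm hm)), intervalIntegral.integral_sub (hcm hn) (hcm hm),
    intervalIntegral.integral_const_mul, integral_integral_mul_eq hcg hn,
    integral_integral_mul_eq hcg hm, ← intervalIntegral.integral_sub (hmi hn) (hmi hm)] at h1
  simp only [sub_mul]
  simp only [sub_mul] at h1
  exact h1

/-- When `v 0 < 1`, the whole profile can be raised with its slopes unchanged. -/
lemma IsStationary.tail_zero_nonneg (hs : IsStationary g v) (h : v 0 < 1) : 0 ≤ tail g 0 := by
  obtain ⟨m, hm, hm01, -, hmv⟩ := hs.isProfile.exists_monotone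
  have := hs.slope_form hm hmv hm hm01 (right_mem_Icc.2 zero_le_one)
  simp only [sub_self, zero_mul, intervalIntegral.integral_zero, add_zero] at this
  exact nonneg_of_mul_nonneg_right this (sub_pos.2 h)

lemma IsStationary.tail_zero_nonpos (hs : IsStationary g v) (h : 0 < v 0) : tail g 0 ≤ 0 := by
  obtain ⟨m, hm, hm01, -, hmv⟩ := hs.isProfile.exists_monotone
  have := hs.slope_form hm hmv hm hm01 (left_mem_Icc.2 zero_le_one)
  simp only [sub_self, zero_mul, intervalIntegral.integral_zero, add_zero, zero_sub] at this
  nlinarith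

/-- The slope of `v` jumps or increases at, or arbitrarily close to, the point `s`. -/
def IsKink (v : ℝ → ℝ) (s : ℝ) : Prop := ∀ δ > 0, ∃ s₁ ∈ Icc (0 : ℝ) 1, ∃ s₂ ∈ Icc (0 : ℝ) 1,
  ∃ α ∈ Icc (0 : ℝ) 1, ∃ β ∈ Icc (0 : ℝ) 1, |s₁ - s| ≤ δ ∧ |s₂ - s| ≤ δ ∧ α < β ∧
    IsSlope v s₁ α ∧ IsSlope v s₂ β

lemma integral_indicator_Ioi_eq_tail {r : ℝ} (hr : r ∈ Icc (0 : ℝ) 1) :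
    ∫ t in (0 : ℝ)..1, (Ioi r).indicator h t = tail h r := by
  rw [tail, intervalIntegral.integral_of_le zero_le_one, intervalIntegral.integral_of_le hr.2,
    setIntegral_indicator measurableSet_Ioi]
  congr 2
  ext t
  simp only [mem_inter_iff, mem_Ioc, mem_Ioi]
  constructor
  · rintro ⟨⟨_, h1⟩, h2⟩
    exact ⟨h2, h1⟩
  · rintro ⟨h1, h2⟩
    exact ⟨⟨hr.1.trans_lt h1, h2⟩, h1⟩

lemma intervalIntegrable_indicator {s : Set ℝ} (hh : Continuous h) (hs : MeasurableSet s) :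
    IntervalIntegrable (s.indicator h) volume 0 1 := by
  rw [intervalIntegrable_iff]
  exact ((intervalIntegrable_iff.1 (hh.intervalIntegrable 0 1)).indicator hs)

/-- Moving the increase of the slope from a kink elsewhere does not help. -/
lemma IsStationary.tail_tail_le (hs : IsStationary g v) {s : ℝ} (hsI : s ∈ Icc (0 : ℝ) 1)
    (hk : IsKink v s) {r : ℝ} (hr : r ∈ Icc (0 : ℝ) 1) :
    tail (tail g) s ≤ tail (tail g) r := by
  have hP := continuous_tail hs.continuous
  obtain ⟨m, hm, hm01, hslope, hmv⟩ := hs.isProfile.exists_monotone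
  obtain ⟨B, hB⟩ := isCompact_Icc.exists_bound_of_continuousOn (s := Icc (0 : ℝ) 1) hP.continuousOn
  have hB0 : 0 ≤ B := (norm_nonneg _).trans (hB 0 (left_mem_Icc.2 zero_le_one))
  have key : ∀ δ > 0, tail (tail g) s ≤ tail (tail g) r + 2 * B * δ := by
    intro δ hδ
    obtain ⟨s₁, hs₁, s₂, hs₂, α, hα, β, hβ, hd₁, hd₂, hαβ, hsl₁, hsl₂⟩ := hk δ hδ
    rw [abs_le] at hd₁ hd₂
    have hβα : 0 < β - α := sub_pos.2 hαβ
    -- The rise of the slope from `α` to `β` near `s` is flattened by subtracting the clamped slope,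
    -- and put back as a single jump of size `β - α` at `r`.
    set n : ℝ → ℝ := fun t =>
      m t - max α (min (m t) β) + α + (Ioi r).indicator (fun _ => β - α) t with hn
    have hind : ∀ t, (Ioi r).indicator (fun _ => β - α) t ∈ Icc 0 (β - α) := by
      intro t
      by_cases ht : t ∈ Ioi r
      · simp [ht, hβα.le]
      · simp [ht, hβα.le]
    have hnmono : Monotone n := by
      intro a b hab
      have h1 := hm hab
      have h2 : (Ioi r).indicator (fun _ => β - α) a ≤ (Ioi r).indicator (fun _ => β - α) b := by
        by_cases ha : a ∈ Ioi r
        · have hb : b ∈ Ioi r := lt_of_lt_of_le (show r < a from ha) hab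
          simp [ha, hb]
        · rw [indicator_of_notMem ha]
          exact (hind b).1
      have h3 : max α (min (m b) β) - max α (min (m a) β) ≤ m b - m a := by
        rcases le_total (m a) α with h | h <;> rcases le_total (m b) α with h' | h' <;>
        rcases le_total (m a) β with h'' | h'' <;> rcases le_total (m b) β with h''' | h''' <;>
        simp only [max_def, min_def] <;> split_ifs <;> linarith
      simp only [hn]
      linarith
    have hn01 : ∀ t, n t ∈ Icc (0 : ℝ) 1 := by
      intro t
      have h1 := hm01 t
      have h2 := hind t
      rcases le_total (m t) α with h | h
      · have : max α (min (m t) β) = α := max_eq_left ((min_le_left _ _).trans h)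
        simp only [hn, this]
        exact ⟨by linarith [h1.1, h2.1], by linarith [h1.2, h2.2, hβ.2]⟩
      · rcases le_total (m t) β with h' | h'
        · have : max α (min (m t) β) = m t := by rw [min_eq_left h', max_eq_right h]
          simp only [hn, this]
          exact ⟨by linarith [hα.1, h2.1], by linarith [h2.2, hβ.2]⟩
        · have : max α (min (m t) β) = β := by rw [min_eq_right h', max_eq_right hαβ.le]
          simp only [hn, this]
          exact ⟨by linarith [hα.1, h2.1], by linarith [h2.2, h1.2]⟩
    have hc : v 0 ∈ Icc (0 : ℝ) 1 := ⟨hs.isProfile.initial_nonneg, hs.isProfile.initial_le_one⟩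
    have h0 := hs.slope_form hm hmv hnmono hn01 hc
    rw [sub_self, zero_mul, zero_add] at h0
    have hint : IntervalIntegrable (fun t => (n t - m t) * tail g t) volume 0 1 :=
      IntervalIntegrable.mul_continuousOn
        ((hnmono.intervalIntegrable).sub (hm.intervalIntegrable)) hP.continuousOn
    have hi1 := intervalIntegrable_indicator hP (measurableSet_Ioi (a := r))
    have hi2 := intervalIntegrable_indicator hP (measurableSet_Ioi (a := s))
    have hi3 := intervalIntegrable_indicator (continuous_const (y := B))
      (measurableSet_Icc (a := s - δ) (b := s + δ))
    have hle : ∫ t in (0 : ℝ)..1, (n t - m t) * tail g t ≤ ∫ t in (0 : ℝ)..1,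
        (β - α) * ((Ioi r).indicator (tail g) t - (Ioi s).indicator (tail g) t
          + (Icc (s - δ) (s + δ)).indicator (fun _ => B) t) := by
      refine intervalIntegral.integral_mono_on zero_le_one hint
        (((hi1.sub hi2).add hi3).const_mul _) fun t ht => ?_
      have hPt := abs_le.1 (hB t ht)
      have hr' : (Ioi r).indicator (fun _ => β - α) t * tail g t
          = (β - α) * (Ioi r).indicator (tail g) t := by
        by_cases h : t ∈ Ioi r
        · simp [h]
        · simp [h]
      -- Off `[s - δ, s + δ]` the clamped slope minus `α` is exactly a jump of size `β - α` at `s`.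
      -- Inside, the discrepancy is at most `β - α` and `|tail g| ≤ B`, which costs at most `2 B δ
      -- (β - α)` in total.
      have hs' : (β - α) * (Ioi s).indicator (tail g) t
          - (max α (min (m t) β) - α) * tail g t
          ≤ (β - α) * (Icc (s - δ) (s + δ)).indicator (fun _ => B) t := by
        by_cases h : t ∈ Icc (s - δ) (s + δ)
        · rw [indicator_of_mem h]
          have hx0 : 0 ≤ max α (min (m t) β) - α := sub_nonneg.2 (le_max_left _ _)
          have hx1 : max α (min (m t) β) ≤ β := max_le hαβ.le (min_le_right _ _)
          by_cases h' : t ∈ Ioi s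
          · rw [indicator_of_mem h']
            nlinarith
          · rw [indicator_of_notMem h']
            nlinarith
        · rw [indicator_of_notMem h, mul_zero]
          rcases lt_or_ge t (s - δ) with h' | h'
          · have h1 : m t ≤ α := (hslope t ht).le_of_lt ht hs₁ hsl₁ (by linarith)
            have h2 : max α (min (m t) β) = α := max_eq_left ((min_le_left _ _).trans h1)
            rw [h2, indicator_of_notMem (notMem_Ioi.2 (by linarith))]
            simp
          · have h3 : s + δ < t := by
              by_contra! hh
              exact h ⟨h', hh⟩
            have h1 : β ≤ m t := hsl₂.le_of_lt hs₂ ht (hslope t ht) (by linarith)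
            have h2 : max α (min (m t) β) = β := by rw [min_eq_right h1, max_eq_right hαβ.le]
            rw [h2, indicator_of_mem (mem_Ioi.2 (by linarith))]
            simp
      simp only [hn]
      nlinarith
    have hB3 : ∫ t in (0 : ℝ)..1, (Icc (s - δ) (s + δ)).indicator (fun _ => B) t ≤ 2 * B * δ := by
      rw [intervalIntegral.integral_of_le zero_le_one, setIntegral_indicator measurableSet_Icc,
        setIntegral_const, smul_eq_mul]
      have h1 : volume.real (Ioc (0 : ℝ) 1 ∩ Icc (s - δ) (s + δ)) ≤ 2 * δ := by
        calc volume.real (Ioc (0 : ℝ) 1 ∩ Icc (s - δ) (s + δ))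
            ≤ volume.real (Icc (s - δ) (s + δ)) :=
              measureReal_mono inter_subset_right (by simp)
          _ = 2 * δ := by
              rw [Real.volume_real_Icc_of_le (by linarith)]
              ring
      nlinarith
    rw [intervalIntegral.integral_const_mul, intervalIntegral.integral_add (hi1.sub hi2) hi3,
      intervalIntegral.integral_sub hi1 hi2, integral_indicator_Ioi_eq_tail hr,
      integral_indicator_Ioi_eq_tail hsI] at hle
    have h5 := nonneg_of_mul_nonneg_right (h0.trans hle) hβα
    linarith
  refine le_of_forall_pos_le_add fun ε hε => ?_
  -- The `+ 1` avoids dividing by zero when `B = 0`.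
  refine (key (ε / (2 * B + 1)) (by positivity)).trans ?_
  have : 2 * B * (ε / (2 * B + 1)) ≤ ε := by
    rw [← mul_div_assoc, div_le_iff₀ (by positivity)]
    nlinarith
  linarith

/-- At a kink the first- and second-order conditions hold. -/
theorem IsStationary.of_isKink (hs : IsStationary g v) (h0 : 0 ≤ tail g 0) {s : ℝ}
    (hsI : s ∈ Icc (0 : ℝ) 1) (hk : IsKink v s) : tail g s = 0 ∧ 0 ≤ g s := by
  have hmin := fun r hr => hs.tail_tail_le hsI hk (r := r) hr
  have hminR : ∀ r ∈ Icc s 1, tail (tail g) s ≤ tail (tail g) r :=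
    fun r hr => hmin r ⟨hsI.1.trans hr.1, hr.2⟩
  have hminL : ∀ r ∈ Icc 0 s, tail (tail g) s ≤ tail (tail g) r :=
    fun r hr => hmin r ⟨hr.1, hr.2.trans hsI.2⟩
  have hg := hs.continuous
  rcases hsI.1.eq_or_lt with hs0 | hs0
  · subst hs0
    have h1 := le_antisymm (tail_nonpos_of_isMin hg one_pos hminR) h0
    exact ⟨h1, nonneg_of_isMin_right hg one_pos h1 hminR⟩
  · have h2 := tail_nonneg_of_isMin hg hs0 hminL
    have h1 : tail g s = 0 := by
      rcases hsI.2.eq_or_lt with hs1 | hs1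
      · rw [hs1, tail_one]
      · exact le_antisymm (tail_nonpos_of_isMin hg hs1 hminR) h2
    exact ⟨h1, nonneg_of_isMin_left hg hs0 h1 hminL⟩


end TwoGoods

namespace TwoGoods

/-! ### The types on the top edge that buy a given bundle -/

variable {f p : ℝ × ℝ → ℝ} {w v : ℝ → ℝ}

lemma IsFeasible.convexOn_ubar (hp : IsFeasible p) : ConvexOn ℝ univ (ubar p) := by
  refine ⟨convex_univ, fun x _ y _ a b ha hb hab => ?_⟩
  have h := hp.convexOn.2 (mem_univ (x, (1 : ℝ))) (mem_univ (y, (1 : ℝ))) ha hb hab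
  have h2 : a • ((x, 1) : ℝ × ℝ) + b • ((y, 1) : ℝ × ℝ) = (a • x + b • y, 1) := by
    simp [hab]
  rw [h2] at h
  exact h

/-- One-sided derivatives of a convex function bound its chord slopes. The conventions at 0 and 1
impose nothing there, since `q` lies in `[0,1]`. -/
lemma IsFeasible.mem_buyers_iff (hp : IsFeasible p) {q : ℝ} (hq : q ∈ Icc (0 : ℝ) 1) {t : ℝ} :
    t ∈ buyers p q ↔ t ∈ Icc (0 : ℝ) 1 ∧ IsSlope (ubar p) t q := by
  have hc := hp.convexOn_ubar
  have hint : ∀ x : ℝ, x ∈ interior (univ : Set ℝ) := fun x => by simp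
  constructor
  · rintro ⟨ht, hl, hr⟩
    refine ⟨ht, fun s hs => ?_⟩
    rcases lt_trichotomy s t with h | h | h
    · rw [ubarLeft, if_neg (not_le.2 (hs.1.trans_lt h))] at hl
      have h1 := (hc.slope_le_leftDeriv_of_mem_interior (mem_univ s) (hint t) h).trans hl
      rw [slope_def_field, div_le_iff₀ (sub_pos.2 h)] at h1
      linarith
    · simp [h]
    · rw [ubarRight, if_neg (not_le.2 (h.trans_le hs.2))] at hr
      have h1 := hr.trans (hc.rightDeriv_le_slope_of_mem_interior (hint t) (mem_univ s) h)
      rw [slope_def_field, le_div_iff₀ (sub_pos.2 h)] at h1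
      linarith
  · rintro ⟨ht, hsl⟩
    refine ⟨ht, ?_, ?_⟩
    · rw [ubarLeft]
      split_ifs with h0
      · exact hq.1
      · push Not at h0
        have h1 := hc.hasDerivWithinAt_leftDeriv_of_mem_interior (hint t)
        rw [hasDerivWithinAt_iff_tendsto_slope' self_notMem_Iio] at h1
        refine le_of_tendsto h1 ?_
        filter_upwards [self_mem_nhdsWithin, mem_nhdsWithin_of_mem_nhds (lt_mem_nhds h0)]
          with s hs hs0
        rw [slope_comm, slope_def_field, div_le_iff₀ (sub_pos.2 hs)]
        linarith [hsl s ⟨hs0.le, (le_of_lt hs).trans ht.2⟩]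
    · rw [ubarRight]
      split_ifs with h1
      · exact hq.2
      · push Not at h1
        have h2 := hc.hasDerivWithinAt_rightDeriv_of_mem_interior (hint t)
        rw [hasDerivWithinAt_iff_tendsto_slope' self_notMem_Ioi] at h2
        refine ge_of_tendsto h2 ?_
        filter_upwards [self_mem_nhdsWithin, mem_nhdsWithin_of_mem_nhds (gt_mem_nhds h1)]
          with s hs hs1
        rw [slope_def_field, le_div_iff₀ (sub_pos.2 hs)]
        linarith [hsl s ⟨ht.1.trans (le_of_lt hs), hs1.le⟩]

lemma IsFeasible.buyers_eq_Icc (hp : IsFeasible p) {q : ℝ} (hq : q ∈ Icc (0 : ℝ) 1) :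
    lowerEnd p q ≤ upperEnd p q ∧ buyers p q = Icc (lowerEnd p q) (upperEnd p q) := by
  have hv := hp.continuous_ubar
  have hset : buyers p q = Icc 0 1 ∩ {t | IsSlope (ubar p) t q} :=
    Set.ext fun t => hp.mem_buyers_iff hq
  have hclosed : IsClosed {t | IsSlope (ubar p) t q} := by
    have : {t | IsSlope (ubar p) t q}
        = ⋂ s ∈ Icc (0 : ℝ) 1, {t | ubar p t + (s - t) * q ≤ ubar p s} := by
      ext t
      simp [IsSlope]
    rw [this]
    exact isClosed_biInter fun s _ => isClosed_le (by fun_prop) continuous_const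
  have hcomp : IsCompact (buyers p q) := by
    rw [hset]
    exact isCompact_Icc.inter_right hclosed
  have hne : (buyers p q).Nonempty := by
    -- A buyer of `q` is a maximizer of `q t - ū(t)`.
    obtain ⟨t, ht, hmax⟩ := isCompact_Icc.exists_isMaxOn (nonempty_Icc.2 zero_le_one)
      ((by fun_prop : Continuous fun t => q * t - ubar p t).continuousOn (s := Icc 0 1))
    refine ⟨t, (hp.mem_buyers_iff hq).2 ⟨ht, fun s hs => ?_⟩⟩
    have : q * s - ubar p s ≤ q * t - ubar p t := hmax hs
    linarith
  have hinf := hcomp.sInf_mem hne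
  have hsup := hcomp.sSup_mem hne
  refine ⟨csInf_le hcomp.bddBelow hsup, Subset.antisymm
    (fun t ht => ⟨csInf_le hcomp.bddBelow ht, le_csSup hcomp.bddAbove ht⟩) fun t ht => ?_⟩
  obtain ⟨ha, ha'⟩ : lowerEnd p q ∈ Icc (0 : ℝ) 1 ∧ IsSlope (ubar p) (lowerEnd p q) q :=
    (hp.mem_buyers_iff hq).1 hinf
  obtain ⟨hb, hb'⟩ : upperEnd p q ∈ Icc (0 : ℝ) 1 ∧ IsSlope (ubar p) (upperEnd p q) q :=
    (hp.mem_buyers_iff hq).1 hsup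
  have ht01 : t ∈ Icc (0 : ℝ) 1 := ⟨ha.1.trans ht.1, ht.2.trans hb.2⟩
  refine (hp.mem_buyers_iff hq).2 ⟨ht01, fun s hs => ?_⟩
  rcases ht.1.eq_or_lt with h | h
  · rw [← h]
    exact ha' s hs
  · have hconv := hp.convexOn_ubar.2 (mem_univ (lowerEnd p q)) (mem_univ (upperEnd p q))
    have h1 := ha' _ hb
    have h2 := hb' _ ha
    have hlt : 0 < upperEnd p q - lowerEnd p q := sub_pos.2 (h.trans_le ht.2)
    set a := lowerEnd p q
    set b := upperEnd p q
    have h3 := hconv (a := (b - t) / (b - a)) (b := (t - a) / (b - a))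
      (div_nonneg (sub_nonneg.2 ht.2) hlt.le) (div_nonneg (sub_nonneg.2 ht.1) hlt.le)
      (by field_simp; ring)
    have h4 : ((b - t) / (b - a)) • a + ((t - a) / (b - a)) • b = t := by
      simp only [smul_eq_mul]
      field_simp
      ring
    rw [h4] at h3
    have hvb : ubar p b = ubar p a + (b - a) * q :=
      le_antisymm (by linarith) (ha' b hb)
    have h5 : ((b - t) / (b - a)) • ubar p a + ((t - a) / (b - a)) • ubar p b
        = ubar p a + (t - a) * q := by
      rw [hvb]
      simp only [smul_eq_mul]
      field_simp
      ring
    rw [h5] at h3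
    linarith [ha' s hs]

lemma IsFeasible.lowerEnd_mem (hp : IsFeasible p) {q : ℝ} (hq : q ∈ Icc (0 : ℝ) 1) :
    lowerEnd p q ∈ Icc (0 : ℝ) 1 ∧ IsSlope (ubar p) (lowerEnd p q) q := by
  have h := hp.buyers_eq_Icc hq
  exact (hp.mem_buyers_iff hq).1 (h.2 ▸ left_mem_Icc.2 h.1)

lemma IsFeasible.upperEnd_mem (hp : IsFeasible p) {q : ℝ} (hq : q ∈ Icc (0 : ℝ) 1) :
    upperEnd p q ∈ Icc (0 : ℝ) 1 ∧ IsSlope (ubar p) (upperEnd p q) q := by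
  have h := hp.buyers_eq_Icc hq
  exact (hp.mem_buyers_iff hq).1 (h.2 ▸ right_mem_Icc.2 h.1)

lemma IsFeasible.isSlope_iff (hp : IsFeasible p) {q : ℝ} (hq : q ∈ Icc (0 : ℝ) 1) {t : ℝ}
    (ht : t ∈ Icc (0 : ℝ) 1) :
    IsSlope (ubar p) t q ↔ t ∈ Icc (lowerEnd p q) (upperEnd p q) := by
  rw [← (hp.buyers_eq_Icc hq).2, hp.mem_buyers_iff hq]
  exact ⟨fun h => ⟨ht, h⟩, fun h => h.2⟩

lemma IsProfile.isSlope_zero_zero (hv : IsProfile v) : IsSlope v 0 0 := fun s hs => by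
  simpa using hv.le_of_le (left_mem_Icc.2 zero_le_one) hs hs.1

lemma IsProfile.isSlope_one_one (hv : IsProfile v) : IsSlope v 1 1 := fun s hs => by
  linarith [hv.sub_le hs (right_mem_Icc.2 zero_le_one) hs.2]

/-- The left end point of the interval of buyers is a kink. -/
lemma IsFeasible.isKink_lowerEnd (hp : IsFeasible p) (hv : IsProfile (ubar p)) {q : ℝ}
    (hq : q ∈ Icc (0 : ℝ) 1) (hq0 : q ≠ 0) : IsKink (ubar p) (lowerEnd p q) := by
  obtain ⟨ha, ha'⟩ := hp.lowerEnd_mem hq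
  intro δ hδ
  rcases ha.1.eq_or_lt with h | h
  · refine ⟨0, left_mem_Icc.2 zero_le_one, _, ha, 0, left_mem_Icc.2 zero_le_one, q, hq, ?_, ?_,
      lt_of_le_of_ne hq.1 hq0.symm, hv.isSlope_zero_zero, ha'⟩
    · simpa [← h] using hδ.le
    · simpa using hδ.le
  · have hlt : max (lowerEnd p q - δ) 0 < lowerEnd p q := max_lt (by linarith) h
    have hs : max (lowerEnd p q - δ) 0 ∈ Icc (0 : ℝ) 1 :=
      ⟨le_max_right _ _, hlt.le.trans ha.2⟩
    obtain ⟨α, hα, hα'⟩ := hv.exists_slope _ hs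
    refine ⟨_, hs, _, ha, α, hα, q, hq, ?_, ?_, ?_, hα', ha'⟩
    · rw [abs_le]
      exact ⟨by linarith [le_max_left (lowerEnd p q - δ) 0], by linarith⟩
    · simpa using hδ.le
    · refine lt_of_le_of_ne (hα'.le_of_lt hs ha ha' hlt) fun heq => ?_
      rw [heq, hp.isSlope_iff hq hs] at hα'
      exact hlt.not_ge hα'.1

/-- The right end point of the interval of buyers is a kink. -/
lemma IsFeasible.isKink_upperEnd (hp : IsFeasible p) (hv : IsProfile (ubar p)) {q : ℝ}
    (hq : q ∈ Icc (0 : ℝ) 1) (hq1 : q ≠ 1) : IsKink (ubar p) (upperEnd p q) := by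
  obtain ⟨hb, hb'⟩ := hp.upperEnd_mem hq
  intro δ hδ
  rcases hb.2.eq_or_lt with h | h
  · refine ⟨_, hb, 1, right_mem_Icc.2 zero_le_one, q, hq, 1, right_mem_Icc.2 zero_le_one, ?_, ?_,
      lt_of_le_of_ne hq.2 hq1, hb', hv.isSlope_one_one⟩
    · simpa using hδ.le
    · simpa [h] using hδ.le
  · have hlt : upperEnd p q < min (upperEnd p q + δ) 1 := lt_min (by linarith) h
    have hs : min (upperEnd p q + δ) 1 ∈ Icc (0 : ℝ) 1 :=
      ⟨hb.1.trans hlt.le, min_le_right _ _⟩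
    obtain ⟨α, hα, hα'⟩ := hv.exists_slope _ hs
    refine ⟨_, hb, _, hs, q, hq, α, hα, ?_, ?_, ?_, hb', hα'⟩
    · simpa using hδ.le
    · rw [abs_le]
      exact ⟨by linarith, by linarith [min_le_left (upperEnd p q + δ) 1]⟩
    · refine lt_of_le_of_ne (hb'.le_of_lt hb hs hα' hlt) fun heq => ?_
      rw [← heq, hp.isSlope_iff hq hs] at hα'
      exact hlt.not_ge hα'.2

/-! ### Stationarity of the optimal profile -/

/-- `Φ`, extended from the unit interval to a continuous function on the line. -/
noncomputable def phiExt (f p : ℝ × ℝ → ℝ) (t : ℝ) : ℝ :=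
  Phi f p (projIcc 0 1 zero_le_one t : Icc (0 : ℝ) 1)

lemma phiExt_eq {t : ℝ} (ht : t ∈ Icc (0 : ℝ) 1) : phiExt f p t = Phi f p t := by
  rw [phiExt, projIcc_of_mem _ ht]

lemma IsOptimal.isStationary (hp : IsOptimal f p) (hf : IsSRS f) (hsymm : IsSymmetric p) :
    IsStationary (phiExt f p) (ubar p) := by
  refine ⟨?_, hp.isProfile hf hsymm, fun w hw => ?_⟩
  · exact (hp.continuousOn_Phi hf hsymm).comp_continuous
      (continuous_subtype_val.comp continuous_projIcc) fun t => Subtype.property _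
  · have h := hp.integral_Phi_mul_nonneg hf hsymm hw
    rw [intervalIntegral.integral_of_le zero_le_one, integral_Ioc_eq_integral_Ioo]
    refine h.trans_eq (setIntegral_congr_fun measurableSet_Ioo fun t ht => ?_)
    simp only [phiExt_eq (Ioo_subset_Icc_self ht)]

lemma integral_Phi_eq {a b : ℝ} (ha : a ∈ Icc (0 : ℝ) 1) (hb : b ∈ Icc (0 : ℝ) 1) :
    ∫ t in a..b, Phi f p t = ∫ t in a..b, phiExt f p t :=
  intervalIntegral.integral_congr fun _ ht => (phiExt_eq (uIcc_subset_Icc ha hb ht)).symm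

/-! ### Boundary values of the profile and the sign of the tail integrals. -/

lemma slicePhi_eq_of_le {a t : ℝ} (h : 1 - a ≤ t) (ht : 0 ≤ t) :
    slicePhi f a t = slicePhi f 1 t := by
  rw [slicePhi, slicePhi, max_eq_right h, max_eq_right (by simpa using ht)]

/-- Selling an additional upgrade to all types in the part of the triangle given by `h`. -/
lemma IsTypeDensity.integral_mul_slicePhi_one (hf : IsTypeDensity f) {h : ℝ → ℝ} {K : NNReal}
    (hh : LipschitzWith K h) :
    ∫ t in Ioo 0 1, h t * slicePhi f 1 t
      = -∫ x in triangle, (fderiv ℝ (fun x : ℝ × ℝ => h x.1) x x - h x.1) * f x := by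
  have hL : LipschitzWith (K * 1) fun x : ℝ × ℝ => h x.1 := hh.comp LipschitzWith.prod_fst
  have hi := (hf.integrableOn_mul_phiInt hL.continuous.continuousOn).mono_set
    triangle_subset_openSquare
  have hi2 : IntegrableOn (fun t => h t * f (t, 1)) (Ioo 0 1) :=
    ((hh.continuous.continuousOn.mul hf.continuousOn_top).integrableOn_compact
      isCompact_Icc).mono_set Ioo_subset_Icc_self
  rw [hf.setIntegral_triangle_revenue hL, setIntegral_triangle_slices hi, neg_sub,
    integral_Icc_eq_integral_Ioo, ← integral_sub (integrableOn_triangle_slices hi) hi2]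
  refine setIntegral_congr_fun measurableSet_Ioo fun t ht => ?_
  simp only
  rw [integral_const_mul, ← mul_sub, slicePhi, sub_self, max_eq_right ht.1.le,
    intervalIntegral.integral_of_le ht.2.le, integral_Ioc_eq_integral_Ioo]
  congr 2
  refine setIntegral_congr_fun measurableSet_Ioo fun y hy => ?_
  exact hf.phi_eq ⟨ht, ht.1.trans hy.1, hy.2⟩

/-- If `ū(0) = 1`, every type above the diagonal gets the second good, so the total integral of `Φ`
is the mass `1/2` of the triangle. Stationarity would make it nonpositive, since lowering the
profile is then possible. -/
lemma IsOptimal.ubar_zero_lt_one (hp : IsOptimal f p) (hf : IsSRS f) (hsymm : IsSymmetric p) :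
    ubar p 0 < 1 := by
  have hv := hp.isProfile hf hsymm
  have hs := hp.isStationary hf hsymm
  refine hv.initial_le_one.lt_of_ne fun h1 => ?_
  have hle := hs.tail_zero_nonpos (h1 ▸ one_pos)
  have h2 := hf.integral_mul_slicePhi_one (LipschitzWith.const (1 : ℝ))
  simp only [fderiv_fun_const, Pi.zero_apply, zero_apply, zero_sub, neg_mul,
    one_mul, integral_neg, hf.setIntegral_triangle_density, neg_neg] at h2
  have h3 : tail (phiExt f p) 0 = ∫ t in Ioo 0 1, slicePhi f 1 t := by
    rw [tail, intervalIntegral.integral_of_le zero_le_one, integral_Ioc_eq_integral_Ioo]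
    refine setIntegral_congr_fun measurableSet_Ioo fun t ht => ?_
    rw [phiExt_eq (Ioo_subset_Icc_self ht), Phi_eq, slicePhi_eq_of_le _ ht.1.le]
    linarith [hv.le_of_le (left_mem_Icc.2 zero_le_one) (Ioo_subset_Icc_self ht) ht.1.le, ht.1]
  linarith

lemma IsOptimal.tail_zero_nonneg (hp : IsOptimal f p) (hf : IsSRS f) (hsymm : IsSymmetric p) :
    0 ≤ tail (phiExt f p) 0 :=
  (hp.isStationary hf hsymm).tail_zero_nonneg (hp.ubar_zero_lt_one hf hsymm)

lemma IsOptimal.of_isKink (hp : IsOptimal f p) (hf : IsSRS f) (hsymm : IsSymmetric p) {s : ℝ}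
    (hs : s ∈ Icc (0 : ℝ) 1) (hk : IsKink (ubar p) s) :
    tail (phiExt f p) s = 0 ∧ 0 ≤ Phi f p s := by
  have := (hp.isStationary hf hsymm).of_isKink (hp.tail_zero_nonneg hf hsymm) hs hk
  rwa [phiExt_eq hs] at this

lemma IsTypeDensity.integral_top_pos (hf : IsTypeDensity f) {b : ℝ} (hb : b ∈ Icc (0 : ℝ) 1)
    (hb0 : 0 < b) : 0 < ∫ t in (0 : ℝ)..b, f (t, 1) := by
  have hint : IntegrableOn (fun t => f (t, 1)) (Ioc 0 b) :=
    (hf.continuousOn_top.integrableOn_compact isCompact_Icc).mono_set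
      (Ioc_subset_Icc_self.trans (Icc_subset_Icc_right hb.2))
  have hae : ∀ᵐ t ∂(volume.restrict (Ioc (0 : ℝ) b)), 0 < f (t, 1) := by
    filter_upwards [ae_restrict_of_ae_restrict_of_subset
      (Ioc_subset_Icc_self.trans (Icc_subset_Icc_right hb.2)) hf.pos_top] with t ht using ht.1
  rw [intervalIntegral.integral_of_le hb0.le, integral_pos_iff_support_of_nonneg_ae
    (by filter_upwards [hae] with t ht using ht.le) hint]
  have hsupp : (Function.support fun t => f (t, 1)) =ᵐ[volume.restrict (Ioc (0 : ℝ) b)] univ := by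
    filter_upwards [hae] with t ht
    exact propext ⟨fun _ => trivial, fun _ => ht.ne'⟩
  rw [measure_congr hsupp, Measure.restrict_apply_univ, Real.volume_Ioc, sub_zero]
  exact ENNReal.ofReal_pos.2 hb0

/-- All types on the top edge obtain a positive utility, except possibly the lowest. -/
lemma IsOptimal.ubar_pos (hp : IsOptimal f p) (hf : IsSRS f) (hsymm : IsSymmetric p) {t : ℝ}
    (ht : t ∈ Icc (0 : ℝ) 1) (ht0 : 0 < t) : 0 < ubar p t := by
  have hv := hp.isProfile hf hsymm
  have hF := hp.feasible
  refine (hv.nonneg ht).lt_of_ne' fun hzero => ?_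
  have h0 : (0 : ℝ) ∈ Icc (0 : ℝ) 1 := left_mem_Icc.2 zero_le_one
  obtain ⟨hb, hb'⟩ := hF.upperEnd_mem h0
  have htb : t ≤ upperEnd p 0 :=
    ((hF.isSlope_iff h0 ht).1 fun s hs => by simpa [hzero] using hv.nonneg hs).2
  set b := upperEnd p 0
  have hvz : ∀ s ∈ Icc 0 b, ubar p s = 0 := by
    intro s hs
    have hs1 : s ∈ Icc (0 : ℝ) 1 := ⟨hs.1, hs.2.trans hb.2⟩
    have h1 := hb' 0 h0
    have h2 := hv.le_of_le hs1 hb hs.2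
    have h3 := hv.le_of_le h0 ht ht.1
    have h4 := hv.nonneg hs1
    linarith
  -- On `[0, b]` the profile is zero, so `Φ(t) = -f(t, 1)`. As `tail` vanishes at the kink `b`, it
  -- would be negative at 0.
  have hk := (hp.of_isKink hf hsymm hb (hF.isKink_upperEnd hv h0 zero_ne_one)).1
  have hP0 := hp.tail_zero_nonneg hf hsymm
  have hdiff := tail_sub_tail (hp.isStationary hf hsymm).continuous 0 b
  have hb0 : 0 < b := ht0.trans_le htb
  have hint : ∫ t in (0 : ℝ)..b, phiExt f p t = ∫ t in (0 : ℝ)..b, -f (t, 1) := by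
    refine intervalIntegral.integral_congr fun s hs => ?_
    rw [uIcc_of_le hb0.le] at hs
    have hs1 : s ∈ Icc (0 : ℝ) 1 := ⟨hs.1, hs.2.trans hb.2⟩
    rw [phiExt_eq hs1, Phi_eq, hvz s hs, slicePhi, sub_zero, max_eq_left hs1.2,
      intervalIntegral.integral_same, zero_sub]
  rw [hint, intervalIntegral.integral_neg, hk] at hdiff
  linarith [hf.integral_top_pos hb hb0]

lemma tail_tail_eq {g : ℝ → ℝ} (hg : Continuous g) (s : ℝ) :
    tail (tail g) s = ∫ t in s..1, (t - s) * g t := by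
  have hP := continuous_tail hg
  have hd : ∀ t : ℝ, HasDerivAt (fun t => (t - s) * tail g t) (tail g t - (t - s) * g t) t := by
    intro t
    refine (((hasDerivAt_id t).sub_const s).fun_mul (hasDerivAt_tail hg t)).congr_deriv ?_
    simp only [id]
    ring
  have hc : Continuous fun t => (t - s) * g t := by fun_prop
  have h := intervalIntegral.integral_eq_sub_of_hasDerivAt (a := s) (b := 1) (fun t _ => hd t)
    ((hP.sub hc).intervalIntegrable _ _)
  rw [intervalIntegral.integral_sub (hP.intervalIntegrable _ _) (hc.intervalIntegrable _ _),
    tail_one] at h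
  rw [tail]
  linarith

/-- An upgrade in the first good at price `s` yields revenue `s` from each type with `x₁ > s` and
nothing from the others. -/
lemma fderiv_max_sub {s : ℝ} {x : ℝ × ℝ} (hx : x.1 ≠ s) :
    fderiv ℝ (fun x : ℝ × ℝ => max 0 (x.1 - s)) x x - max 0 (x.1 - s)
      = {x : ℝ × ℝ | s < x.1}.indicator (fun _ => s) x := by
  rcases lt_or_gt_of_ne hx with h | h
  · have hev : (fun x : ℝ × ℝ => max 0 (x.1 - s)) =ᶠ[𝓝 x] fun _ => 0 := by
      filter_upwards [(isOpen_lt continuous_fst continuous_const).mem_nhds h] with y hy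
      exact max_eq_left (sub_nonpos.2 (le_of_lt hy))
    rw [hev.fderiv_eq, indicator_of_notMem (show x ∉ {x : ℝ × ℝ | s < x.1} from h.not_gt),
      max_eq_left (sub_nonpos.2 h.le)]
    simp
  · have hev : (fun x : ℝ × ℝ => max 0 (x.1 - s)) =ᶠ[𝓝 x] fun x => x.1 - s := by
      filter_upwards [(isOpen_lt continuous_const continuous_fst).mem_nhds h] with y hy
      exact max_eq_right (sub_nonneg.2 (le_of_lt hy))
    have hd : HasFDerivAt (fun x : ℝ × ℝ => x.1 - s) (ContinuousLinearMap.fst ℝ ℝ ℝ) x :=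
      hasFDerivAt_fst.sub_const s
    rw [hev.fderiv_eq, hd.fderiv, indicator_of_mem (show x ∈ {x : ℝ × ℝ | s < x.1} from h),
      max_eq_right (sub_nonneg.2 h.le)]
    simp

lemma volume_vertical (s : ℝ) : volume {x : ℝ × ℝ | x.1 = s} = 0 := by
  have h : {x : ℝ × ℝ | x.1 = s} = {s} ×ˢ univ := by
    ext x
    simp
  rw [h, Measure.volume_eq_prod, Measure.prod_prod, Real.volume_singleton, zero_mul]

/-- The value of a marginal upgrade sold to the top types is negative, as it is minus the price
times the mass of these types. -/
lemma IsOptimal.tail_tail_neg (hp : IsOptimal f p) (hf : IsSRS f) (hsymm : IsSymmetric p) {s : ℝ}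
    (hs : s ∈ Ioo (0 : ℝ) 1) (hsv : ∀ t ∈ Icc s 1, 1 - ubar p t ≤ t) :
    tail (tail (phiExt f p)) s < 0 := by
  rw [tail_tail_eq (hp.isStationary hf hsymm).continuous]
  have hL : LipschitzWith 1 fun t : ℝ => max 0 (t - s) := by
    refine LipschitzWith.of_le_add_mul 1 fun x y => ?_
    rw [NNReal.coe_one, one_mul, Real.dist_eq]
    refine max_le ?_ ?_
    · linarith [le_max_left 0 (y - s), abs_nonneg (x - y)]
    · linarith [le_max_right 0 (y - s), le_abs_self (x - y)]
  have h1 := hf.integral_mul_slicePhi_one hL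
  have h2 : ∫ t in s..1, (t - s) * phiExt f p t
      = ∫ t in Ioo 0 1, max 0 (t - s) * slicePhi f 1 t := by
    have h3 : ∀ t ∈ Ioo (0 : ℝ) 1, max 0 (t - s) * slicePhi f 1 t
        = (Ioi s).indicator (fun t => (t - s) * slicePhi f 1 t) t := by
      intro t _
      by_cases h : t ∈ Ioi s
      · rw [indicator_of_mem h, max_eq_right (sub_nonneg.2 (le_of_lt h))]
      · rw [indicator_of_notMem h, max_eq_left (sub_nonpos.2 (notMem_Ioi.1 h)), zero_mul]
    rw [setIntegral_congr_fun measurableSet_Ioo h3, ← intervalIntegral_slice_eq hs.1.le hs.2.le]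
    refine intervalIntegral.integral_congr fun t ht => ?_
    rw [uIcc_of_le hs.2.le] at ht
    have ht' : t ∈ Icc (0 : ℝ) 1 := ⟨hs.1.le.trans ht.1, ht.2⟩
    rw [phiExt_eq ht', Phi_eq, slicePhi_eq_of_le (hsv t ht) ht'.1]
  have hU : MeasurableSet {x : ℝ × ℝ | s < x.1} := measurableSet_lt measurable_const measurable_fst
  have h4 : ∫ x in triangle,
      (fderiv ℝ (fun x : ℝ × ℝ => max 0 (x.1 - s)) x x - max 0 (x.1 - s)) * f x
      = s * ∫ x in triangle ∩ {x | s < x.1}, f x := by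
    rw [← integral_const_mul, ← setIntegral_indicator hU]
    refine integral_congr_ae ?_
    have hne : ∀ᵐ x : ℝ × ℝ, x.1 ≠ s := by
      rw [ae_iff]
      simpa using volume_vertical s
    filter_upwards [ae_restrict_of_ae hne] with x hx
    rw [fderiv_max_sub hx]
    by_cases h : x ∈ {x : ℝ × ℝ | s < x.1}
    · rw [indicator_of_mem h, indicator_of_mem h]
    · rw [indicator_of_notMem h, indicator_of_notMem h, zero_mul]
  have hsub : triangle ∩ {x | s < x.1} ⊆ openSquare :=
    inter_subset_left.trans triangle_subset_openSquare
  have hopen : IsOpen (triangle ∩ {x : ℝ × ℝ | s < x.1}) :=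
    isOpen_triangle.inter (isOpen_lt continuous_const continuous_fst)
  have hpos : 0 < ∫ x in triangle ∩ {x | s < x.1}, f x := by
    have hae := ae_restrict_of_ae_restrict_of_subset hsub hf.pos_ae
    rw [integral_pos_iff_support_of_nonneg_ae (by filter_upwards [hae] with t ht using ht.le)
      (hf.integrableOn.mono_set (hsub.trans openSquare_subset_square))]
    have hsupp : Function.support f =ᵐ[volume.restrict (triangle ∩ {x | s < x.1})] univ := by
      filter_upwards [hae] with t ht
      exact propext ⟨fun _ => trivial, fun _ => ht.ne'⟩
    rw [measure_congr hsupp, Measure.restrict_apply_univ]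
    refine hopen.measure_pos volume ⟨(s + (1 - s) / 3, s + 2 * (1 - s) / 3), ?_⟩
    have := hs.1
    have := hs.2
    exact ⟨⟨by simp only; linarith, by simp only; linarith, by simp only; linarith⟩,
      show s < s + (1 - s) / 3 by linarith⟩
  rw [h2, h1, h4]
  linarith [mul_pos hs.1 hpos]


end TwoGoods

namespace TwoGoods

/-! ### Demand sets -/

variable {f p : ℝ × ℝ → ℝ} {w v : ℝ → ℝ}

lemma top_mem_square {t : ℝ} (ht : t ∈ Icc (0 : ℝ) 1) : ((t, 1) : ℝ × ℝ) ∈ square :=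
  ⟨ht, right_mem_Icc.2 zero_le_one⟩

lemma IsFeasible.isClosed_demand (hp : IsFeasible p) (q : ℝ × ℝ) : IsClosed (demand p q) := by
  by_cases hq : q ∈ square
  · have h : demand p q
        = square ∩ ⋂ y ∈ square, {x | dot y q - utility p y ≤ dot x q - utility p x} := by
      ext x
      simp [demand, subdiff, hq]
    have hc := hp.lipschitzWith.continuous
    have hdot : Continuous fun x : ℝ × ℝ => dot x q := by
      unfold dot
      fun_prop
    rw [h]
    exact isCompact_square.isClosed.inter
      (isClosed_biInter fun y _ => isClosed_le continuous_const (hdot.sub hc))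
  · have h : demand p q = ∅ := by
      ext x
      simp [demand, subdiff, hq]
    rw [h]
    exact isClosed_empty

lemma IsSymmetric.swap_mem_demand (hsymm : IsSymmetric p) {x q : ℝ × ℝ} (hx : x ∈ demand p q) :
    x.swap ∈ demand p q.swap := by
  obtain ⟨hxs, hq, h⟩ := hx
  refine ⟨swap_mem_square hxs, swap_mem_square hq, fun y hy => ?_⟩
  have h1 := h y.swap (swap_mem_square hy)
  rw [hsymm y hy] at h1
  rw [hsymm x hxs]
  simp only [dot, Prod.fst_swap, Prod.snd_swap] at h1 ⊢
  linarith

lemma IsSymmetric.swap_mem_demand_iff (hsymm : IsSymmetric p) {x q : ℝ × ℝ} :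
    x.swap ∈ demand p q.swap ↔ x ∈ demand p q :=
  ⟨fun h => by simpa using hsymm.swap_mem_demand h, hsymm.swap_mem_demand⟩

/-- Optimality of `(q, 1)` need only be tested against types on the top edge, since `top_sub_le`
covers the rest. -/
lemma IsFeasible.mem_demand_top_iff (hp : IsFeasible p) {q : ℝ} (hq : q ∈ Icc (0 : ℝ) 1)
    {x : ℝ × ℝ} : x ∈ demand p (q, 1) ↔
      x ∈ square ∧ IsSlope (ubar p) x.1 q ∧ utility p x = ubar p x.1 + x.2 - 1 := by
  constructor
  · rintro ⟨hx, -, h⟩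
    have h1 : ∀ t ∈ Icc (0 : ℝ) 1, t * q + 1 - ubar p t ≤ x.1 * q + x.2 - utility p x := by
      intro t ht
      have := h (t, 1) (top_mem_square ht)
      simp only [dot, mul_one] at this
      exact this
    have h2 := hp.top_sub_le hx
    refine ⟨hx, fun s hs => ?_, ?_⟩
    · linarith [h1 s hs]
    · linarith [h1 x.1 hx.1]
  · rintro ⟨hx, hsl, hu⟩
    refine ⟨hx, ⟨hq, right_mem_Icc.2 zero_le_one⟩, fun y hy => ?_⟩
    have h1 := hsl y.1 hy.1
    have h2 := hp.top_sub_le hy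
    simp only [dot, mul_one]
    linarith

lemma IsOptimal.mem_demand_top_iff (hp : IsOptimal f p) (hf : IsSRS f) (hsymm : IsSymmetric p)
    {q : ℝ} (hq : q ∈ Icc (0 : ℝ) 1) {x : ℝ × ℝ} : x ∈ demand p (q, 1) ↔
      x ∈ square ∧ IsSlope (ubar p) x.1 q ∧ 0 ≤ ubar p x.1 + x.2 - 1 ∧
        ubar p x.2 + x.1 ≤ ubar p x.1 + x.2 := by
  rw [hp.feasible.mem_demand_top_iff hq]
  refine and_congr_right fun hx => and_congr_right fun _ => ?_
  rw [hp.utility_eq hf hsymm hx, extendProfile]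
  constructor
  · intro h
    refine ⟨?_, ?_⟩
    · rw [← h]
      exact le_max_of_le_left (le_max_left _ _)
    · have := le_max_right (max 0 (ubar p x.1 + x.2 - 1)) (ubar p x.2 + x.1 - 1)
      linarith
  · rintro ⟨h1, h2⟩
    rw [max_eq_right h1, max_eq_left (by linarith)]

/-- The types above the diagonal with first coordinate in `[a, b]` that buy the second good. -/
def upgradeRegion (v : ℝ → ℝ) (a b : ℝ) : Set (ℝ × ℝ) :=
  {x | x.1 ∈ Icc a b ∧ max (1 - v x.1) x.1 ≤ x.2 ∧ x.2 ≤ 1}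

lemma IsOptimal.mem_demand_top_iff_of_le (hp : IsOptimal f p) (hf : IsSRS f)
    (hsymm : IsSymmetric p) {q : ℝ} (hq : q ∈ Icc (0 : ℝ) 1) {x : ℝ × ℝ} (hx : x.1 ≤ x.2) :
    x ∈ demand p (q, 1) ↔ x ∈ upgradeRegion (ubar p) (lowerEnd p q) (upperEnd p q) := by
  have hF := hp.feasible
  have hv := hp.isProfile hf hsymm
  rw [hp.mem_demand_top_iff hf hsymm hq]
  constructor
  · rintro ⟨hxs, hsl, h1, -⟩
    exact ⟨(hF.isSlope_iff hq hxs.1).1 hsl, max_le (by linarith) hx, hxs.2.2⟩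
  · rintro ⟨hab, h1, h2⟩
    have ha := (hF.lowerEnd_mem hq).1
    have hb := (hF.upperEnd_mem hq).1
    have hxs : x ∈ square :=
      ⟨⟨ha.1.trans hab.1, hab.2.trans hb.2⟩, (ha.1.trans hab.1).trans hx, h2⟩
    refine ⟨hxs, (hF.isSlope_iff hq hxs.1).2 hab, ?_, ?_⟩
    · linarith [(le_max_left _ _).trans h1]
    · linarith [hv.sub_le hxs.1 hxs.2 hx]

/-- A buyer below the diagonal would do strictly better with the first good for sure, since for `q <
1` the profile rises from `x₂` to `x₁` by less than `x₁ - x₂`. -/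
lemma IsOptimal.le_of_mem_demand_top (hp : IsOptimal f p) (hf : IsSRS f)
    (hsymm : IsSymmetric p) {q : ℝ} (hq : q ∈ Icc (0 : ℝ) 1) (hq1 : q < 1) {x : ℝ × ℝ}
    (hx : x ∈ demand p (q, 1)) : x.1 ≤ x.2 := by
  obtain ⟨hxs, hsl, -, h⟩ := (hp.mem_demand_top_iff hf hsymm hq).1 hx
  by_contra! hlt
  have := hsl x.2 hxs.2
  nlinarith

lemma IsOptimal.demand_top_eq (hp : IsOptimal f p) (hf : IsSRS f)
    (hsymm : IsSymmetric p) {q : ℝ} (hq : q ∈ Icc (0 : ℝ) 1) (hq1 : q < 1) :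
    demand p (q, 1) = upgradeRegion (ubar p) (lowerEnd p q) (upperEnd p q) := by
  ext x
  refine ⟨fun hx => ?_, fun hx => ?_⟩
  · exact (hp.mem_demand_top_iff_of_le hf hsymm hq (hp.le_of_mem_demand_top hf hsymm hq hq1 hx)).1 hx
  · exact (hp.mem_demand_top_iff_of_le hf hsymm hq ((le_max_right _ _).trans hx.2.1)).2 hx

/-! ### Marginal revenue -/

lemma IsTypeDensity.integrableOn_phi (hf : IsTypeDensity f) : IntegrableOn (phi f) openSquare := by
  have := hf.integrableOn_mul_phiInt (continuousOn_const (c := (1 : ℝ)))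
  simp only [one_mul] at this
  exact this.congr_fun (fun x hx => (hf.phi_eq hx).symm) isOpen_openSquare.measurableSet

lemma isClosed_upgradeRegion (hv : Continuous v) (a b : ℝ) : IsClosed (upgradeRegion v a b) :=
  (isClosed_Icc.preimage continuous_fst).inter
    ((isClosed_le (f := fun x : ℝ × ℝ => max (1 - v x.1) x.1) (by fun_prop) continuous_snd).inter
      (isClosed_le continuous_snd continuous_const))

lemma ae_eq_inter_openSquare {s : Set (ℝ × ℝ)} (hs : s ⊆ square) :
    (openSquare ∩ s : Set (ℝ × ℝ)) =ᵐ[volume] s := by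
  have h := openSquare_ae_eq_square.inter (ae_eq_refl s)
  rwa [inter_eq_right.2 hs] at h

/-- Fubini on the open square; the closed region and the open slices differ in one point of each
slice. -/
lemma IsSRS.setIntegral_upgradeRegion (hf : IsSRS f) (hv : Continuous v)
    (hv0 : ∀ t ∈ Icc (0 : ℝ) 1, 0 ≤ v t) {a b : ℝ} (ha : 0 ≤ a) (hb : b ≤ 1) :
    ∫ x in upgradeRegion v a b, phi f x
      = ∫ t in Icc a b, ∫ y in (max (1 - v t) t)..1, phi f (t, y) := by
  have hR := (isClosed_upgradeRegion hv a b).measurableSet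
  have hsub : upgradeRegion v a b ⊆ square := fun x hx =>
    ⟨⟨ha.trans hx.1.1, hx.1.2.trans hb⟩,
      (ha.trans hx.1.1).trans ((le_max_right _ _).trans hx.2.1), hx.2.2⟩
  have hint : Integrable ((upgradeRegion v a b).indicator (phi f))
      ((volume.restrict (Ioo (0 : ℝ) 1)).prod (volume.restrict (Ioo (0 : ℝ) 1))) := by
    rw [Measure.prod_restrict]
    exact hf.integrableOn_phi.indicator hR
  have h1 := integral_prod _ hint
  rw [Measure.prod_restrict] at h1
  rw [← setIntegral_congr_set (ae_eq_inter_openSquare hsub), ← setIntegral_indicator hR]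
  refine h1.trans ?_
  have h2 : ∀ t ∈ Ioo (0 : ℝ) 1,
      ∫ y in Ioo 0 1, (upgradeRegion v a b).indicator (phi f) (t, y)
      = (Icc a b).indicator (fun t => ∫ y in (max (1 - v t) t)..1, phi f (t, y)) t := by
    intro t ht
    have ht' := Ioo_subset_Icc_self ht
    by_cases h : t ∈ Icc a b
    · have hm := max_one_sub_mem (hv0 t ht') ht'
      rw [indicator_of_mem h, intervalIntegral_slice_eq (ht.1.le.trans hm.1) hm.2]
      refine integral_congr_ae ?_
      filter_upwards [ae_restrict_mem measurableSet_Ioo,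
        ae_restrict_of_ae (Measure.ae_ne volume (max (1 - v t) t))] with y hy hne
      by_cases hy' : y ∈ Ioi (max (1 - v t) t)
      · rw [indicator_of_mem hy', indicator_of_mem]
        exact ⟨h, le_of_lt hy', hy.2.le⟩
      · rw [indicator_of_notMem hy', indicator_of_notMem]
        exact fun hh => hne (le_antisymm (notMem_Ioi.1 hy') hh.2.1)
    · rw [indicator_of_notMem h]
      have : ∀ y, (upgradeRegion v a b).indicator (phi f) (t, y) = 0 :=
        fun y => indicator_of_notMem (fun hh => h hh.1) _
      simp [this]
  rw [setIntegral_congr_fun measurableSet_Ioo h2, ← integral_Icc_eq_integral_Ioo,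
    setIntegral_indicator measurableSet_Icc, inter_eq_right.2 (Icc_subset_Icc ha hb)]

lemma IsOptimal.setIntegral_upgradeRegion_sub (hp : IsOptimal f p) (hf : IsSRS f)
    (hsymm : IsSymmetric p) {a b : ℝ} (ha : 0 ≤ a) (hab : a ≤ b) (hb : b ≤ 1) :
    (∫ x in upgradeRegion (ubar p) a b, phi f x) - ∫ t in Icc a b, f (t, 1)
      = ∫ t in a..b, Phi f p t := by
  have hv := hp.isProfile hf hsymm
  have hsub := Icc_subset_Icc ha hb
  have hftop : IntegrableOn (fun t => f (t, 1)) (Icc a b) :=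
    (hf.continuousOn_top.mono hsub).integrableOn_compact isCompact_Icc
  have hPhi : IntegrableOn (Phi f p) (Icc a b) :=
    ((hp.continuousOn_Phi hf hsymm).mono hsub).integrableOn_compact isCompact_Icc
  have hA : IntegrableOn (fun t => ∫ y in (max (1 - ubar p t) t)..1, phi f (t, y)) (Icc a b) := by
    refine (hPhi.add hftop).congr (Eventually.of_forall fun t => ?_)
    simp [Phi]
  rw [hf.setIntegral_upgradeRegion hp.feasible.continuous_ubar (fun t ht => hv.nonneg ht) ha hb,
    ← integral_sub hA hftop, intervalIntegral.integral_of_le hab, ← integral_Icc_eq_integral_Ioc]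
  rfl

lemma IsSRS.phi_swap (hf : IsSRS f) {x : ℝ × ℝ} (hx : x ∈ openSquare) :
    phi f x.swap = phi f x := by
  rw [hf.phi_eq hx, hf.phi_eq (swap_mem_openSquare hx), phiInt, phiInt,
    hf.symmetric x (openSquare_subset_square hx),
    fderiv_swap_apply (fun y hy => hf.symmetric y (openSquare_subset_square hy)) hx]

/-- The marginal revenue of a bundle on the top edge is an integral of `Φ`. -/
theorem IsOptimal.marginalRevenue_eq (hp : IsOptimal f p) (hf : IsSRS f) (hsymm : IsSymmetric p)
    {q : ℝ} (hq : q ∈ Icc (0 : ℝ) 1) : marginalRevenue f p (q, 1)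
      = (if q = 1 then 2 else 1) * ∫ t in (lowerEnd p q)..(upperEnd p q), Phi f p t := by
  have hF := hp.feasible
  have hab := (hF.buyers_eq_Icc hq).1
  have ha := (hF.lowerEnd_mem hq).1
  have hb := (hF.upperEnd_mem hq).1
  have hkey := hp.setIntegral_upgradeRegion_sub hf hsymm ha.1 hab hb.2
  have hv := hp.isProfile hf hsymm
  have htop : {t : ℝ | (t, (1 : ℝ)) ∈ demand p (q, 1)} = Icc (lowerEnd p q) (upperEnd p q) := by
    ext t
    constructor
    · intro ht
      have ht : (t, (1 : ℝ)) ∈ demand p (q, 1) := ht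
      exact ((hp.mem_demand_top_iff_of_le hf hsymm hq (x := (t, 1)) ht.1.1.2).1 ht).1
    · intro ht
      have ht1 : t ∈ Icc (0 : ℝ) 1 := ⟨ha.1.trans ht.1, ht.2.trans hb.2⟩
      refine (hp.mem_demand_top_iff_of_le hf hsymm hq (x := (t, 1)) ht1.2).2 ⟨ht, ?_, le_rfl⟩
      exact (max_one_sub_mem (hv.nonneg ht1) ht1).2
  rw [marginalRevenue, htop]
  -- The demand set of the grand bundle is symmetric about the diagonal, so each half contributes
  -- the same amount. For `q < 1` the demand set lies above the diagonal and meets the right edge at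
  -- most in `(1, 1)`.
  split_ifs with h1
  · subst h1
    have hright : {t : ℝ | ((1 : ℝ), t) ∈ demand p (1, 1)}
        = Icc (lowerEnd p 1) (upperEnd p 1) := by
      rw [← htop]
      ext t
      exact (hsymm.swap_mem_demand_iff (x := (1, t)) (q := (1, 1))).symm
    have hedge : ∫ t in Icc (lowerEnd p 1) (upperEnd p 1), f (1, t)
        = ∫ t in Icc (lowerEnd p 1) (upperEnd p 1), f (t, 1) := by
      refine setIntegral_congr_fun measurableSet_Icc fun t ht => ?_
      exact (hf.symmetric (1, t) (swap_mem_square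
        (top_mem_square ⟨ha.1.trans ht.1, ht.2.trans hb.2⟩))).symm
    have hDsub : demand p (1, 1) ⊆ square := fun x hx => hx.1
    have hDm := (hF.isClosed_demand (1, 1)).measurableSet
    have hswap : Prod.swap ⁻¹' (openSquare ∩ demand p (1, 1)) = openSquare ∩ demand p (1, 1) := by
      rw [preimage_inter, preimage_swap_openSquare]
      congr 1
      ext x
      exact hsymm.swap_mem_demand_iff (x := x) (q := (1, 1))
    have hsy := setIntegral_of_symm (isOpen_openSquare.measurableSet.inter hDm) hswap
      (hf.integrableOn_phi.mono_set inter_subset_left) fun x hx => hf.phi_swap hx.1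
    have hhalf : (openSquare ∩ demand p (1, 1) ∩ {x | x.1 < x.2} : Set (ℝ × ℝ))
        =ᵐ[volume] upgradeRegion (ubar p) (lowerEnd p 1) (upperEnd p 1) := by
      have hne : ∀ᵐ x : ℝ × ℝ, x.1 ≠ x.2 := by
        rw [ae_iff]
        simpa using volume_diagonal
      filter_upwards [hne, openSquare_ae_eq_square.mem_iff] with x hx hxs
      refine propext ⟨fun ⟨⟨_, hD⟩, hlt⟩ => ?_, fun hR => ?_⟩
      · exact (hp.mem_demand_top_iff_of_le hf hsymm hq (le_of_lt hlt)).1 hD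
      · have hle : x.1 ≤ x.2 := (le_max_right _ _).trans hR.2.1
        have hD := (hp.mem_demand_top_iff_of_le hf hsymm hq hle).2 hR
        exact ⟨⟨hxs.2 hD.1, hD⟩, lt_of_le_of_ne hle hx⟩
    rw [hright, hedge, ← setIntegral_congr_set (ae_eq_inter_openSquare hDsub), hsy,
      setIntegral_congr_set hhalf, ← hkey]
    ring
  · have hq1 := lt_of_le_of_ne hq.2 h1
    have hright : ∫ t in {t : ℝ | ((1 : ℝ), t) ∈ demand p (q, 1)}, f (1, t) = 0 := by
      have hsub : {t : ℝ | ((1 : ℝ), t) ∈ demand p (q, 1)} ⊆ {1} := by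
        intro t ht
        have ht : ((1 : ℝ), t) ∈ demand p (q, 1) := ht
        exact le_antisymm ht.1.2.2 (hp.le_of_mem_demand_top hf hsymm hq hq1 ht)
      exact setIntegral_measure_zero _ (measure_mono_null hsub Real.volume_singleton)
    rw [hright, add_zero, hp.demand_top_eq hf hsymm hq hq1, hkey, one_mul]

/-! ### Pooling bundles -/

lemma IsOptimal.integral_Phi_eq_tail_sub (hp : IsOptimal f p) (hf : IsSRS f)
    (hsymm : IsSymmetric p) {a b : ℝ} (ha : a ∈ Icc (0 : ℝ) 1) (hb : b ∈ Icc (0 : ℝ) 1) :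
    ∫ t in a..b, Phi f p t = tail (phiExt f p) a - tail (phiExt f p) b := by
  rw [integral_Phi_eq ha hb, tail_sub_tail (hp.isStationary hf hsymm).continuous]

lemma volume_horizontal (s : ℝ) : volume {x : ℝ × ℝ | x.2 = s} = 0 := by
  have h : {x : ℝ × ℝ | x.2 = s} = univ ×ˢ {s} := by
    ext x
    simp
  rw [h, Measure.volume_eq_prod, Measure.prod_prod, Real.volume_singleton, mul_zero]

lemma typeMeasure_eq_zero_of_volume {s : Set (ℝ × ℝ)} (hs : volume s = 0) : typeMeasure f s = 0 :=
  typeMeasure_ac f (Measure.restrict_le_self.absolutelyContinuous hs)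


end TwoGoods

namespace TwoGoods

variable {f p : ℝ × ℝ → ℝ} {w v : ℝ → ℝ}

lemma IsPooling.mem_Icc {q : ℝ} (h : IsPooling f p (q, 1)) : q ∈ Icc (0 : ℝ) 1 := h.1.1.1

/-- Kinks occur at both ends of the interval of buyers of a pooling bundle, or at least the tail
integral vanishes there. -/
lemma IsOptimal.tail_eq_zero_of_isPooling (hp : IsOptimal f p) (hf : IsSRS f)
    (hsymm : IsSymmetric p) {q : ℝ} (h : IsPooling f p (q, 1)) :
    tail (phiExt f p) (lowerEnd p q) = 0 ∧ tail (phiExt f p) (upperEnd p q) = 0 := by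
  have hq := h.mem_Icc
  have hF := hp.feasible
  have hv := hp.isProfile hf hsymm
  have ha := hF.lowerEnd_mem hq
  have hb := hF.upperEnd_mem hq
  have h0 : (0 : ℝ) ∈ Icc (0 : ℝ) 1 := left_mem_Icc.2 zero_le_one
  have h1 : (1 : ℝ) ∈ Icc (0 : ℝ) 1 := right_mem_Icc.2 zero_le_one
  constructor
  · rcases eq_or_ne q 0 with rfl | hq0
    · have hl : lowerEnd p 0 = 0 :=
        le_antisymm ((hF.isSlope_iff hq h0).1 hv.isSlope_zero_zero).1 ha.1.1
      -- For `q = 0` the left end may fail to be a kink. If `ū(0) = 0`, the buyers of `(0, 1)` would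
      -- lie on the top edge, a null set; hence the profile can be lowered and `tail` at 0 is
      -- nonpositive.
      have hpos : 0 < ubar p 0 := by
        refine hv.initial_nonneg.lt_of_ne fun hz => ?_
        have hsub : demand p (0, 1) ⊆ {x | x.2 = 1} := by
          intro x hx
          obtain ⟨hxs, hsl, hnn, -⟩ := (hp.mem_demand_top_iff hf hsymm hq).1 hx
          have h2 := hsl 0 h0
          rw [← hz] at h2
          have h3 := hxs.2.2
          exact le_antisymm h3 (by linarith)
        exact h.2.ne' (measure_mono_null hsub (typeMeasure_eq_zero_of_volume (volume_horizontal 1)))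
      rw [hl]
      exact le_antisymm ((hp.isStationary hf hsymm).tail_zero_nonpos hpos)
        (hp.tail_zero_nonneg hf hsymm)
    · exact (hp.of_isKink hf hsymm ha.1 (hF.isKink_lowerEnd hv hq hq0)).1
  · rcases eq_or_ne q 1 with rfl | hq1
    · have hu : upperEnd p 1 = 1 :=
        le_antisymm hb.1.2 ((hF.isSlope_iff hq h1).1 hv.isSlope_one_one).2
      rw [hu, tail_one]
    · exact (hp.of_isKink hf hsymm hb.1 (hF.isKink_upperEnd hv hq hq1)).1

theorem IsOptimal.integral_Phi_eq_zero_of_isPooling (hp : IsOptimal f p) (hf : IsSRS f)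
    (hsymm : IsSymmetric p) {q : ℝ} (h : IsPooling f p (q, 1)) :
    ∫ t in (lowerEnd p q)..(upperEnd p q), Phi f p t = 0 := by
  have ht := hp.tail_eq_zero_of_isPooling hf hsymm h
  rw [hp.integral_Phi_eq_tail_sub hf hsymm (hp.feasible.lowerEnd_mem h.mem_Icc).1
    (hp.feasible.upperEnd_mem h.mem_Icc).1, ht.1, ht.2, sub_zero]

/-! ### The grand bundle -/

lemma isActive_of_demand_pos {q : ℝ × ℝ} (hq : q ∈ square) (hq0 : q ≠ 0)
    (h : 0 < typeMeasure f (demand p q)) : IsActive f p q := by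
  refine ⟨hq, hq0, fun δ hδ => h.trans_le (measure_mono ?_)⟩
  exact subset_biUnion_of_mem (u := demand p) (by simpa [eDist] using hδ)

theorem IsOptimal.isPooling_grand (hp : IsOptimal f p) (hf : IsSRS f) (hsymm : IsSymmetric p) :
    IsPooling f p (1, 1) := by
  have hF := hp.feasible
  have hv := hp.isProfile hf hsymm
  have h1 : (1 : ℝ) ∈ Icc (0 : ℝ) 1 := right_mem_Icc.2 zero_le_one
  have ha := hF.lowerEnd_mem h1
  have hvc := hF.continuous_ubar
  have hv1 := hp.ubar_pos hf hsymm h1 one_pos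
  obtain ⟨s, hs, hsv⟩ : ∃ s ∈ Ioo (0 : ℝ) 1, ∀ t ∈ Icc s 1, 1 - ubar p t < t := by
    have hev : ∀ᶠ t in 𝓝 (1 : ℝ), 1 - ubar p t < t := by
      have hc : Continuous fun t => t - (1 - ubar p t) := by fun_prop
      filter_upwards [hc.continuousAt.eventually (lt_mem_nhds (a := 0) (by linarith))] with t ht
      linarith
    obtain ⟨ε, hε, hball⟩ := Metric.eventually_nhds_iff.1 hev
    refine ⟨max (1 - ε / 2) (1 / 2), ⟨lt_max_of_lt_right (by norm_num),
      max_lt (by linarith) (by norm_num)⟩, fun t ht => hball ?_⟩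
    rw [Real.dist_eq]
    have := (le_max_left (1 - ε / 2) (1 / 2)).trans ht.1
    exact (abs_le.2 ⟨by linarith, by linarith [ht.2]⟩).trans_lt (half_lt_self hε)
  -- Otherwise 1 is a kink and minimizes the double tail with value 0, whereas just below 1 the
  -- double tail is negative.
  have hlt : lowerEnd p 1 < 1 := by
    refine ha.1.2.lt_of_ne fun heq => ?_
    have hk := hF.isKink_lowerEnd hv h1 one_ne_zero
    rw [heq] at hk
    have h2 := (hp.isStationary hf hsymm).tail_tail_le h1 hk (Ioo_subset_Icc_self hs)
    rw [tail_one] at h2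
    exact h2.not_gt (hp.tail_tail_neg hf hsymm hs fun t ht => (hsv t ht).le)
  have hu : upperEnd p 1 = 1 :=
    le_antisymm (hF.upperEnd_mem h1).1.2 ((hF.isSlope_iff h1 h1).1 hv.isSlope_one_one).2
  set U : Set (ℝ × ℝ) := Ioo (lowerEnd p 1) 1 ×ˢ Ioo (lowerEnd p 1) 1
    ∩ {x | 1 - ubar p x.1 < x.2}
  have hUo : IsOpen U := (isOpen_Ioo.prod isOpen_Ioo).inter
    (isOpen_lt (by fun_prop : Continuous fun x : ℝ × ℝ => 1 - ubar p x.1) continuous_snd)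
  have hUsq : U ⊆ square := fun x hx =>
    ⟨⟨ha.1.1.trans hx.1.1.1.le, hx.1.1.2.le⟩, ha.1.1.trans hx.1.2.1.le, hx.1.2.2.le⟩
  have hUne : U.Nonempty := by
    have hm : max s (lowerEnd p 1) < 1 := max_lt hs.2 hlt
    obtain ⟨r, hr1, hr2⟩ := exists_between hm
    have hr3 := (le_max_right _ _).trans_lt hr1
    exact ⟨(r, r), ⟨⟨hr3, hr2⟩, hr3, hr2⟩, hsv r ⟨((le_max_left _ _).trans_lt hr1).le, hr2.le⟩⟩
  have hUD : U ⊆ demand p (1, 1) := by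
    intro x hx
    have hxs := hUsq hx
    have hs1 : IsSlope (ubar p) x.1 1 := (hF.isSlope_iff h1 hxs.1).2 ⟨hx.1.1.1.le, hxs.1.2.trans_eq hu.symm⟩
    have hs2 : IsSlope (ubar p) x.2 1 := (hF.isSlope_iff h1 hxs.2).2 ⟨hx.1.2.1.le, hxs.2.2.trans_eq hu.symm⟩
    refine (hp.mem_demand_top_iff hf hsymm h1).2 ⟨hxs, hs1, ?_, ?_⟩
    · have : 1 - ubar p x.1 < x.2 := hx.2
      linarith
    · linarith [hs2 x.1 hxs.1]
  have hpos := hf.typeMeasure_pos_of_isOpen hUo hUne hUD hUsq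
  exact ⟨isActive_of_demand_pos ⟨h1, h1⟩ (by simp [Prod.ext_iff]) hpos, hpos⟩

/-! ### Active bundles -/

/-- A bundle demanded by `x` is a subgradient at `x`, hence the gradient. -/
lemma eq_of_mem_demand_of_differentiableAt {x r : ℝ × ℝ} (hx : x ∈ openSquare)
    (hd : DifferentiableAt ℝ (utility p) x) (hr : x ∈ demand p r) :
    r = (fderiv ℝ (utility p) x (1, 0), fderiv ℝ (utility p) x (0, 1)) := by
  set L : ℝ × ℝ →L[ℝ] ℝ :=
    r.1 • ContinuousLinearMap.fst ℝ ℝ ℝ + r.2 • ContinuousLinearMap.snd ℝ ℝ ℝ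
  have hL : ∀ y, L y = dot y r := fun y => by
    simp only [L, dot, add_apply, smul_apply, ContinuousLinearMap.coe_fst',
      ContinuousLinearMap.coe_snd', smul_eq_mul]
    ring
  have hmin : IsLocalMin (fun y => utility p y - L y) x := by
    filter_upwards [isOpen_openSquare.mem_nhds hx] with y hy
    have := hr.2.2 y (openSquare_subset_square hy)
    rw [hL, hL]
    linarith
  have h0 := hmin.hasFDerivAt_eq_zero (hd.hasFDerivAt.sub L.hasFDerivAt)
  rw [sub_eq_zero] at h0
  rw [h0, hL, hL]
  simp [dot]

/-- Almost every type buys nothing or one of the goods for sure. -/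
lemma IsOptimal.ae_demand (hp : IsOptimal f p) (hf : IsSRS f) (hsymm : IsSymmetric p) :
    ∀ᵐ x ∂(volume.restrict square), ∀ r, x ∈ demand p r →
      r = 0 ∨ (r.2 = 1 ∧ IsSlope (ubar p) x.1 r.1) ∨ r.1 = 1 := by
  have hF := hp.feasible
  have hv := hp.isProfile hf hsymm
  rw [← Measure.restrict_congr_set openSquare_ae_eq_square]
  filter_upwards [ae_restrict_mem isOpen_openSquare.measurableSet,
    ae_restrict_of_ae hF.lipschitzWith.ae_differentiableAt] with x hx hd r hr
  have huniq : ∀ r', x ∈ demand p r' → r = r' := fun r' hr' => by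
    rw [eq_of_mem_demand_of_differentiableAt hx hd hr,
      eq_of_mem_demand_of_differentiableAt hx hd hr']
  have hxs := openSquare_subset_square hx
  have hu := hp.utility_eq hf hsymm hxs
  rw [extendProfile] at hu
  rcases max_choice (max 0 (ubar p x.1 + x.2 - 1)) (ubar p x.2 + x.1 - 1) with h | h
  · rw [h] at hu
    rcases max_choice 0 (ubar p x.1 + x.2 - 1) with h' | h'
    · rw [h'] at hu
      left
      refine huniq 0 ⟨hxs, zero_mem_square, fun y _ => ?_⟩
      rw [hu]
      simpa [dot] using hF.utility_nonneg y
    · rw [h'] at hu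
      obtain ⟨q, hq, hsl⟩ := hv.exists_slope x.1 hxs.1
      have := huniq (q, 1) ((hF.mem_demand_top_iff hq).2 ⟨hxs, hsl, hu⟩)
      right; left
      rw [this]
      exact ⟨rfl, hsl⟩
  · rw [h] at hu
    obtain ⟨q, hq, hsl⟩ := hv.exists_slope x.2 hxs.2
    have hD : x.swap ∈ demand p (q, 1) :=
      (hF.mem_demand_top_iff hq).2 ⟨swap_mem_square hxs, hsl, (hsymm x hxs).trans hu⟩
    have := huniq (1, q) (hsymm.swap_mem_demand_iff.1 hD)
    right; right
    rw [this]

lemma abs_sub_le_eDist (q r : ℝ × ℝ) : |q.1 - r.1| ≤ eDist q r ∧ |q.2 - r.2| ≤ eDist q r := by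
  constructor <;> rw [eDist, ← Real.sqrt_sq_eq_abs] <;> apply Real.sqrt_le_sqrt
  · nlinarith [sq_nonneg (q.2 - r.2)]
  · nlinarith [sq_nonneg (q.1 - r.1)]

/-- Every neighbourhood of an active bundle contains bundles bought by generic types. -/
lemma IsActive.exists_mem_demand {q : ℝ × ℝ} (h : IsActive f p q) {δ : ℝ} (hδ : 0 < δ)
    {P : ℝ × ℝ → Prop} (hP : ∀ᵐ x ∂(volume.restrict square), P x) :
    ∃ x r, P x ∧ x ∈ demand p r ∧ |r.1 - q.1| < δ ∧ |r.2 - q.2| < δ := by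
  by_contra! hno
  refine (h.2.2 δ hδ).ne' (typeMeasure_ac f (measure_mono_null ?_ (ae_iff.1 hP)))
  intro x hx
  simp only [mem_iUnion] at hx
  obtain ⟨r, hr, hxr⟩ := hx
  have hr : eDist r q < δ := hr
  intro hPx
  have := hno x r hPx hxr ((abs_sub_le_eDist r q).1.trans_lt hr)
  exact this.not_gt ((abs_sub_le_eDist r q).2.trans_lt hr)

theorem IsOptimal.eq_one_of_isActive (hp : IsOptimal f p) (hf : IsSRS f) (hsymm : IsSymmetric p)
    {q : ℝ × ℝ} (h : IsActive f p q) : q.1 = 1 ∨ q.2 = 1 := by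
  by_contra! hne
  have hqs := h.1
  have hq0 := h.2.1
  have h1 : q.1 < 1 := lt_of_le_of_ne hqs.1.2 hne.1
  have h2 : q.2 < 1 := lt_of_le_of_ne hqs.2.2 hne.2
  have h3 : 0 < max q.1 q.2 := by
    by_contra! hle
    have h4 := (le_max_left _ _).trans hle
    have h5 := (le_max_right _ _).trans hle
    exact hq0 (Prod.ext (le_antisymm h4 hqs.1.1) (le_antisymm h5 hqs.2.1))
  -- The box of radius `δ` around `q` misses both edges `q₁ = 1` and `q₂ = 1` and the origin, hence
  -- everything generic types buy.
  set δ := min (min (1 - q.1) (1 - q.2)) (max q.1 q.2) with hδdef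
  have hδ : 0 < δ := lt_min (lt_min (by linarith) (by linarith)) h3
  have hδ1 : δ ≤ 1 - q.1 := (min_le_left _ _).trans (min_le_left _ _)
  have hδ2 : δ ≤ 1 - q.2 := (min_le_left _ _).trans (min_le_right _ _)
  have hδ3 : δ ≤ max q.1 q.2 := min_le_right _ _
  obtain ⟨x, r, hx, hr, hr1, hr2⟩ := h.exists_mem_demand hδ (hp.ae_demand hf hsymm)
  rw [abs_lt] at hr1 hr2
  rcases hx r hr with rfl | ⟨h4, -⟩ | h4
  · simp only [Prod.fst_zero, Prod.snd_zero] at hr1 hr2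
    have : max q.1 q.2 < δ := max_lt (by linarith) (by linarith)
    linarith
  · linarith
  · linarith

/-- Only null sets matter here, and those are the null sets of Lebesgue measure on the square, which
swapping preserves. -/
lemma IsSRS.typeMeasure_preimage_swap_pos (hf : IsSRS f) {s : Set (ℝ × ℝ)}
    (h : 0 < typeMeasure f s) : 0 < typeMeasure f (Prod.swap ⁻¹' s) := by
  refine pos_iff_ne_zero.2 fun h0 => h.ne' (typeMeasure_ac f ?_)
  have h1 := hf.volume_ac h0
  rw [Measure.restrict_apply' measurableSet_square] at h1 ⊢
  have h2 := measurePreserving_swap.quasiMeasurePreserving.preimage_null h1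
  refine measure_mono_null (fun x hx => ?_) h2
  exact ⟨by simpa using hx.1, swap_mem_square hx.2⟩

theorem IsActive.swap (hf : IsSRS f) (hsymm : IsSymmetric p) {q : ℝ × ℝ} (h : IsActive f p q) :
    IsActive f p q.swap := by
  obtain ⟨hqs, hq0, hact⟩ := h
  refine ⟨swap_mem_square hqs, fun h0 => hq0 ?_, fun δ hδ => ?_⟩
  · rw [← Prod.swap_swap q, h0]
    rfl
  · refine (hf.typeMeasure_preimage_swap_pos (hact δ hδ)).trans_le (measure_mono fun x hx => ?_)
    simp only [mem_preimage, mem_iUnion] at hx ⊢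
    obtain ⟨r, hr, hxr⟩ := hx
    refine ⟨r.swap, ?_, by simpa using hsymm.swap_mem_demand hxr⟩
    have hr : eDist r q < δ := hr
    show eDist r.swap q.swap < δ
    rw [eDist, Prod.fst_swap, Prod.snd_swap, Prod.fst_swap, Prod.snd_swap, add_comm]
    exact hr

/-! ### Separating bundles -/

/-- An interval of buyers of positive length carries an open set of types above it, because `ū > 0`
at its interior points; the bundle would then be pooling. -/
theorem IsOptimal.lowerEnd_eq_upperEnd (hp : IsOptimal f p) (hf : IsSRS f)
    (hsymm : IsSymmetric p) {q : ℝ} (h : IsSeparating f p (q, 1)) :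
    lowerEnd p q = upperEnd p q := by
  have hF := hp.feasible
  have hq : q ∈ Icc (0 : ℝ) 1 := h.1.1.1
  have ha := (hF.lowerEnd_mem hq).1
  have hb := (hF.upperEnd_mem hq).1
  refine (hF.buyers_eq_Icc hq).1.eq_of_not_lt fun hlt => h.2 ⟨h.1, ?_⟩
  set U : Set (ℝ × ℝ) := {x | x.1 ∈ Ioo (lowerEnd p q) (upperEnd p q)
    ∧ max (1 - ubar p x.1) x.1 < x.2 ∧ x.2 < 1}
  have hvc := hF.continuous_ubar
  have hUo : IsOpen U := (isOpen_Ioo.preimage continuous_fst).inter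
    ((isOpen_lt (f := fun x : ℝ × ℝ => max (1 - ubar p x.1) x.1) (by fun_prop)
      continuous_snd).inter (isOpen_lt continuous_snd continuous_const))
  have hUD : U ⊆ demand p (q, 1) := fun x hx =>
    (hp.mem_demand_top_iff_of_le hf hsymm hq ((le_max_right _ _).trans hx.2.1.le)).2
      ⟨Ioo_subset_Icc_self hx.1, hx.2.1.le, hx.2.2.le⟩
  refine hf.typeMeasure_pos_of_isOpen hUo ?_ hUD fun x hx => (hUD hx).1
  obtain ⟨t, ht1, ht2⟩ := exists_between hlt
  have ht : t ∈ Icc (0 : ℝ) 1 := ⟨ha.1.trans ht1.le, ht2.le.trans hb.2⟩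
  have hm : max (1 - ubar p t) t < 1 :=
    max_lt (by linarith [hp.ubar_pos hf hsymm ht (ha.1.trans_lt ht1)]) (ht2.trans_le hb.2)
  obtain ⟨y, hy1, hy2⟩ := exists_between hm
  exact ⟨(t, y), ⟨ht1, ht2⟩, hy1, hy2⟩

/-- Types whose slope is close to `q` are close to the only buyer `s` of `q`. -/
lemma IsProfile.exists_slope_close (hv : IsProfile v) {s q : ℝ} (hs : s ∈ Icc (0 : ℝ) 1)
    (hsq : IsSlope v s q) (huniq : ∀ t ∈ Icc (0 : ℝ) 1, IsSlope v t q → t = s) {ε : ℝ}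
    (hε : 0 < ε) : ∃ δ > 0, ∀ t ∈ Icc (0 : ℝ) 1, ∀ r, IsSlope v t r → |r - q| < δ →
      |t - s| < ε := by
  have hright : ∃ δ > 0, ∀ t ∈ Icc (0 : ℝ) 1, ∀ r, IsSlope v t r → r < q + δ → t < s + ε := by
    rcases lt_or_ge 1 (s + ε / 2) with h | h
    · exact ⟨1, one_pos, fun t ht _ _ _ => by linarith [ht.2]⟩
    · have hm : s + ε / 2 ∈ Icc (0 : ℝ) 1 := ⟨by linarith [hs.1], h⟩
      obtain ⟨k, -, hk⟩ := hv.exists_slope _ hm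
      have hle : q ≤ k := hsq.le_of_lt hs hm hk (by linarith)
      have hne : q ≠ k := fun heq => by
        have := huniq _ hm (heq ▸ hk)
        linarith
      refine ⟨k - q, sub_pos.2 (lt_of_le_of_ne hle hne), fun t ht r hr hrq => ?_⟩
      by_contra! hts
      have := hk.le_of_lt hm ht hr (by linarith)
      linarith
  have hleft : ∃ δ > 0, ∀ t ∈ Icc (0 : ℝ) 1, ∀ r, IsSlope v t r → q - δ < r → s - ε < t := by
    rcases lt_or_ge (s - ε / 2) 0 with h | h
    · exact ⟨1, one_pos, fun t ht _ _ _ => by linarith [ht.1]⟩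
    · have hm : s - ε / 2 ∈ Icc (0 : ℝ) 1 := ⟨h, by linarith [hs.2]⟩
      obtain ⟨k, -, hk⟩ := hv.exists_slope _ hm
      have hle : k ≤ q := hk.le_of_lt hm hs hsq (by linarith)
      have hne : k ≠ q := fun heq => by
        have := huniq _ hm (heq ▸ hk)
        linarith
      refine ⟨q - k, sub_pos.2 (lt_of_le_of_ne hle hne), fun t ht r hr hrq => ?_⟩
      by_contra! hts
      have := hr.le_of_lt ht hm hk (by linarith)
      linarith
  obtain ⟨δ₁, hδ₁, H₁⟩ := hright
  obtain ⟨δ₂, hδ₂, H₂⟩ := hleft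
  refine ⟨min δ₁ δ₂, lt_min hδ₁ hδ₂, fun t ht r hr hrq => ?_⟩
  rw [abs_lt] at hrq ⊢
  have h1 := H₁ t ht r hr (by linarith [min_le_left δ₁ δ₂])
  have h2 := H₂ t ht r hr (by linarith [min_le_right δ₁ δ₂])
  constructor <;> linarith

/-- Activity supplies slopes arbitrarily close to `q` at types other than `s`, and those types
converge to `s`. Between two such slopes on the same side of `q` there is a kink different from `s`,
so zeros of `tail` accumulate at `s`. -/
theorem IsOptimal.Phi_eq_zero_of_isSeparating (hp : IsOptimal f p) (hf : IsSRS f)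
    (hsymm : IsSymmetric p) {q : ℝ} (h : IsSeparating f p (q, 1)) :
    Phi f p (lowerEnd p q) = 0 := by
  have hF := hp.feasible
  have hv := hp.isProfile hf hsymm
  have hq : q ∈ Icc (0 : ℝ) 1 := h.1.1.1
  have hq1 : q < 1 := lt_of_le_of_ne hq.2 fun heq =>
    h.2 (by rw [heq]; exact hp.isPooling_grand hf hsymm)
  have hab := hp.lowerEnd_eq_upperEnd hf hsymm h
  obtain ⟨hs, hsq⟩ := hF.lowerEnd_mem hq
  set s := lowerEnd p q with hsdef
  have huniq : ∀ t ∈ Icc (0 : ℝ) 1, IsSlope (ubar p) t q → t = s := by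
    intro t ht hsl
    have := (hF.isSlope_iff hq ht).1 hsl
    rw [← hab] at this
    exact le_antisymm this.2 this.1
  have hpick : ∀ δ > 0, ∃ t ∈ Icc (0 : ℝ) 1, ∃ r ∈ Icc (0 : ℝ) 1, IsSlope (ubar p) t r ∧
      t ≠ s ∧ |r - q| < δ := by
    intro δ hδ
    have hne : ∀ᵐ x ∂(volume.restrict square), x.1 ≠ s := by
      refine ae_restrict_of_ae ?_
      rw [ae_iff]
      simpa using volume_vertical s
    -- A radius of at most `1 - q` excludes bundles with first coordinate 1, and also the zero
    -- bundle, which is at distance 1 in the second coordinate.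
    obtain ⟨x, r, ⟨hx, hxs⟩, hr, hr1, hr2⟩ := h.1.exists_mem_demand
      (lt_min hδ (sub_pos.2 hq1)) ((hp.ae_demand hf hsymm).and hne)
    simp only [lt_min_iff, abs_lt] at hr1 hr2
    rcases hx r hr with rfl | ⟨-, hsl⟩ | h1
    · simp only [Prod.snd_zero] at hr2
      linarith [hq.1, hr2.2.1]
    · exact ⟨x.1, hr.1.1, r.1, hr.2.1.1, hsl, hxs, abs_lt.2 hr1.1⟩
    · linarith [hr1.2.2]
  have hside : ∀ t ∈ Icc (0 : ℝ) 1, ∀ r, IsSlope (ubar p) t r → t ≠ s →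
      (s < t ∧ q < r) ∨ (t < s ∧ r < q) := by
    intro t ht r hr hts
    have hrq : r ≠ q := fun heq => hts (huniq t ht (heq ▸ hr))
    rcases lt_or_gt_of_ne hts with hlt | hgt
    · exact Or.inr ⟨hlt, lt_of_le_of_ne (hr.le_of_lt ht hs hsq hlt) hrq⟩
    · exact Or.inl ⟨hgt, lt_of_le_of_ne (hsq.le_of_lt hs ht hr hgt) hrq.symm⟩
  have hright : ∀ {t t' r r' : ℝ}, t ∈ Icc (0 : ℝ) 1 → t' ∈ Icc (0 : ℝ) 1 → r ∈ Icc (0 : ℝ) 1 →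
      IsSlope (ubar p) t r → IsSlope (ubar p) t' r' → s < t' → q < r' → r' < r →
      ∃ k, s < k ∧ k ≤ t ∧ tail (phiExt f p) k = 0 := by
    intro t t' r r' ht ht' hr hsl hsl' h1 h2 h3
    obtain ⟨hk, hk'⟩ := hF.lowerEnd_mem hr
    refine ⟨lowerEnd p r, ?_, ((hF.isSlope_iff hr ht).1 hsl).1,
      (hp.of_isKink hf hsymm hk (hF.isKink_lowerEnd hv hr (by linarith [hq.1]))).1⟩
    by_contra! hle
    have := hk'.le_of_lt hk ht' hsl' (by linarith)
    linarith
  have hleft : ∀ {t t' r r' : ℝ}, t ∈ Icc (0 : ℝ) 1 → t' ∈ Icc (0 : ℝ) 1 → r ∈ Icc (0 : ℝ) 1 →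
      IsSlope (ubar p) t r → IsSlope (ubar p) t' r' → t' < s → r' < q → r < r' →
      ∃ k, k < s ∧ t ≤ k ∧ tail (phiExt f p) k = 0 := by
    intro t t' r r' ht ht' hr hsl hsl' h1 h2 h3
    obtain ⟨hk, hk'⟩ := hF.upperEnd_mem hr
    refine ⟨upperEnd p r, ?_, ((hF.isSlope_iff hr ht).1 hsl).2,
      (hp.of_isKink hf hsymm hk (hF.isKink_upperEnd hv hr (by linarith))).1⟩
    by_contra! hle
    have := hsl'.le_of_lt ht' hk hk' (by linarith)
    linarith
  rw [← phiExt_eq hs]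
  refine eq_zero_of_tail_accumulates (hp.isStationary hf hsymm).continuous fun ε hε => ?_
  obtain ⟨δ, hδ, hclose⟩ := hv.exists_slope_close hs hsq huniq hε
  obtain ⟨t₀, ht₀, r₀, hr₀, hsl₀, hne₀, hd₀⟩ := hpick δ hδ
  have hc₀ := abs_lt.1 (hclose t₀ ht₀ r₀ hsl₀ hd₀)
  have hpos₀ : 0 < |r₀ - q| := by
    rw [abs_pos, sub_ne_zero]
    exact fun heq => hne₀ (huniq t₀ ht₀ (heq ▸ hsl₀))
  obtain ⟨t₁, ht₁, r₁, hr₁, hsl₁, hne₁, hd₁⟩ := hpick _ hpos₀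
  have hc₁ := abs_lt.1 (hclose t₁ ht₁ r₁ hsl₁ (hd₁.trans hd₀))
  have hpos₁ : 0 < |r₁ - q| := by
    rw [abs_pos, sub_ne_zero]
    exact fun heq => hne₁ (huniq t₁ ht₁ (heq ▸ hsl₁))
  obtain ⟨t₂, ht₂, r₂, hr₂, hsl₂, hne₂, hd₂⟩ := hpick _ hpos₁
  -- Of three slopes successively closer to `q`, two lie on the same side. The end point nearer to
  -- `s` of the buyers of the farther slope is a kink, and the closer slope separates it from `s`.
  have hfin : (∃ k, s < k ∧ k < s + ε ∧ tail (phiExt f p) k = 0)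
      ∨ ∃ k, k < s ∧ s - ε < k ∧ tail (phiExt f p) k = 0 := by
    rcases hside t₀ ht₀ r₀ hsl₀ hne₀ with ⟨a₀, b₀⟩ | ⟨a₀, b₀⟩ <;>
    rcases hside t₁ ht₁ r₁ hsl₁ hne₁ with ⟨a₁, b₁⟩ | ⟨a₁, b₁⟩ <;>
    rcases hside t₂ ht₂ r₂ hsl₂ hne₂ with ⟨a₂, b₂⟩ | ⟨a₂, b₂⟩ <;>
    simp only [abs_of_pos, abs_of_neg, sub_pos, sub_neg, b₀, b₁, b₂] at hd₁ hd₂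
    · obtain ⟨k, h1, h2, h3⟩ := hright ht₀ ht₁ hr₀ hsl₀ hsl₁ a₁ b₁ (by linarith)
      exact Or.inl ⟨k, h1, by linarith, h3⟩
    · obtain ⟨k, h1, h2, h3⟩ := hright ht₀ ht₁ hr₀ hsl₀ hsl₁ a₁ b₁ (by linarith)
      exact Or.inl ⟨k, h1, by linarith, h3⟩
    · obtain ⟨k, h1, h2, h3⟩ := hright ht₀ ht₂ hr₀ hsl₀ hsl₂ a₂ b₂ (by linarith)
      exact Or.inl ⟨k, h1, by linarith, h3⟩
    · obtain ⟨k, h1, h2, h3⟩ := hleft ht₁ ht₂ hr₁ hsl₁ hsl₂ a₂ b₂ (by linarith)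
      exact Or.inr ⟨k, h1, by linarith, h3⟩
    · obtain ⟨k, h1, h2, h3⟩ := hright ht₁ ht₂ hr₁ hsl₁ hsl₂ a₂ b₂ (by linarith)
      exact Or.inl ⟨k, h1, by linarith, h3⟩
    · obtain ⟨k, h1, h2, h3⟩ := hleft ht₀ ht₂ hr₀ hsl₀ hsl₂ a₂ b₂ (by linarith)
      exact Or.inr ⟨k, h1, by linarith, h3⟩
    · obtain ⟨k, h1, h2, h3⟩ := hleft ht₀ ht₁ hr₀ hsl₀ hsl₁ a₁ b₁ (by linarith)
      exact Or.inr ⟨k, h1, by linarith, h3⟩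
    · obtain ⟨k, h1, h2, h3⟩ := hleft ht₀ ht₁ hr₀ hsl₀ hsl₁ a₁ b₁ (by linarith)
      exact Or.inr ⟨k, h1, by linarith, h3⟩
  rcases hfin with ⟨k, h1, h2, h3⟩ | ⟨k, h1, h2, h3⟩
  · exact ⟨k, h1.ne', abs_lt.2 ⟨by linarith, by linarith⟩, h3⟩
  · exact ⟨k, h1.ne, abs_lt.2 ⟨by linarith, by linarith⟩, h3⟩


end TwoGoods

/-! ### Assembly of the proposition. -/

theorem proposition1 (f p : ℝ × ℝ → ℝ) (hf : TwoGoods.IsSRS f)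
    (hp : TwoGoods.IsOptimal f p) (hsymm : TwoGoods.IsSymmetric p) :
    -- the sets defining `a^q` and `b^q` are nonempty closed intervals
    (∀ q ∈ Set.Icc (0 : ℝ) 1, TwoGoods.lowerEnd p q ≤ TwoGoods.upperEnd p q ∧
      TwoGoods.buyers p q = Set.Icc (TwoGoods.lowerEnd p q) (TwoGoods.upperEnd p q)) ∧
    -- active bundles
    (∀ q : ℝ × ℝ, TwoGoods.IsActive f p q →
      (q.1 = 1 ∨ q.2 = 1) ∧ TwoGoods.IsActive f p q.swap) ∧
    -- pooling bundles
    (∀ q : ℝ, TwoGoods.IsPooling f p (q, 1) →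
      TwoGoods.marginalRevenue f p (q, 1) = 0 ∧
      (∫ t in (TwoGoods.lowerEnd p q)..(TwoGoods.upperEnd p q), TwoGoods.Phi f p t) = 0 ∧
      (q ≠ 0 → 0 ≤ TwoGoods.Phi f p (TwoGoods.lowerEnd p q)) ∧
      (q ≠ 1 → 0 ≤ TwoGoods.Phi f p (TwoGoods.upperEnd p q))) ∧
    -- the grand bundle
    TwoGoods.IsPooling f p (1, 1) ∧
    -- separating bundles
    (∀ q : ℝ, TwoGoods.IsSeparating f p (q, 1) →
      TwoGoods.lowerEnd p q = TwoGoods.upperEnd p q ∧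
      TwoGoods.Phi f p (TwoGoods.lowerEnd p q) = 0) := by
  have hF := hp.feasible
  have hv := hp.isProfile hf hsymm
  refine ⟨fun q hq => hF.buyers_eq_Icc hq,
    fun q hq => ⟨hp.eq_one_of_isActive hf hsymm hq, hq.swap hf hsymm⟩, fun q h => ?_,
    hp.isPooling_grand hf hsymm,
    fun q h => ⟨hp.lowerEnd_eq_upperEnd hf hsymm h, hp.Phi_eq_zero_of_isSeparating hf hsymm h⟩⟩
  have hq := h.mem_Icc
  have h0 := hp.integral_Phi_eq_zero_of_isPooling hf hsymm h
  refine ⟨?_, h0, fun hne => ?_, fun hne => ?_⟩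
  · rw [hp.marginalRevenue_eq hf hsymm hq, h0, mul_zero]
  · exact (hp.of_isKink hf hsymm (hF.lowerEnd_mem hq).1 (hF.isKink_lowerEnd hv hq hne)).2
  · exact (hp.of_isKink hf hsymm (hF.upperEnd_mem hq).1 (hF.isKink_upperEnd hv hq hne)).2
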